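/- Let $G$ be a connected reductive complex algebraic group with maximal torus $T$, character lattice $X$, cocharacter lattice $X^\vee$, Weyl group $W$, simple roots $\alpha_i$ and simple coroots $\alpha_i^\vee$ ($i\in I$), and coroot lattice $Q^\vee\subset X^\vee$. Let $\tilde W=X^\vee\rtimes W$ be the extended affine Weyl group, with translations $t_\lambda$ ($\lambda\in X^\vee$), and let $\hat W=Q^\vee\rtimes W$ be the affine Weyl group, a Coxeter group with generators $s_i$ ($i\in I$) and $s_0=t_{\theta^\vee}s_\theta$ for the highest root $\theta$ (one such generator for each irreducible component of the root system), indexed by $\tilde I$; put $\alpha_0=-\theta$. Let $\Omega\subset\tilde W$ be the subgroup of elements permuting the affine simple roots ($\alpha_i$ for $i\in I$, and $\delta-\theta$), where $t_\mu u$ acts by $\alpha+k\delta\mapsto u\alpha+(k-\langle\mu,u\alpha\rangle)\delta$; it is isomorphic to $\pi_1(G)$. Every $w\in\tilde W$ is uniquely $w=\pi v$ with $\pi\in\Omega$, $v\in\hat W$. Length and Bruhat order extend from $\hat W$ to $\tilde W$ by $\ell(\pi v)=\ell(v)$, and $\pi v\le\pi'v'$ iff $\pi=\pi'$ and $v\le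 v'$. Let $\tilde W^0$ be the set of affine Grassmannian elements, i.e. those $w\in\tilde W$ with $ws_i>w$ for all $i\in I$. Let $R=\mathbb Z[X]$, and let $R^\Delta$ be its localization at the elements $c(\alpha)=1-e^\alpha$ for all roots $\alpha$. In the smash product of $R^\Delta$ with $\mathbb Z[\tilde W]$, where $\tilde W$ acts on $R^\Delta$ through $\tilde W\to W$, put $T_i=c(\alpha_i)^{-1}(s_i-1)$ for $i\in\tilde I$, and $T_{\pi v}=\pi T_{i_1}\cdots T_{i_n}$ for $\pi\in\Omega$ and any reduced word $v=s_{i_1}\cdots s_{i_n}$ in $\hat W$. Let $\mathbb K$ be the subring generated by $R$, the $T_i$ and $\Omega$, and let $\mathbb L$ be the centralizer of $R$ in $\mathbb K$. For $w\in\tilde W^0$ let $k_w$ be the unique element of $\mathbb L$ of the form $T_w+\sum_{v\notin\tilde W^0}f_vT_v$ (a finite sum, $f_v\in R$), and let $\ell_w=\sum_{v\in\tilde W^0,\,v\le w}k_v$. Then the decomposition $w=\pi v$, the elements $T_w$ and $k_w$, and the sums $\ell_w$ (the Bruhat order has finite lower intervals) are well defined, and the following hold. (1) Let $w\in\tilde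 W^0$ and let $\lambda\in X^\vee$ be antidominant, i.e. $\langle\lambda,\alpha_i\rangle\le0$ for all $i\in I$. Then $wt_\lambda\in\tilde W^0$, $\ell(wt_\lambda)=\ell(w)+\ell(t_\lambda)$, and $\ell_{wt_\lambda}=\ell_w\,\ell_{t_\lambda}$. (2) Let $i\in I$ and suppose that $\varpi_i^\vee\in X^\vee$ satisfies $\langle\varpi_i^\vee,\alpha_j\rangle=\delta_{ij}$ for all $j\in I$. Let $\pi_i\in\Omega$ be the element with $t_{\varpi_i^\vee}\in\pi_i\hat W$, and let $\kappa_i\in\hat W$ be the element with $t_{-\varpi_i^\vee}\in\Omega\,\kappa_i$ (so $t_{-\varpi_i^\vee}=\pi_i^{-1}\kappa_i$). If $w\in\tilde W$ satisfies $w\kappa_i\in\tilde W^0$ and $\ell(w\kappa_i)=\ell(w)+\ell(\kappa_i)$, then $\pi_i^{-1}w\pi_i\in\tilde W^0$ and $$\ell_{w\kappa_i}=\ell_{\kappa_i}\cdot\pi_i\,\ell_{\pi_i^{-1}w\pi_i}\,\pi_i^{-1}.$$ -/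

import Mathlib

noncomputable section

namespace AffNilHecke

variable {ι X Y : Type*} [AddCommGroup X] [AddCommGroup Y] (P : RootPairing ι ℤ X Y)

/-! ### The extended affine Weyl group -/

/-- The finite Weyl group acting (on the left) on the cocharacter lattice: the contragredient
of its action on the character lattice, so that `⟨uμ, uλ⟩ = ⟨μ, λ⟩`. -/
def coweightAct : P.weylGroup →* (Y ≃ₗ[ℤ] Y) where
  toFun u := RootPairing.Equiv.coweightEquiv P P (u⁻¹ : P.weylGroup).1
  map_one' := by
    ext y
    simp
  map_mul' u v := by
    ext y
    simp [mul_inv_rev]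

/-- The same action on the cocharacter lattice written multiplicatively. -/
def translationAct : P.weylGroup →* MulAut (Multiplicative Y) where
  toFun u := AddEquiv.toMultiplicative (coweightAct P u).toAddEquiv
  map_one' := by
    ext y
    simp
  map_mul' u v := by
    ext y
    simp

/-- The extended affine Weyl group: the cocharacter lattice `Y` (translations) semidirect the
finite Weyl group. -/
abbrev ExtAffWeyl : Type _ := Multiplicative Y ⋊[translationAct P] P.weylGroup

/-- The translation element `t_μ`. -/
def trans (μ : Y) : ExtAffWeyl P := SemidirectProduct.inl (Multiplicative.ofAdd μ)

/-- An element of the finite Weyl group, in the extended affine Weyl group. -/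
def fin (u : P.weylGroup) : ExtAffWeyl P := SemidirectProduct.inr u

/-- The homomorphism `cl` to the finite Weyl group, `t_μ u ↦ u`. -/
def cl : ExtAffWeyl P →* P.weylGroup := SemidirectProduct.rightHom

/-- Action of the extended affine Weyl group on the lattice `X ⊕ ℤδ` that contains the affine
roots: `t_μ u (x + kδ) = u x + (k - ⟨μ, u x⟩) δ`. -/
def affAct (w : ExtAffWeyl P) (p : X × ℤ) : X × ℤ :=
  (cl P w • p.1, p.2 - P.toLinearMap (cl P w • p.1) (Multiplicative.toAdd w.left))

variable {P} (b : P.Base)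

/-- The root with index `j` is a highest root: it is maximal for the order in which `α ≤ β` if
`β - α` is a sum of simple roots. (There is one such root for each irreducible component.) -/
def IsHighestRoot (j : ι) : Prop :=
  ∀ i, P.root i - P.root j ∈ AddSubmonoid.closure (P.root '' b.support) → i = j

/-- The nodes of the affine Dynkin diagram: the nodes of the finite one and one more node for each
highest root. -/
abbrev AffNode : Type _ := b.support ⊕ {j : ι // IsHighestRoot b j}

/-- The simple reflections: `s_i` for a finite node and `t_{θ^∨} s_θ` for a highest root `θ`. -/
def simpleRefl : AffNode b → ExtAffWeyl P
  | .inl i => fin P (RootPairing.weylGroup.ofIdx P i)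
  | .inr j => trans P (P.coroot j) * fin P (RootPairing.weylGroup.ofIdx P j)

/-- The affine simple roots: `α_i` for a finite node and `δ - θ` for a highest root `θ`. -/
def affSimpleRoot : AffNode b → X × ℤ
  | .inl i => (P.root i, 0)
  | .inr j => (-P.root j, 1)

/-- The (index of the) level zero affine simple root: `α_i` for a finite node and `-θ` for a
highest root `θ`. -/
def levelZeroIdx : AffNode b → ι
  | .inl i => i
  | .inr j => P.reflectionPerm j j

lemma root_levelZeroIdx (a : AffNode b) : P.root (levelZeroIdx b a) = (affSimpleRoot b a).1 := by
  rcases a with i | j <;> simp [levelZeroIdx, affSimpleRoot]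

/-- The fundamental group `Ω ≅ π₁(G)` inside the extended affine Weyl group: the elements that
permute the affine simple roots. -/
def IsFundamental (w : ExtAffWeyl P) : Prop :=
  affAct P w '' Set.range (affSimpleRoot b) = Set.range (affSimpleRoot b)

/-- Membership in the affine Weyl group: the translation part lies in the coroot lattice. -/
def IsAffine (w : ExtAffWeyl P) : Prop :=
  Multiplicative.toAdd w.left ∈ AddSubgroup.closure (P.coroot '' b.support)

/-- `p = (π, v)` is the decomposition `w = π v` with `π` in the fundamental group and `v` in the
affine Weyl group. -/
def IsFundAffDecomp (w : ExtAffWeyl P) (p : ExtAffWeyl P × ExtAffWeyl P) : Prop :=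
  IsFundamental b p.1 ∧ IsAffine b p.2 ∧ w = p.1 * p.2

/-- The decomposition `w = π v` (it exists and is unique). -/
def fundAff (w : ExtAffWeyl P) : ExtAffWeyl P × ExtAffWeyl P :=
  Classical.epsilon (IsFundAffDecomp b w)

/-- The component `π` of `w = π v`. -/
def fundPart (w : ExtAffWeyl P) : ExtAffWeyl P := (fundAff b w).1

/-- The component `v` of `w = π v`. -/
def affPart (w : ExtAffWeyl P) : ExtAffWeyl P := (fundAff b w).2

/-- The product of the simple reflections in a word. -/
def wordProd (l : List (AffNode b)) : ExtAffWeyl P := (l.map (simpleRefl b)).prod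

/-- Coxeter length on the affine Weyl group. -/
def coxLength (v : ExtAffWeyl P) : ℕ := sInf {n | ∃ l : List (AffNode b), l.length = n ∧ wordProd b l = v}

/-- Length on the extended affine Weyl group, `ℓ(π v) = ℓ(v)`. -/
def length (w : ExtAffWeyl P) : ℕ := coxLength b (affPart b w)

/-- A reduced word of an element of the affine Weyl group. -/
def IsReducedWord (v : ExtAffWeyl P) (l : List (AffNode b)) : Prop :=
  wordProd b l = v ∧ l.length = coxLength b v

/-- Reflections of the affine Weyl group: the conjugates of the simple reflections. -/
def IsRefl (t : ExtAffWeyl P) : Prop :=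
  ∃ v a, IsAffine b v ∧ t = v * simpleRefl b a * v⁻¹

/-- Bruhat order on the affine Weyl group: generated by `v < v t` for reflections `t` with
`ℓ(v) < ℓ(v t)`. -/
def affBruhatLE : ExtAffWeyl P → ExtAffWeyl P → Prop :=
  Relation.ReflTransGen fun u v ↦ coxLength b u < coxLength b v ∧ ∃ t, IsRefl b t ∧ v = u * t

/-- Bruhat order on the extended affine Weyl group: `π v ≤ π' v'` if `π = π'` and `v ≤ v'`. -/
def bruhatLE (v w : ExtAffWeyl P) : Prop :=
  fundPart b v = fundPart b w ∧ affBruhatLE b (affPart b v) (affPart b w)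

/-- Affine Grassmannian elements: `w < w s_i` for all finite nodes `i`. -/
def IsGrassmannian (w : ExtAffWeyl P) : Prop :=
  ∀ i : b.support, bruhatLE b w (w * simpleRefl b (.inl i)) ∧ w ≠ w * simpleRefl b (.inl i)

/-- Antidominant cocharacters. -/
def IsAntidominant (μ : Y) : Prop := ∀ i ∈ b.support, P.toLinearMap (P.root i) μ ≤ 0

/-! ### The localized representation ring and the level zero action -/

variable (X) in
/-- The representation ring `R(T) = ℤ[X]` of the torus. -/
abbrev RepRing : Type _ := AddMonoidAlgebra ℤ X

/-- `c(x) = 1 - e^x`. -/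
def c (x : X) : RepRing X := 1 - AddMonoidAlgebra.single x 1

variable (P) in
/-- The multiplicative set generated by the `c(α)` for all roots `α`. -/
def rootMonoid : Submonoid (RepRing X) := Submonoid.closure (Set.range fun i ↦ c (P.root i))

variable (P) in
/-- The localization of `R(T)` at the `c(α)`. -/
abbrev LocRep : Type _ := Localization (rootMonoid P)

variable (P) in
/-- The action of the finite Weyl group on `R(T)`, `u e^x = e^{u x}`. -/
def repAct : P.weylGroup →* RingAut (RepRing X) where
  toFun u := (AddMonoidAlgebra.domCongr ℤ ℤ (DistribMulAction.toAddEquiv X u)).toRingEquiv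
  map_one' := by
    apply RingEquiv.toRingHom_injective
    ext x <;> simp
  map_mul' u v := by
    apply RingEquiv.toRingHom_injective
    ext x <;> simp [mul_smul]

lemma repAct_c (u : P.weylGroup) (x : X) : repAct P u (c x) = c (u • x) := by
  simp [repAct, c]

lemma repAct_mem (u : P.weylGroup) {f : RepRing X} (hf : f ∈ rootMonoid P) :
    repAct P u f ∈ rootMonoid P := by
  induction hf using Submonoid.closure_induction with
  | mem f hf =>
    obtain ⟨i, rfl⟩ := hf
    refine Submonoid.subset_closure ⟨P.weylGroupToPerm u i, ?_⟩
    rw [repAct_c, P.weylGroup_apply_root]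
  | one => simp
  | mul f g _ _ hf hg => rw [map_mul]; exact mul_mem hf hg

variable (P) in
/-- The action of one element of the finite Weyl group on the localization. -/
def locMap (u : P.weylGroup) : LocRep P →+* LocRep P :=
  IsLocalization.map (LocRep P) (repAct P u : RepRing X →+* RepRing X)
    (show rootMonoid P ≤ (rootMonoid P).comap _ from fun _ hf ↦ repAct_mem u hf)

lemma locMap_algebraMap (u : P.weylGroup) (f : RepRing X) :
    locMap P u (algebraMap _ _ f) = algebraMap _ _ (repAct P u f) := by
  simp [locMap]

/-- The level zero action of the extended affine Weyl group on the localization: `w` acts through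
its finite part `cl(w)`. -/
instance levelZeroAction : MulSemiringAction (ExtAffWeyl P) (LocRep P) where
  smul w f := locMap P (cl P w) f
  one_smul f := by
    have : locMap P (cl P 1) = RingHom.id _ :=
      IsLocalization.ringHom_ext (rootMonoid P) (by
        ext x <;> simp [locMap_algebraMap])
    exact congrArg (fun g : LocRep P →+* LocRep P ↦ g f) this
  mul_smul v w f := by
    have : locMap P (cl P (v * w)) = (locMap P (cl P v)).comp (locMap P (cl P w)) :=
      IsLocalization.ringHom_ext (rootMonoid P) (by
        ext x <;> simp [locMap_algebraMap])
    exact congrArg (fun g : LocRep P →+* LocRep P ↦ g f) this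
  smul_zero w := map_zero (locMap P (cl P w))
  smul_add w := map_add (locMap P (cl P w))
  smul_one w := map_one (locMap P (cl P w))
  smul_mul w := map_mul (locMap P (cl P w))

/-! ### The `K`-nil-Hecke ring -/

variable (P) in
/-- The smash product of the localized representation ring and the extended affine Weyl group:
`(f ⊗ v) (g ⊗ w) = f v(g) ⊗ v w`. -/
abbrev Smash : Type _ := SkewMonoidAlgebra (LocRep P) (ExtAffWeyl P)

variable (P) in
/-- The inclusion of `R(T)` in the smash product. -/
def scalar : RepRing X →+* Smash P :=
  (SkewMonoidAlgebra.singleOneRingHom : LocRep P →+* Smash P).comp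
    (algebraMap (RepRing X) (LocRep P))

/-- A group element in the smash product. -/
def elt (w : ExtAffWeyl P) : Smash P := SkewMonoidAlgebra.of (LocRep P) (ExtAffWeyl P) w

variable (P) in
/-- The scalar `c(α)⁻¹`, for a root `α`. -/
def cInv (i : ι) : LocRep P :=
  Localization.mk 1 ⟨c (P.root i), Submonoid.subset_closure ⟨i, rfl⟩⟩

/-- `T_i = c(α_i)⁻¹ (s_i - 1)` for a node `i` of the affine Dynkin diagram. -/
def TNode (a : AffNode b) : Smash P :=
  SkewMonoidAlgebra.single 1 (cInv P (levelZeroIdx b a)) * (elt (simpleRefl b a) - 1)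

/-- `x` is the value `π T_{i₁} ⋯ T_{iₙ}` at a reduced word `i₁ … iₙ` of `v`, where `w = π v`. -/
def IsTElt (w : ExtAffWeyl P) (x : Smash P) : Prop :=
  ∃ l, IsReducedWord b (affPart b w) l ∧ x = elt (fundPart b w) * (l.map (TNode b)).prod

/-- The element `T_w` (by the braid relations it does not depend on the reduced word). -/
def T (w : ExtAffWeyl P) : Smash P := Classical.epsilon (IsTElt b w)

/-- The level zero affine `K`-nil-Hecke ring, generated by `R(T)`, the `T_i` and the fundamental
group. -/
def nilHecke : Subring (Smash P) :=
  Subring.closure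
    (Set.range (scalar P) ∪ Set.range (TNode b) ∪ {x | ∃ w, IsFundamental b w ∧ x = elt w})

/-- The `K`-Peterson algebra: the centralizer of `R(T)` in the `K`-nil-Hecke ring. -/
def peterson : Subring (Smash P) :=
  nilHecke b ⊓ Subring.centralizer (Set.range (scalar P))

/-- `x` lies in the `K`-Peterson algebra and has the form `T_w + ∑ f_v T_v`, a finite sum over
`v` that are not affine Grassmannian, with `f_v` in `R(T)`. -/
def IsKClass (w : ExtAffWeyl P) (x : Smash P) : Prop :=
  x ∈ peterson b ∧ ∃ f : ExtAffWeyl P →₀ RepRing X,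
    (∀ v ∈ f.support, ¬ IsGrassmannian b v) ∧ x = T b w + f.sum fun v r ↦ scalar P r * T b v

/-- The basis element `k_w` of the `K`-Peterson algebra, for `w` affine Grassmannian. -/
def kClass (w : ExtAffWeyl P) : Smash P := Classical.epsilon (IsKClass b w)

/-- `ℓ_w`, the (finite) sum of the `k_v` for `v ≤ w` affine Grassmannian. -/
def ellClass (w : ExtAffWeyl P) : Smash P :=
  ∑ᶠ v ∈ {v | IsGrassmannian b v ∧ bruhatLE b v w}, kClass b v

/-! ### The elements of the factorization -/

/-- For a fundamental coweight `ϖ`, the element `π` of the fundamental group with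
`t_ϖ ∈ π · (affine Weyl group)`. -/
def fundElt (ϖ : Y) : ExtAffWeyl P := fundPart b (trans P ϖ)

/-- For a fundamental coweight `ϖ`, the component `κ` of `t_{-ϖ}` in the affine Weyl group. -/
def kappa (ϖ : Y) : ExtAffWeyl P := affPart b (trans P (-ϖ))

/-- `ϖ` is a cocharacter that is a fundamental coweight for the simple root with index `i`. -/
def IsFundCoweight (i : ι) (ϖ : Y) : Prop :=
  P.toLinearMap (P.root i) ϖ = 1 ∧
    ∀ j ∈ b.support, j ≠ i → P.toLinearMap (P.root j) ϖ = 0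

end AffNilHecke

end

noncomputable section

namespace AffNilHecke

variable {ι X Y : Type*} [AddCommGroup X] [AddCommGroup Y] {P : RootPairing ι ℤ X Y}

/-! ### The finite Weyl group on characters and cocharacters -/

/-! The proof rests on the projection `proj` of the smash product onto the span of the translations:
it is left linear over the localized ring and sends `t_μ u` to `t_μ`. Right multiplication by a
finite `T_i` lands in its kernel, so it kills `T_v` whenever `v` is not affine Grassmannian. It maps
the nil-Hecke ring to itself (`proj_mem`); by `proj_mul_proj` this reduces to the generators, where
an explicit formula decides. Its fixed points in the nil-Hecke ring form exactly the Peterson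
algebra (`mem_peterson_iff`). The images of the `T_v` with `v` affine Grassmannian are linearly
independent, because `T_v` is triangular in the group elements and such a `v` is the unique shortest
element of `vW`. Hence `k_w` exists, is unique and equals `proj T_w` (`kClass_eq`), and `ℓ_w` is the
projection of the sum of all `T_v` with `v ≤ w` (`ellClass_eq`).

That full sum, `lowerSum`, is an element of `Ω` times the product of the idempotents `1 + T_i` along
a reduced word, by the lifting property of the Bruhat order and `T_i² = -T_i`. It is therefore
multiplicative whenever lengths add (`lowerSum_mul`). It remains to see when the projection respects
such a product. Always `proj (x y) = proj (x proj y)`, and this is `proj x proj y` as soon as `proj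
y` commutes with `W` (`proj_mul_proj_of_comm`). Take `y = lowerSum t_μ` with `μ` antidominant.
Either `s_i t_μ < t_μ`, and `T_i y = 0`, or `⟨μ, α_i⟩ = 0`, and `s_i` commutes with `t_μ`, so that
`T_i y = y T_i`. Both times `proj (T_i y) = 0`, which says that `proj y` commutes with `s_i`. This
proves (1).

For (2), `κ = π t_{-ϖ}`, and `w κ = π w' t_{-ϖ}` with `w' = π⁻¹ w π`. The same argument gives
`ℓ_{wκ} = proj (π lowerSum w') ℓ_{t_{-ϖ}}` and `ℓ_κ = proj (π) ℓ_{t_{-ϖ}}`. Since `proj (π x) = π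
proj (x) π⁻¹ proj (π)` and the span of the translations over the localized ring is commutative, the
factorization follows.

That lengths, Bruhat order and the `T_w` behave as expected is derived from the action on affine
real roots. The length is the number of inversions, the exchange property gives Matsumoto's theorem,
and the braid relations for the `T_i` are checked in rank two, in coordinates on the cosets of a
reflection. -/

lemma toLinearMap_smul_left (u : P.weylGroup) (x : X) (y : Y) :
    P.toLinearMap (u • x) y = P.toLinearMap x (coweightAct P u⁻¹ y) := by
  have h := DFunLike.congr_fun
    (RootPairing.Hom.weight_coweight_transpose_apply P P y u.1.toHom) x
  have e : coweightAct P u⁻¹ y = u.1.coweightMap y := by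
    simp [coweightAct]
  rw [e]
  exact h

lemma toLinearMap_smul_coweightAct (u : P.weylGroup) (x : X) (y : Y) :
    P.toLinearMap (u • x) (coweightAct P u y) = P.toLinearMap x y := by
  rw [toLinearMap_smul_left, ← LinearEquiv.mul_apply, ← map_mul]
  simp

lemma weylGroup_smul_injective {u v : P.weylGroup} (h : ∀ x : X, u • x = v • x) : u = v := by
  apply Subtype.ext
  apply RootPairing.Equiv.weightHom_injective P
  ext x
  exact h x

lemma coweight_ext {y z : Y} (h : ∀ x : X, P.toLinearMap x y = P.toLinearMap x z) : y = z := by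
  apply P.flip.toPerfPair.injective
  ext x
  exact h x

lemma smul_root (u : P.weylGroup) (i : ι) :
    u • P.root i = P.root (P.weylGroupToPerm u i) := P.weylGroup_apply_root u i

lemma ofIdx_smul_eq (i : ι) (x : X) :
    RootPairing.weylGroup.ofIdx P i • x = P.reflection i x := rfl

lemma weylGroupToPerm_ofIdx (i : ι) :
    P.weylGroupToPerm (RootPairing.weylGroup.ofIdx P i) = P.reflectionPerm i := rfl

lemma ofIdx_mul_self (i : ι) :
    RootPairing.weylGroup.ofIdx P i * RootPairing.weylGroup.ofIdx P i = 1 := by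
  apply weylGroup_smul_injective
  intro x
  rw [mul_smul, ofIdx_smul_eq, ofIdx_smul_eq, RootPairing.reflection_same, one_smul]

lemma ofIdx_inv (i : ι) :
    (RootPairing.weylGroup.ofIdx P i)⁻¹ = RootPairing.weylGroup.ofIdx P i :=
  inv_eq_of_mul_eq_one_left (ofIdx_mul_self i)

lemma coweightAct_coroot (u : P.weylGroup) (i : ι) :
    coweightAct P u (P.coroot i) = P.coroot (P.weylGroupToPerm u i) := by
  have h := RootPairing.Hom.coroot_coweightMap_apply P P i (u⁻¹ : P.weylGroup).1.toHom
  exact h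

lemma coweightAct_ofIdx (i : ι) (y : Y) :
    coweightAct P (RootPairing.weylGroup.ofIdx P i) y = P.coreflection i y := by
  apply coweight_ext (P := P)
  intro x
  rw [← ofIdx_inv, ← toLinearMap_smul_left, ofIdx_smul_eq, RootPairing.reflection_apply,
    RootPairing.coreflection_apply]
  simp [mul_comm]

lemma toLinearMap_smul_coroot (u : P.weylGroup) (x : X) (i : ι) :
    P.toLinearMap (u • x) (P.coroot (P.weylGroupToPerm u i)) = P.toLinearMap x (P.coroot i) := by
  rw [← coweightAct_coroot, toLinearMap_smul_coweightAct]

lemma reflection_eq (i : ι) (x : X) :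
    P.reflection i x = x - P.toLinearMap x (P.coroot i) • P.root i := by
  rw [RootPairing.reflection_apply]; rfl

lemma ofIdx_conj (u : P.weylGroup) (i : ι) :
    u * RootPairing.weylGroup.ofIdx P i * u⁻¹ =
      RootPairing.weylGroup.ofIdx P (P.weylGroupToPerm u i) := by
  apply weylGroup_smul_injective
  intro x
  rw [mul_smul, mul_smul, ofIdx_smul_eq, ofIdx_smul_eq, reflection_eq, reflection_eq, smul_sub,
    smul_inv_smul]
  congr 1
  have h := toLinearMap_smul_coroot u (u⁻¹ • x) i
  rw [smul_inv_smul] at h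
  rw [h, ← smul_root]
  exact smul_comm (M := P.Aut) _ _ _

/-! ### Affine real roots -/

/-- The affine real roots `α + kδ`, given by the index of `α` and the level `k`. -/
@[nolint unusedArguments]
def AffRoot (_P : RootPairing ι ℤ X Y) : Type _ := ι × ℤ

/-- The affine real root `α + kδ`. -/
abbrev AffRoot.mk (P : RootPairing ι ℤ X Y) (i : ι) (k : ℤ) : AffRoot P := (i, k)

/-- The affine real root as an element of `X ⊕ ℤδ`. -/
def AffRoot.real (β : AffRoot P) : X × ℤ := (P.root β.1, β.2)

lemma AffRoot.real_injective : Function.Injective (AffRoot.real (P := P)) := by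
  rintro ⟨i, k⟩ ⟨j, l⟩ h
  simp only [AffRoot.real, Prod.mk.injEq, EmbeddingLike.apply_eq_iff_eq] at h
  exact Prod.ext h.1 h.2

lemma cl_mul (v w : ExtAffWeyl P) : cl P (v * w) = cl P v * cl P w := map_mul _ _ _

lemma toAdd_left_mul (v w : ExtAffWeyl P) :
    Multiplicative.toAdd (v * w).left =
      Multiplicative.toAdd v.left + coweightAct P (cl P v) (Multiplicative.toAdd w.left) := rfl

lemma affAct_one (p : X × ℤ) : affAct P 1 p = p := by
  simp [affAct]

lemma affAct_mul (v w : ExtAffWeyl P) (p : X × ℤ) :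
    affAct P (v * w) p = affAct P v (affAct P w p) := by
  ext
  · simp [affAct, cl_mul, mul_smul]
  · simp only [affAct, cl_mul, toAdd_left_mul, map_add, mul_smul, toLinearMap_smul_coweightAct]
    ring

lemma affAct_add (w : ExtAffWeyl P) (p q : X × ℤ) :
    affAct P w (p + q) = affAct P w p + affAct P w q := by
  ext
  · simp [affAct]
  · simp [affAct]; ring

lemma affAct_neg (w : ExtAffWeyl P) (p : X × ℤ) :
    affAct P w (-p) = - affAct P w p := by
  ext
  · simp [affAct]
  · simp [affAct]; ring

lemma affAct_delta (w : ExtAffWeyl P) (k : ℤ) : affAct P w (0, k) = (0, k) := by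
  simp [affAct]

/-- The formula is the one that makes `AffRoot.real` equivariant; as that map is injective, the
axioms are inherited from `affAct`. -/
instance : MulAction (ExtAffWeyl P) (AffRoot P) where
  smul w β := (P.weylGroupToPerm (cl P w) β.1,
    β.2 - P.toLinearMap (cl P w • P.root β.1) (Multiplicative.toAdd w.left))
  one_smul β := by
    apply AffRoot.real_injective
    refine Eq.trans ?_ (affAct_one (P := P) β.real)
    exact Prod.ext (smul_root _ _).symm rfl
  mul_smul v w β := by
    apply AffRoot.real_injective
    have key (w : ExtAffWeyl P) (β : AffRoot P) : AffRoot.real (P := P)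
        (P.weylGroupToPerm (cl P w) β.1,
          β.2 - P.toLinearMap (cl P w • P.root β.1) (Multiplicative.toAdd w.left)) =
        affAct P w β.real := Prod.ext (smul_root _ _).symm rfl
    refine (key _ _).trans ?_
    rw [affAct_mul]
    exact (congrArg _ (key w β).symm).trans (key v _).symm

lemma AffRoot.real_smul (w : ExtAffWeyl P) (β : AffRoot P) :
    (w • β).real = affAct P w β.real := Prod.ext (smul_root _ _).symm rfl

lemma AffRoot.smul_fst (w : ExtAffWeyl P) (β : AffRoot P) :
    (w • β).1 = P.weylGroupToPerm (cl P w) β.1 := rfl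

instance : Neg (AffRoot P) where
  neg β := (P.reflectionPerm β.1 β.1, -β.2)

lemma AffRoot.real_neg (β : AffRoot P) : (-β).real = -β.real :=
  Prod.ext (by
    change P.root (P.reflectionPerm β.1 β.1) = -P.root β.1
    simp) rfl

instance : InvolutiveNeg (AffRoot P) where
  neg_neg β := by
    apply AffRoot.real_injective
    rw [AffRoot.real_neg, AffRoot.real_neg, neg_neg]

lemma AffRoot.smul_neg (w : ExtAffWeyl P) (β : AffRoot P) : w • (-β) = -(w • β) := by
  apply AffRoot.real_injective
  rw [AffRoot.real_smul, AffRoot.real_neg, AffRoot.real_neg, affAct_neg, AffRoot.real_smul]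

/-- The reflection in an affine real root `α + kδ`: it is `t_{-kα^∨} s_α`. -/
def affRefl (β : AffRoot P) : ExtAffWeyl P :=
  trans P (-(β.2 • P.coroot β.1)) * fin P (RootPairing.weylGroup.ofIdx P β.1)

@[simp] lemma cl_trans (μ : Y) : cl P (trans P μ) = 1 := rfl

@[simp] lemma cl_fin (u : P.weylGroup) : cl P (fin P u) = u := rfl

@[simp] lemma toAdd_left_trans (μ : Y) : Multiplicative.toAdd (trans P μ).left = μ := rfl

@[simp] lemma toAdd_left_fin (u : P.weylGroup) : Multiplicative.toAdd (fin P u).left = 0 := rfl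

lemma cl_affRefl (β : AffRoot P) : cl P (affRefl β) = RootPairing.weylGroup.ofIdx P β.1 := by
  simp [affRefl, cl_mul]

lemma toAdd_left_affRefl (β : AffRoot P) :
    Multiplicative.toAdd (affRefl β).left = -(β.2 • P.coroot β.1) := by
  simp [-SemidirectProduct.mul_left, affRefl, toAdd_left_mul]

lemma extAffWeyl_ext {v w : ExtAffWeyl P} (h : cl P v = cl P w)
    (h' : Multiplicative.toAdd v.left = Multiplicative.toAdd w.left) : v = w :=
  SemidirectProduct.ext h' h

lemma trans_mul_fin (w : ExtAffWeyl P) :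
    trans P (Multiplicative.toAdd w.left) * fin P (cl P w) = w :=
  extAffWeyl_ext (by simp [cl_mul]) (by simp [-SemidirectProduct.mul_left, toAdd_left_mul])

lemma trans_add (μ ν : Y) : trans P (μ + ν) = trans P μ * trans P ν :=
  extAffWeyl_ext (by simp [cl_mul]) (by simp [-SemidirectProduct.mul_left, toAdd_left_mul])

lemma trans_neg (μ : Y) : trans P (-μ) = (trans P μ)⁻¹ :=
  eq_inv_of_mul_eq_one_left (by
    rw [← trans_add, neg_add_cancel]; exact extAffWeyl_ext (by simp) rfl)

lemma trans_zero : trans P (0 : Y) = 1 := extAffWeyl_ext (by simp) rfl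

lemma conj_trans (w : ExtAffWeyl P) (μ : Y) :
    w * trans P μ * w⁻¹ = trans P (coweightAct P (cl P w) μ) := by
  rw [mul_inv_eq_iff_eq_mul]
  exact extAffWeyl_ext (by simp [cl_mul]) (by simp [-SemidirectProduct.mul_left, toAdd_left_mul, add_comm])

lemma affRefl_conj (w : ExtAffWeyl P) (β : AffRoot P) :
    w * affRefl β * w⁻¹ = affRefl (w • β) := by
  rw [mul_inv_eq_iff_eq_mul]
  apply extAffWeyl_ext
  · rw [cl_mul, cl_mul, cl_affRefl, cl_affRefl, AffRoot.smul_fst, ← ofIdx_conj,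
      inv_mul_cancel_right]
  · rw [toAdd_left_mul, toAdd_left_mul, cl_affRefl, toAdd_left_affRefl, toAdd_left_affRefl,
      coweightAct_ofIdx, RootPairing.coreflection_apply, map_neg, map_zsmul, coweightAct_coroot,
      AffRoot.smul_fst]
    change _ = -((β.2 - P.toLinearMap (cl P w • P.root β.1) (Multiplicative.toAdd w.left)) • _) +
      (_ - (P.toLinearMap (P.root _) (Multiplicative.toAdd w.left)) • _)
    rw [smul_root]
    module

lemma affAct_affRefl (β : AffRoot P) (p : X × ℤ) :
    affAct P (affRefl β) p = p - P.toLinearMap p.1 (P.coroot β.1) • β.real := by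
  have h : P.toLinearMap (RootPairing.weylGroup.ofIdx P β.1 • p.1) (P.coroot β.1) =
      -P.toLinearMap p.1 (P.coroot β.1) := by
    rw [ofIdx_smul_eq, reflection_eq]
    simp
    ring
  ext
  · simp [affAct, cl_affRefl, AffRoot.real, reflection_eq]
  · simp only [affAct, cl_affRefl, toAdd_left_affRefl, map_neg, map_zsmul, h, AffRoot.real]
    simp [mul_comm]

lemma affRefl_mul_self (β : AffRoot P) : affRefl β * affRefl β = 1 := by
  apply extAffWeyl_ext
  · rw [cl_mul, cl_affRefl, ofIdx_mul_self, map_one]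
  · rw [toAdd_left_mul, cl_affRefl, toAdd_left_affRefl, coweightAct_ofIdx,
      map_neg, map_zsmul, RootPairing.coreflection_apply_self]
    simp

lemma affRefl_inv (β : AffRoot P) : (affRefl β)⁻¹ = affRefl β :=
  inv_eq_of_mul_eq_one_left (affRefl_mul_self β)

lemma real_affRefl_smul (β γ : AffRoot P) :
    (affRefl β • γ).real = γ.real - P.pairing γ.1 β.1 • β.real := by
  rw [AffRoot.real_smul, affAct_affRefl]; rfl

lemma affRefl_smul_self (β : AffRoot P) : affRefl β • β = -β := by
  apply AffRoot.real_injective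
  rw [real_affRefl_smul, AffRoot.real_neg, RootPairing.pairing_same]
  module

lemma affRefl_neg (β : AffRoot P) : affRefl (-β) = affRefl β := by
  rw [← affRefl_smul_self, ← affRefl_conj, affRefl_mul_self, one_mul, affRefl_inv]

end AffNilHecke

end

noncomputable section

namespace AffNilHecke

variable {ι X Y : Type*} [AddCommGroup X] [AddCommGroup Y] {P : RootPairing ι ℤ X Y}

/-! ### Positive roots and highest roots -/

lemma pairingIn_int (i j : ι) : P.pairingIn ℤ i j = P.pairing i j := P.algebraMap_pairingIn ℤ i j

lemma isTorsionFree_of_rootPairing (P : RootPairing ι ℤ X Y) : Module.IsTorsionFree ℤ X :=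
  have : Module.IsReflexive ℤ X := .of_isPerfPair P.toLinearMap
  inferInstance

lemma root_reflectionPerm_self (i : ι) : P.root (P.reflectionPerm i i) = -P.root i := by simp

variable (b : P.Base)

/-- The nonnegative combinations of simple roots. -/
def rootCone : AddSubmonoid X := AddSubmonoid.closure (P.root '' b.support)

variable {b}

lemma exists_sum_of_mem_rootCone {x : X} (hx : x ∈ rootCone b) :
    ∃ f : ι → ℤ, 0 ≤ f ∧ x = ∑ j ∈ b.support, f j • P.root j := by
  classical
  induction hx using AddSubmonoid.closure_induction with
  | mem x hx =>
    obtain ⟨i, hi, rfl⟩ := hx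
    refine ⟨Pi.single i 1, by simp, ?_⟩
    rw [Finset.sum_eq_single_of_mem i hi (by simp_all)]
    simp
  | zero => exact ⟨0, le_rfl, by simp⟩
  | add x y _ _ hx hy =>
    obtain ⟨f, hf, rfl⟩ := hx
    obtain ⟨g, hg, rfl⟩ := hy
    exact ⟨f + g, add_nonneg hf hg, by simp [add_smul, Finset.sum_add_distrib]⟩

/-- Height is additive, and a nonnegative combination of simple roots of height zero vanishes. -/
lemma eq_or_height_lt_of_sub_mem_rootCone {i j : ι} (h : P.root i - P.root j ∈ rootCone b) :
    i = j ∨ b.height j < b.height i := by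
  obtain ⟨f, hf, hf'⟩ := exists_sum_of_mem_rootCone h
  obtain ⟨g, -, -, hg⟩ := b.exists_root_eq_sum_int j
  have hi : P.root i = ∑ k ∈ b.support, (f + g) k • P.root k := by
    simp [add_smul, Finset.sum_add_distrib, ← hf', ← hg]
  rw [RootPairing.Base.height_eq_sum hi, RootPairing.Base.height_eq_sum hg]
  rcases (Finset.sum_nonneg fun k (_ : k ∈ b.support) ↦ hf k).eq_or_lt with h0 | h0
  · left
    have : ∀ k ∈ b.support, f k = 0 :=
      (Finset.sum_eq_zero_iff_of_nonneg fun k _ ↦ hf k).mp h0.symm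
    rw [Finset.sum_eq_zero fun k hk ↦ by rw [this k hk, zero_smul], sub_eq_zero] at hf'
    exact P.root.injective hf'
  · right
    simp only [Pi.add_apply, Finset.sum_add_distrib]
    linarith

lemma isPos_of_mem_rootCone {i : ι} (h : P.root i ∈ rootCone b) : b.IsPos i := by
  obtain ⟨f, hf, hf'⟩ := exists_sum_of_mem_rootCone h
  rw [RootPairing.Base.isPos_iff', RootPairing.Base.height_eq_sum hf']
  exact Finset.sum_nonneg fun k _ ↦ hf k

lemma isPos_neg_iff (i : ι) : b.IsPos (P.reflectionPerm i i) ↔ ¬ b.IsPos i :=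
  RootPairing.Base.IsPos.neg_iff_not b i

lemma isPos_iff_mem_rootCone {i : ι} : b.IsPos i ↔ P.root i ∈ rootCone b := by
  refine ⟨fun h ↦ (b.root_mem_or_neg_mem i).resolve_right fun h' ↦ ?_, isPos_of_mem_rootCone⟩
  rw [← root_reflectionPerm_self] at h'
  exact (isPos_neg_iff i).mp (isPos_of_mem_rootCone h') h

lemma root_ne_neg_self (i : ι) : P.reflectionPerm i i ≠ i := by
  intro h
  have h' := root_reflectionPerm_self (P := P) i
  rw [h] at h'
  have := congrArg (fun x ↦ P.toLinearMap x (P.coroot i)) h'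
  simp at this

lemma IsHighestRoot.isPos {j : ι} (hj : IsHighestRoot b j) : b.IsPos j := by
  by_contra h
  rw [← isPos_neg_iff, isPos_iff_mem_rootCone] at h
  refine root_ne_neg_self (P := P) j (hj _ ?_)
  have := add_mem h h
  nth_rewrite 2 [root_reflectionPerm_self] at this
  rwa [← sub_eq_add_neg] at this

variable [Finite ι]

lemma root_sub_mem_of_pairing_pos {i j : ι} (h : 0 < P.pairing i j) (h' : i ≠ j) :
    ∃ k, P.root k = P.root i - P.root j :=
  P.root_sub_root_mem_of_pairingIn_pos (by rwa [pairingIn_int]) h'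

lemma pairing_pos_comm {i j : ι} : 0 < P.pairing i j ↔ 0 < P.pairing j i := by
  have := P.zero_lt_pairingIn_iff' (S := ℤ) (i := i) (j := j)
  rwa [pairingIn_int, pairingIn_int] at this

lemma pairing_neg_comm {i j : ι} : P.pairing i j < 0 ↔ P.pairing j i < 0 := by
  have h1 := P.pairing_reflectionPerm_self_left i j
  have h2 := P.pairing_reflectionPerm_self_right j i
  have h3 := pairing_pos_comm (P := P) (i := P.reflectionPerm i i) (j := j)
  omega

/-- A negative pairing would make `θ + α` a root above `θ`, unless `α = -θ`; but then the negative
of `θ` would lie above it. -/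
lemma IsHighestRoot.pairing_nonneg {i j : ι} (hj : IsHighestRoot b j) (hi : b.IsPos i) :
    0 ≤ P.pairing i j := by
  by_contra! h
  have hneg : 0 < P.pairing j (P.reflectionPerm i i) := by
    have h1 := P.pairing_reflectionPerm_self_right j i
    have := pairing_neg_comm.mp h
    omega
  have hi' := isPos_iff_mem_rootCone.mp hi
  by_cases hij : j = P.reflectionPerm i i
  · have : P.root i - P.root j ∈ rootCone b := by
      rw [hij, root_reflectionPerm_self, sub_neg_eq_add]
      exact add_mem hi' hi'
    have := hj _ this
    exact root_ne_neg_self i (by rw [← hij, this])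
  · obtain ⟨k, hk⟩ := root_sub_mem_of_pairing_pos hneg hij
    rw [root_reflectionPerm_self, sub_neg_eq_add] at hk
    have : k = j := hj k (by rw [hk, add_sub_cancel_left]; exact hi')
    rw [this, left_eq_add] at hk
    exact P.ne_zero i hk

omit [Finite ι] in
lemma IsHighestRoot.isPos_of_root_eq_sub {j k i : ι} (hj : IsHighestRoot b j)
    (h : P.root k = P.root j - P.root i) : b.IsPos k := by
  by_contra hk
  rw [← isPos_neg_iff, isPos_iff_mem_rootCone, root_reflectionPerm_self, h, neg_sub] at hk
  rw [hj i hk, sub_self] at h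
  exact P.ne_zero k h

/-- If `⟨α, θ^∨⟩ ≥ 2` and `α ≠ θ`, then `θ - α` is a positive root and `-s_θ α - θ = (⟨α, θ^∨⟩ - 2)
θ + (θ - α)` lies in the cone. Maximality of `θ` gives `-s_θ α = θ`, that is `α = θ`. -/
lemma IsHighestRoot.pairing_le_one [P.IsReduced] {i j : ι} (hj : IsHighestRoot b j)
    (hij : i ≠ j) : P.pairing i j ≤ 1 := by
  by_contra! h
  have hset := P.pairingIn_pairingIn_mem_set_of_isCrystal_of_isRed i j
  have : Module.IsTorsionFree ℤ X := isTorsionFree_of_rootPairing P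
  have h22 := P.pairingIn_two_two_iff ℤ i j
  rw [pairingIn_int, pairingIn_int] at hset h22
  obtain ⟨k, hk⟩ := root_sub_mem_of_pairing_pos
    (pairing_pos_comm.mp (show 0 < P.pairing i j by omega)) hij.symm
  have hkpos := isPos_iff_mem_rootCone.mp (hj.isPos_of_root_eq_sub hk)
  have hjpos := isPos_iff_mem_rootCone.mp hj.isPos
  have hr : P.root (P.reflectionPerm j i) = P.root i - P.pairing i j • P.root j := by
    rw [P.root_reflectionPerm, P.reflection_apply_root]
  set l := P.reflectionPerm j i with hl
  have hl' : P.reflectionPerm l l = j := by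
    apply hj
    rw [root_reflectionPerm_self, hr]
    have : -(P.root i - P.pairing i j • P.root j) - P.root j =
        (P.pairing i j - 2).toNat • P.root j + P.root k := by
      rw [hk, ← natCast_zsmul, Int.toNat_of_nonneg (by omega)]
      module
    rw [this]
    exact add_mem (nsmul_mem hjpos _) hkpos
  have h1 : P.root l = P.root (P.reflectionPerm j j) := by
    rw [root_reflectionPerm_self, ← hl', root_reflectionPerm_self, neg_neg]
  exact hij ((P.reflectionPerm j).injective (P.root.injective h1))

/-- A root of largest height among those above the given one is maximal. Irreducibility plays no
role. -/
lemma exists_isHighestRoot_ge (b : P.Base) (i : ι) :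
    ∃ j, IsHighestRoot b j ∧ P.root j - P.root i ∈ rootCone b := by
  obtain ⟨j, hj, hmax⟩ := Set.exists_max_image {j | P.root j - P.root i ∈ rootCone b} b.height
    (Set.toFinite _) ⟨i, by simp⟩
  refine ⟨j, fun k hk ↦ ?_, hj⟩
  refine (eq_or_height_lt_of_sub_mem_rootCone hk).resolve_right fun hlt ↦ ?_
  have := hmax k (by
    have := add_mem (show _ ∈ rootCone b from hk) (show _ ∈ rootCone b from hj)
    rwa [sub_add_sub_cancel] at this)
  omega

/-! ### Positive affine roots -/

omit [Finite ι]

/-- Positive affine real roots. -/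
def AffRoot.Pos (b : P.Base) (β : AffRoot P) : Prop := 0 < β.2 ∨ β.2 = 0 ∧ b.IsPos β.1

lemma AffRoot.pos_neg_iff (β : AffRoot P) : (-β).Pos b ↔ ¬ β.Pos b := by
  change (0 < -β.2 ∨ -β.2 = 0 ∧ b.IsPos (P.reflectionPerm β.1 β.1)) ↔
    ¬ (0 < β.2 ∨ β.2 = 0 ∧ b.IsPos β.1)
  rw [isPos_neg_iff]
  rcases lt_trichotomy β.2 0 with h | h | h
  · simp [h, h.ne, h.le]
  · simp [h]
  · simp [h, h.ne', h.le]

variable (b) in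
/-- The affine simple root attached to a node, as an affine real root. -/
def nodeRoot (a : AffNode b) : AffRoot P := (levelZeroIdx b a, (affSimpleRoot b a).2)

lemma real_nodeRoot (a : AffNode b) : (nodeRoot b a).real = affSimpleRoot b a :=
  Prod.ext (root_levelZeroIdx b a) rfl

lemma ofIdx_reflectionPerm_self (i : ι) : RootPairing.weylGroup.ofIdx P (P.reflectionPerm i i) =
    RootPairing.weylGroup.ofIdx P i := by
  rw [← weylGroupToPerm_ofIdx, ← ofIdx_conj, ofIdx_mul_self, one_mul, ofIdx_inv]

lemma simpleRefl_eq (a : AffNode b) : simpleRefl b a = affRefl (nodeRoot b a) := by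
  rcases a with i | j
  · simp [simpleRefl, affRefl, nodeRoot, levelZeroIdx, affSimpleRoot, trans_zero]
  · change _ = trans P (-((1 : ℤ) • P.coroot (P.reflectionPerm j j))) *
      fin P (RootPairing.weylGroup.ofIdx P (P.reflectionPerm j j))
    rw [ofIdx_reflectionPerm_self]
    simp [simpleRefl]

lemma pos_nodeRoot (a : AffNode b) : (nodeRoot b a).Pos b := by
  rcases a with i | j
  · exact Or.inr ⟨rfl, RootPairing.Base.isPos_of_mem_support i.2⟩
  · exact Or.inl Int.one_pos

variable (b) in
/-- Nonnegative combinations of positive affine roots lie in this cone. -/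
def affCone : AddSubmonoid (X × ℤ) where
  carrier := {p | 0 < p.2 ∨ p.2 = 0 ∧ p.1 ∈ rootCone b}
  zero_mem' := Or.inr ⟨rfl, zero_mem _⟩
  add_mem' := by
    rintro p q (hp | ⟨hp, hp'⟩) (hq | ⟨hq, hq'⟩)
    · exact Or.inl (add_pos hp hq)
    · exact Or.inl (by simpa [hq] using hp)
    · exact Or.inl (by simpa [hp] using hq)
    · exact Or.inr ⟨by simp [hp, hq], add_mem hp' hq'⟩

lemma pos_iff_real_mem_affCone {β : AffRoot P} : β.Pos b ↔ β.real ∈ affCone b := by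
  change _ ↔ (0 < β.2 ∨ β.2 = 0 ∧ P.root β.1 ∈ rootCone b)
  rw [← isPos_iff_mem_rootCone]; rfl

lemma prod_zero_mem_closure {x : X} (hx : x ∈ rootCone b) :
    ((x, 0) : X × ℤ) ∈ AddSubmonoid.closure (Set.range (affSimpleRoot b)) := by
  induction hx using AddSubmonoid.closure_induction with
  | mem x hx =>
    obtain ⟨i, hi, rfl⟩ := hx
    exact AddSubmonoid.subset_closure ⟨.inl ⟨i, hi⟩, rfl⟩
  | zero => exact zero_mem _
  | add x y _ _ hx hy => simpa using add_mem hx hy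

/-- For `k > 0` choose a highest root `θ` above `-α` and write `α + kδ = (δ - θ) + (θ + α) + (k -
1)δ`, where `δ = (δ - θ) + θ`. -/
lemma AffRoot.Pos.real_mem_closure [Finite ι] {β : AffRoot P} (hβ : β.Pos b) :
    β.real ∈ AddSubmonoid.closure (Set.range (affSimpleRoot b)) := by
  rcases hβ with h | ⟨h, h'⟩
  · obtain ⟨j, hj, hj'⟩ := exists_isHighestRoot_ge b (P.reflectionPerm β.1 β.1)
    rw [root_reflectionPerm_self, sub_neg_eq_add] at hj'
    have h0 : ((-P.root j, 1) : X × ℤ) ∈ AddSubmonoid.closure (Set.range (affSimpleRoot b)) :=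
      AddSubmonoid.subset_closure ⟨.inr ⟨j, hj⟩, rfl⟩
    have hδ := add_mem h0 (prod_zero_mem_closure (isPos_iff_mem_rootCone.mp hj.isPos))
    have := add_mem (add_mem h0 (prod_zero_mem_closure hj')) (nsmul_mem hδ (β.2 - 1).toNat)
    convert this using 1
    ext
    · simp [AffRoot.real]
    · simp [AffRoot.real]
      omega
  · convert prod_zero_mem_closure (isPos_iff_mem_rootCone.mp h') using 1
    exact Prod.ext rfl h

lemma pos_smul_of_forall_nodeRoot [Finite ι] {w : ExtAffWeyl P}
    (hw : ∀ a, (w • nodeRoot b a).Pos b) {β : AffRoot P} (hβ : β.Pos b) : (w • β).Pos b := by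
  rw [pos_iff_real_mem_affCone, AffRoot.real_smul]
  have h := hβ.real_mem_closure
  generalize β.real = p at h
  induction h using AddSubmonoid.closure_induction with
  | mem p hp =>
    obtain ⟨a, rfl⟩ := hp
    rw [← real_nodeRoot, ← AffRoot.real_smul, ← pos_iff_real_mem_affCone]
    exact hw a
  | zero => rw [show (0 : X × ℤ) = (0, 0) from rfl, affAct_delta]; exact zero_mem _
  | add p q _ _ hp hq => rw [affAct_add]; exact add_mem hp hq

/-- A finite node leaves the level unchanged. An affine node adds `⟨α, θ^∨⟩` to it, which is at
least `0` for `α` positive, at least `-1` for `α` negative and different from `-θ`, and `-2` for `α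
= -θ`. When the level drops to `0`, the new finite part is `α + θ` or `θ`, a positive root. -/
lemma pos_simpleRefl_smul [Finite ι] [P.IsReduced] (a : AffNode b) {β : AffRoot P} (hβ : β.Pos b)
    (hne : β ≠ nodeRoot b a) : (simpleRefl b a • β).Pos b := by
  have hreal := real_affRefl_smul (nodeRoot b a) β
  rw [simpleRefl_eq]
  set γ : AffRoot P := affRefl (nodeRoot b a) • β with hγ
  rcases a with i | ⟨j, hj⟩
  · have h2 : γ.2 = β.2 := by
      have := congrArg Prod.snd hreal
      simpa [AffRoot.real, nodeRoot, affSimpleRoot] using this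
    have h1 : γ.1 = P.reflectionPerm i β.1 := by
      rw [hγ, AffRoot.smul_fst, cl_affRefl, weylGroupToPerm_ofIdx]; rfl
    rcases hβ with h | ⟨h, h'⟩
    · exact Or.inl (h2 ▸ h)
    · refine Or.inr ⟨h2.trans h, h1 ▸ h'.reflectionPerm i.2 fun hi ↦ hne (Prod.ext hi h)⟩
  · have h2 : γ.2 = β.2 + P.pairing β.1 j := by
      have := congrArg Prod.snd hreal
      simpa [AffRoot.real, nodeRoot, affSimpleRoot, levelZeroIdx] using this
    have h1 : P.root γ.1 = P.root β.1 - P.pairing β.1 j • P.root j := by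
      have := congrArg Prod.fst hreal
      simpa [AffRoot.real, nodeRoot, affSimpleRoot, levelZeroIdx] using this
    by_cases hp : b.IsPos β.1
    · have h0 := hj.pairing_nonneg hp
      rcases h0.eq_or_lt with h0 | h0
      · rw [← h0, zero_smul, sub_zero] at h1
        rw [← h0, add_zero] at h2
        have : γ = β := Prod.ext (P.root.injective h1) h2
        rwa [this]
      · refine Or.inl ?_
        have : 0 ≤ β.2 := by rcases hβ with h | h <;> omega
        omega
    · have hβ2 : 0 < β.2 := by
        rcases hβ with h | h
        · exact h
        · exact absurd h.2 hp
      have hn := (isPos_neg_iff β.1).mpr hp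
      by_cases hβj : P.reflectionPerm β.1 β.1 = j
      · have hβ1 : P.root β.1 = -P.root j := by rw [← hβj, root_reflectionPerm_self, neg_neg]
        have hβ1' : β.1 = P.reflectionPerm j j :=
          P.root.injective (by rw [hβ1, root_reflectionPerm_self])
        have hpj : P.pairing β.1 j = -2 := by
          rw [hβ1', P.pairing_reflectionPerm_self_left, P.pairing_same]
        rw [hpj] at h1 h2
        rw [hβ1] at h1
        have hγ1 : γ.1 = j := P.root.injective (by rw [h1]; module)
        have : β.2 ≠ 1 := fun h ↦ hne (Prod.ext hβ1' h)
        rcases (show 2 ≤ β.2 by omega).eq_or_lt with h | h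
        · exact Or.inr ⟨by omega, hγ1 ▸ hj.isPos⟩
        · exact Or.inl (by omega)
      · have hle := hj.pairing_le_one hβj
        have hge := hj.pairing_nonneg hn
        rw [P.pairing_reflectionPerm_self_left] at hle hge
        rcases (show P.pairing β.1 j = 0 ∨ P.pairing β.1 j = -1 by omega) with h0 | h0
        · exact Or.inl (by omega)
        · rcases (show 1 ≤ β.2 by omega).eq_or_lt with h | h
          · refine Or.inr ⟨by omega, hj.isPos_of_root_eq_sub (i := P.reflectionPerm β.1 β.1) ?_⟩
            rw [h1, h0, root_reflectionPerm_self]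
            module
          · exact Or.inl (by omega)

/-! ### Inversions -/

variable (b) in
/-- The positive affine roots that `w` makes negative. -/
def inversions (w : ExtAffWeyl P) : Set (AffRoot P) := {β | β.Pos b ∧ ¬ (w • β).Pos b}

/-- Over a fixed finite root, only levels between `0` and the shift caused by `w` can occur. -/
lemma inversions_finite [Finite ι] (w : ExtAffWeyl P) : (inversions b w).Finite := by
  refine (Set.finite_iUnion fun i : ι ↦ (Set.finite_Icc (0 : ℤ)
    (P.toLinearMap (cl P w • P.root i) (Multiplicative.toAdd w.left))).image
      (fun k ↦ ((i, k) : AffRoot P))).subset ?_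
  rintro ⟨i, k⟩ ⟨h, h'⟩
  refine Set.mem_iUnion.mpr ⟨i, k, ⟨?_, ?_⟩, rfl⟩
  · rcases h with h | h
    · exact h.le
    · exact h.1.ge
  · by_contra! hlt
    exact h' (Or.inl (sub_pos.mpr hlt))

variable (b) in
/-- The number of inversions. -/
def invLength (w : ExtAffWeyl P) : ℕ := (inversions b w).ncard

end AffNilHecke

end

noncomputable section

namespace AffNilHecke

variable {ι X Y : Type*} [AddCommGroup X] [AddCommGroup Y] {P : RootPairing ι ℤ X Y}
variable {b : P.Base}

/-! ### Inversions and multiplication by simple reflections -/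

lemma simpleRefl_mul_self (a : AffNode b) : simpleRefl b a * simpleRefl b a = 1 := by
  rw [simpleRefl_eq, affRefl_mul_self]

lemma simpleRefl_inv (a : AffNode b) : (simpleRefl b a)⁻¹ = simpleRefl b a :=
  inv_eq_of_mul_eq_one_left (simpleRefl_mul_self a)

lemma simpleRefl_smul_smul (a : AffNode b) (β : AffRoot P) :
    simpleRefl b a • simpleRefl b a • β = β := by
  rw [smul_smul, simpleRefl_mul_self, one_smul]

lemma simpleRefl_smul_nodeRoot (a : AffNode b) :
    simpleRefl b a • nodeRoot b a = -nodeRoot b a := by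
  rw [simpleRefl_eq, affRefl_smul_self]

lemma AffRoot.pos_smul_neg (w : ExtAffWeyl P) (β : AffRoot P) :
    (w • (-β)).Pos b ↔ ¬ (w • β).Pos b := by
  rw [AffRoot.smul_neg, AffRoot.pos_neg_iff]

lemma pos_mul_simpleRefl_smul_nodeRoot (w : ExtAffWeyl P) (a : AffNode b) :
    ((w * simpleRefl b a) • nodeRoot b a).Pos b ↔ ¬ (w • nodeRoot b a).Pos b := by
  rw [mul_smul, simpleRefl_smul_nodeRoot, AffRoot.pos_smul_neg]

variable [Finite ι] [P.IsReduced]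

lemma eq_nodeRoot_of_not_pos {a : AffNode b} {β : AffRoot P} (hβ : β.Pos b)
    (h : ¬ (simpleRefl b a • β).Pos b) : β = nodeRoot b a :=
  not_not.mp fun hne ↦ h (pos_simpleRefl_smul a hβ hne)

/-- Apart from its own root, `s_a` permutes the positive roots; so it carries the inversions of `w`
to those of `w s_a`, and only `α_a` is new. -/
lemma inversions_mul_simpleRefl {w : ExtAffWeyl P} {a : AffNode b}
    (h : (w • nodeRoot b a).Pos b) :
    inversions b (w * simpleRefl b a) =
      insert (nodeRoot b a) ((simpleRefl b a • ·) '' inversions b w) := by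
  ext β
  simp only [Set.mem_insert_iff, Set.mem_image]
  constructor
  · rintro ⟨h1, h2⟩
    by_cases hβ : β = nodeRoot b a
    · exact Or.inl hβ
    · rw [mul_smul] at h2
      exact Or.inr ⟨_, ⟨pos_simpleRefl_smul a h1 hβ, h2⟩, simpleRefl_smul_smul a β⟩
  · rintro (rfl | ⟨γ, ⟨h1, h2⟩, rfl⟩)
    · exact ⟨pos_nodeRoot a, by rw [pos_mul_simpleRefl_smul_nodeRoot]; exact not_not.mpr h⟩
    · refine ⟨pos_simpleRefl_smul a h1 ?_, ?_⟩
      · rintro rfl; exact h2 h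
      · rwa [mul_smul, simpleRefl_smul_smul]

lemma invLength_mul_simpleRefl {w : ExtAffWeyl P} {a : AffNode b}
    (h : (w • nodeRoot b a).Pos b) :
    invLength b (w * simpleRefl b a) = invLength b w + 1 := by
  rw [invLength, inversions_mul_simpleRefl h, Set.ncard_insert_of_notMem _
    ((inversions_finite w).image _), Set.ncard_image_of_injective _ (MulAction.injective _),
    invLength]
  rintro ⟨γ, ⟨h1, h2⟩, hγ⟩
  have h3 : γ = -nodeRoot b a := by
    rw [← simpleRefl_smul_nodeRoot, ← hγ]; exact (simpleRefl_smul_smul a γ).symm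
  rw [h3, AffRoot.pos_neg_iff] at h1
  exact h1 (pos_nodeRoot a)

lemma invLength_mul_simpleRefl_of_not_pos {w : ExtAffWeyl P} {a : AffNode b}
    (h : ¬ (w • nodeRoot b a).Pos b) :
    invLength b (w * simpleRefl b a) + 1 = invLength b w := by
  rw [← pos_mul_simpleRefl_smul_nodeRoot] at h
  have := invLength_mul_simpleRefl h
  rw [mul_assoc, simpleRefl_mul_self, mul_one] at this
  exact this.symm

omit [P.IsReduced] in
lemma invLength_eq_zero_iff {w : ExtAffWeyl P} :
    invLength b w = 0 ↔ ∀ a, (w • nodeRoot b a).Pos b := by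
  rw [invLength, Set.ncard_eq_zero (inversions_finite w)]
  refine ⟨fun h a ↦ by_contra fun h' ↦ ?_, fun h ↦ Set.eq_empty_of_forall_notMem fun β hβ ↦ ?_⟩
  · have : nodeRoot b a ∈ inversions b w := ⟨pos_nodeRoot a, h'⟩
    rw [h] at this; exact this
  · exact hβ.2 (pos_smul_of_forall_nodeRoot h hβ.1)

omit [P.IsReduced] in
lemma pos_smul_of_invLength_eq_zero {w : ExtAffWeyl P} (hw : invLength b w = 0) {β : AffRoot P}
    (hβ : β.Pos b) : (w • β).Pos b :=
  pos_smul_of_forall_nodeRoot (invLength_eq_zero_iff.mp hw) hβ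

omit [Finite ι] [P.IsReduced] in
lemma inversions_inv (w : ExtAffWeyl P) :
    inversions b w⁻¹ = (fun β ↦ -(w • β)) '' inversions b w := by
  ext β
  constructor
  · rintro ⟨h1, h2⟩
    refine ⟨-(w⁻¹ • β), ⟨(AffRoot.pos_neg_iff _).mpr h2, ?_⟩, ?_⟩
    · rw [AffRoot.smul_neg, smul_inv_smul, AffRoot.pos_neg_iff]; exact not_not.mpr h1
    · simp only [AffRoot.smul_neg, smul_inv_smul, neg_neg]
  · rintro ⟨γ, ⟨h1, h2⟩, rfl⟩
    refine ⟨(AffRoot.pos_neg_iff _).mpr h2, ?_⟩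
    rw [AffRoot.smul_neg, inv_smul_smul, AffRoot.pos_neg_iff]; exact not_not.mpr h1

omit [Finite ι] [P.IsReduced] in
@[simp] lemma invLength_inv (w : ExtAffWeyl P) : invLength b w⁻¹ = invLength b w := by
  rw [invLength, inversions_inv, Set.ncard_image_of_injective, invLength]
  exact neg_injective.comp (MulAction.injective w)

lemma invLength_simpleRefl_mul {w : ExtAffWeyl P} {a : AffNode b}
    (h : (w⁻¹ • nodeRoot b a).Pos b) :
    invLength b (simpleRefl b a * w) = invLength b w + 1 := by
  rw [← invLength_inv, mul_inv_rev, simpleRefl_inv, invLength_mul_simpleRefl h, invLength_inv]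

lemma invLength_simpleRefl_mul_of_not_pos {w : ExtAffWeyl P} {a : AffNode b}
    (h : ¬ (w⁻¹ • nodeRoot b a).Pos b) :
    invLength b (simpleRefl b a * w) + 1 = invLength b w := by
  rw [← invLength_inv, mul_inv_rev, simpleRefl_inv, invLength_mul_simpleRefl_of_not_pos h,
    invLength_inv]

lemma invLength_simpleRefl_mul_le (w : ExtAffWeyl P) (a : AffNode b) :
    invLength b (simpleRefl b a * w) ≤ invLength b w + 1 := by
  by_cases h : (w⁻¹ • nodeRoot b a).Pos b
  · exact (invLength_simpleRefl_mul h).le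
  · have := invLength_simpleRefl_mul_of_not_pos h
    omega

omit [Finite ι] [P.IsReduced] in
lemma invLength_one : invLength b (1 : ExtAffWeyl P) = 0 := by
  have : inversions b (1 : ExtAffWeyl P) = ∅ := by
    ext β; simp [inversions]
  rw [invLength, this, Set.ncard_empty]

omit [P.IsReduced] in
lemma invLength_mul_of_left {π w : ExtAffWeyl P} (hπ : invLength b π = 0) :
    invLength b (π * w) = invLength b w := by
  have hπ' : invLength b π⁻¹ = 0 := by rw [invLength_inv, hπ]
  have : inversions b (π * w) = inversions b w := by
    ext β
    refine and_congr_right fun _ ↦ not_congr ⟨fun h ↦ ?_, fun h ↦ ?_⟩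
    · simpa [mul_smul] using pos_smul_of_invLength_eq_zero hπ' h
    · rw [mul_smul]; exact pos_smul_of_invLength_eq_zero hπ h
  rw [invLength, this, invLength]

omit [P.IsReduced] in
lemma invLength_mul_of_right {π w : ExtAffWeyl P} (hπ : invLength b π = 0) :
    invLength b (w * π) = invLength b w := by
  rw [← invLength_inv, mul_inv_rev, invLength_mul_of_left (by rwa [invLength_inv]), invLength_inv]

/-- The element `π s_a π⁻¹` makes the positive root `π α_a` negative, so it also makes some simple
root `α_{a'}` negative. Then `π⁻¹ α_{a'}` is a positive root that `s_a` makes negative, hence it is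
`α_a`. -/
lemma exists_smul_nodeRoot_eq {π : ExtAffWeyl P} (hπ : invLength b π = 0) (a : AffNode b) :
    ∃ a', π • nodeRoot b a = nodeRoot b a' := by
  have hπ' : invLength b π⁻¹ = 0 := by rw [invLength_inv, hπ]
  have ht : invLength b (π * simpleRefl b a * π⁻¹) ≠ 0 := fun h0 ↦ by
    have h := pos_smul_of_invLength_eq_zero h0
      (pos_smul_of_invLength_eq_zero hπ (pos_nodeRoot a))
    rw [mul_smul, inv_smul_smul, pos_mul_simpleRefl_smul_nodeRoot] at h
    exact h (pos_smul_of_invLength_eq_zero hπ (pos_nodeRoot a))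
  rw [ne_eq, invLength_eq_zero_iff, not_forall] at ht
  obtain ⟨a', ha'⟩ := ht
  refine ⟨a', ?_⟩
  rw [mul_smul, mul_smul] at ha'
  have h1 : ¬ (simpleRefl b a • π⁻¹ • nodeRoot b a').Pos b :=
    fun h ↦ ha' (pos_smul_of_invLength_eq_zero hπ h)
  have := eq_nodeRoot_of_not_pos (pos_smul_of_invLength_eq_zero hπ' (pos_nodeRoot a')) h1
  rw [← this, smul_inv_smul]

lemma isFundamental_iff {π : ExtAffWeyl P} : IsFundamental b π ↔ invLength b π = 0 := by
  constructor
  · intro h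
    rw [invLength_eq_zero_iff]
    intro a
    have : affAct P π (affSimpleRoot b a) ∈ Set.range (affSimpleRoot b) := by
      rw [← h]; exact ⟨_, ⟨a, rfl⟩, rfl⟩
    obtain ⟨a', ha'⟩ := this
    have : π • nodeRoot b a = nodeRoot b a' := AffRoot.real_injective (by
      rw [AffRoot.real_smul, real_nodeRoot, real_nodeRoot, ha'])
    rw [this]; exact pos_nodeRoot a'
  · intro h
    have key : ∀ π : ExtAffWeyl P, invLength b π = 0 → ∀ a, ∃ a',
        affAct P π (affSimpleRoot b a) = affSimpleRoot b a' := fun π h a ↦ by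
      obtain ⟨a', ha'⟩ := exists_smul_nodeRoot_eq h a
      exact ⟨a', by rw [← real_nodeRoot, ← AffRoot.real_smul, ha', real_nodeRoot]⟩
    apply subset_antisymm
    · rintro _ ⟨_, ⟨a, rfl⟩, rfl⟩
      obtain ⟨a', ha'⟩ := key π h a
      exact ⟨a', ha'.symm⟩
    · rintro _ ⟨a, rfl⟩
      obtain ⟨a', ha'⟩ := key π⁻¹ (by rwa [invLength_inv]) a
      refine ⟨_, ⟨a', rfl⟩, ?_⟩
      rw [← ha', ← affAct_mul, mul_inv_cancel, affAct_one]

/-! ### Words -/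

omit [Finite ι] [P.IsReduced] in
@[simp] lemma wordProd_nil : wordProd b ([] : List (AffNode b)) = 1 := rfl

omit [Finite ι] [P.IsReduced] in
@[simp] lemma wordProd_cons (a : AffNode b) (l : List (AffNode b)) :
    wordProd b (a :: l) = simpleRefl b a * wordProd b l := rfl

omit [Finite ι] [P.IsReduced] in
lemma wordProd_append (l l' : List (AffNode b)) :
    wordProd b (l ++ l') = wordProd b l * wordProd b l' := by
  simp [wordProd]

omit [Finite ι] [P.IsReduced] in
lemma wordProd_reverse (l : List (AffNode b)) :
    wordProd b l.reverse = (wordProd b l)⁻¹ := by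
  induction l with
  | nil => simp
  | cons a l ih => simp [wordProd_append, ih, simpleRefl_inv]

lemma exists_eq_mul_wordProd (w : ExtAffWeyl P) : ∃ π l, invLength b π = 0 ∧
    w = π * wordProd b l ∧ l.length = invLength b w := by
  induction hn : invLength b w generalizing w with
  | zero => exact ⟨w, [], hn, by simp, by simp⟩
  | succ n ih =>
    have : ¬ ∀ a, (w • nodeRoot b a).Pos b := by
      rw [← invLength_eq_zero_iff]; omega
    rw [not_forall] at this
    obtain ⟨a, ha⟩ := this
    have h1 := invLength_mul_simpleRefl_of_not_pos ha
    obtain ⟨π, l, hπ, hw, hl⟩ := ih (w * simpleRefl b a) (by omega)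
    refine ⟨π, l ++ [a], hπ, ?_, by simp [hl]⟩
    rw [wordProd_append, ← mul_assoc, ← hw]
    simp [mul_assoc, simpleRefl_mul_self]

lemma invLength_wordProd_le (l : List (AffNode b)) : invLength b (wordProd b l) ≤ l.length := by
  induction l with
  | nil => simp [invLength_one]
  | cons a l ih =>
    have := invLength_simpleRefl_mul_le (wordProd b l) a
    simp only [wordProd_cons, List.length_cons]
    omega

/-- Strong exchange property. Applying the letters to `β` one after another, the root first becomes
negative at a letter whose simple root it has just become; that letter can be deleted. -/
lemma exists_wordProd_mul_affRefl {l : List (AffNode b)} {β : AffRoot P} (hβ : β.Pos b)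
    (h : ¬ (wordProd b l • β).Pos b) :
    ∃ l', wordProd b l' = wordProd b l * affRefl β ∧ l'.length + 1 = l.length := by
  induction l with
  | nil => simp [hβ] at h
  | cons a l ih =>
    by_cases h' : (wordProd b l • β).Pos b
    · rw [wordProd_cons, mul_smul] at h
      have := eq_nodeRoot_of_not_pos h' h
      refine ⟨l, ?_, rfl⟩
      rw [wordProd_cons, simpleRefl_eq, ← this, ← affRefl_conj]
      simp [mul_assoc, affRefl_mul_self]
    · obtain ⟨l', h1, h2⟩ := ih h'
      exact ⟨a :: l', by simp [h1, mul_assoc], by simp [h2]⟩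

/-- When prepending a letter lowers the number of inversions, the exchange property deletes a letter
of the shortened word instead. -/
lemma exists_reduced_wordProd (l : List (AffNode b)) :
    ∃ l', wordProd b l' = wordProd b l ∧ l'.length = invLength b (wordProd b l) := by
  induction l with
  | nil => exact ⟨[], rfl, by simp [invLength_one]⟩
  | cons a l ih =>
    obtain ⟨l1, h1, h2⟩ := ih
    by_cases h : ((wordProd b l)⁻¹ • nodeRoot b a).Pos b
    · exact ⟨a :: l1, by simp [h1], by simp [h2, invLength_simpleRefl_mul h]⟩
    · have h3 : ¬ (wordProd b l1 • -((wordProd b l)⁻¹ • nodeRoot b a)).Pos b := by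
        rw [h1, AffRoot.smul_neg, smul_inv_smul, AffRoot.pos_neg_iff]
        exact not_not.mpr (pos_nodeRoot a)
      obtain ⟨l', h4, h5⟩ := exists_wordProd_mul_affRefl ((AffRoot.pos_neg_iff _).mpr h) h3
      have h6 := invLength_simpleRefl_mul_of_not_pos h
      refine ⟨l', ?_, ?_⟩
      · rw [h4, h1, affRefl_neg, ← affRefl_conj, wordProd_cons, simpleRefl_eq]
        group
      · rw [wordProd_cons]; omega

lemma eq_one_of_invLength_wordProd {l : List (AffNode b)} (h : invLength b (wordProd b l) = 0) :
    wordProd b l = 1 := by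
  obtain ⟨l', h1, h2⟩ := exists_reduced_wordProd l
  rw [h, List.length_eq_zero_iff] at h2
  rw [← h1, h2, wordProd_nil]

/-! ### Affine roots are conjugate to simple ones -/

/-- Pairing with both coroots shows that the two Cartan integers have product `4`. In a reduced
system they are then both `2` or both `-2`, so the finite roots agree up to sign, and positivity
fixes the sign. -/
lemma eq_of_two_smul_eq {β γ : AffRoot P} {n : ℤ} (hβ : β.Pos b) (hγ : γ.Pos b)
    (h : (2 : ℤ) • β.real = n • γ.real) : β = γ := by
  have : Module.IsTorsionFree ℤ X := isTorsionFree_of_rootPairing P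
  have h1 : (2 : ℤ) • P.root β.1 = n • P.root γ.1 := congrArg Prod.fst h
  have h2 : (2 : ℤ) * β.2 = n * γ.2 := congrArg Prod.snd h
  have h3 : P.pairing β.1 γ.1 = n := by
    have := congrArg (fun x ↦ P.toLinearMap x (P.coroot γ.1)) h1
    simp only [map_zsmul, LinearMap.smul_apply, RootPairing.root_coroot_eq_pairing,
      RootPairing.pairing_same, smul_eq_mul] at this
    omega
  have h4 : n * P.pairing γ.1 β.1 = 4 := by
    have := congrArg (fun x ↦ P.toLinearMap x (P.coroot β.1)) h1
    simp only [map_zsmul, LinearMap.smul_apply, RootPairing.root_coroot_eq_pairing,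
      RootPairing.pairing_same, smul_eq_mul] at this
    omega
  have hset := P.pairingIn_pairingIn_mem_set_of_isCrystal_of_isRed β.1 γ.1
  have h22 := P.pairingIn_two_two_iff ℤ β.1 γ.1
  have h22' := P.pairingIn_neg_two_neg_two_iff ℤ β.1 γ.1
  rw [pairingIn_int, pairingIn_int] at hset h22 h22'
  simp only [Set.mem_insert_iff, Set.mem_singleton_iff, Prod.mk.injEq] at hset
  have hn : (P.pairing β.1 γ.1 = 2 ∧ P.pairing γ.1 β.1 = 2) ∨
      (P.pairing β.1 γ.1 = -2 ∧ P.pairing γ.1 β.1 = -2) := by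
    rw [← h3] at h4
    rcases hset with h | h | h | h | h | h | h | h | h | h | h | h | h <;>
      simp [h.1, h.2] at h4 ⊢
  rcases hn with h | h
  · have := h22.mp h
    exact Prod.ext this (by rw [← h3, h.1] at h2; omega)
  · have h5 := h22'.mp h
    have : β = -γ := AffRoot.real_injective (by
      rw [AffRoot.real_neg]
      exact Prod.ext h5 (by change β.2 = -γ.2; rw [← h3, h.1] at h2; omega))
    rw [this, AffRoot.pos_neg_iff] at hβ
    exact absurd hγ hβ

/-- Induction on the length of `s_β`. If `s_β α_a` is negative and `β ≠ α_a`, then `s_a β` is again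
positive, and its reflection `s_a s_β s_a` is shorter by two. -/
lemma AffRoot.Pos.exists_eq_smul_nodeRoot {β : AffRoot P} (hβ : β.Pos b) :
    ∃ l a, β = wordProd b l • nodeRoot b a := by
  induction hn : invLength b (affRefl β) using Nat.strong_induction_on generalizing β with
  | _ n ih =>
    have h0 : ¬ ∀ a, (affRefl β • nodeRoot b a).Pos b := by
      intro h
      have := pos_smul_of_forall_nodeRoot h hβ
      rw [affRefl_smul_self, AffRoot.pos_neg_iff] at this
      exact this hβ
    rw [not_forall] at h0
    obtain ⟨a, ha⟩ := h0
    by_cases hβa : β = nodeRoot b a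
    · exact ⟨[], a, by simpa⟩
    have h1 := invLength_mul_simpleRefl_of_not_pos ha
    -- Otherwise `-s_β α_a` would be a positive root made negative by `s_a`, hence `α_a` itself;
    -- then `2 α_a` is a multiple of `β`, which forces `β = α_a`.
    have h2 : ¬ ((affRefl β * simpleRefl b a)⁻¹ • nodeRoot b a).Pos b := by
      rw [mul_inv_rev, simpleRefl_inv, affRefl_inv, mul_smul]
      intro h
      have h3 : ¬ (simpleRefl b a • (-(affRefl β • nodeRoot b a))).Pos b := by
        rw [AffRoot.smul_neg, AffRoot.pos_neg_iff]; exact not_not.mpr h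
      have h4 := eq_nodeRoot_of_not_pos ((AffRoot.pos_neg_iff _).mpr ha) h3
      have h5 := congrArg AffRoot.real h4
      rw [AffRoot.real_neg, real_affRefl_smul] at h5
      refine hβa (eq_of_two_smul_eq (n := P.pairing (nodeRoot b a).1 β.1) (pos_nodeRoot a) hβ
        ?_).symm
      rw [two_smul]
      nth_rewrite 1 [← h5]
      abel
    have h6 := invLength_simpleRefl_mul_of_not_pos h2
    have h7 : affRefl (simpleRefl b a • β) = simpleRefl b a * (affRefl β * simpleRefl b a) := by
      rw [← affRefl_conj, simpleRefl_inv, mul_assoc]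
    obtain ⟨l, a', hl⟩ := ih _ (by rw [h7]; omega) (pos_simpleRefl_smul a hβ hβa) rfl
    exact ⟨a :: l, a', by rw [wordProd_cons, mul_smul, ← hl, simpleRefl_smul_smul]⟩

lemma exists_eq_smul_nodeRoot (b : P.Base) (β : AffRoot P) :
    ∃ l a, β = wordProd b l • nodeRoot b a := by
  by_cases h : β.Pos b
  · exact h.exists_eq_smul_nodeRoot
  · obtain ⟨l, a, hl⟩ := ((AffRoot.pos_neg_iff β).mpr h).exists_eq_smul_nodeRoot
    refine ⟨l ++ [a], a, ?_⟩
    rw [wordProd_append, mul_smul, wordProd_cons, wordProd_nil, mul_one,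
      simpleRefl_smul_nodeRoot, AffRoot.smul_neg, ← hl, neg_neg]

lemma exists_affRefl_eq_wordProd (b : P.Base) (β : AffRoot P) :
    ∃ l, affRefl β = wordProd b l := by
  obtain ⟨l, a, rfl⟩ := exists_eq_smul_nodeRoot b β
  refine ⟨l ++ a :: l.reverse, ?_⟩
  rw [← affRefl_conj, wordProd_append, wordProd_cons, wordProd_reverse, simpleRefl_eq, mul_assoc]

/-! ### The affine Weyl group -/

omit [Finite ι] [P.IsReduced] in
lemma coroot_mem_closure (b : P.Base) (i : ι) :
    P.coroot i ∈ AddSubgroup.closure (P.coroot '' b.support) := by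
  have := b.coroot_mem_span_int i
  rwa [← Submodule.mem_toAddSubgroup, Submodule.span_int_eq_addSubgroupClosure] at this

omit [Finite ι] [P.IsReduced] in
lemma coweightAct_mem_closure (u : P.weylGroup) {y : Y}
    (hy : y ∈ AddSubgroup.closure (P.coroot '' b.support)) :
    coweightAct P u y ∈ AddSubgroup.closure (P.coroot '' b.support) := by
  induction hy using AddSubgroup.closure_induction with
  | mem y hy =>
    obtain ⟨i, -, rfl⟩ := hy
    rw [coweightAct_coroot]; exact coroot_mem_closure b _
  | zero => rw [map_zero]; exact zero_mem _
  | add y z _ _ hy hz => rw [map_add]; exact add_mem hy hz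
  | neg y _ hy => rw [map_neg]; exact neg_mem hy

variable (b) in
/-- The affine Weyl group as a subgroup of the extended affine Weyl group. -/
def affineSubgroup : Subgroup (ExtAffWeyl P) where
  carrier := {w | IsAffine b w}
  one_mem' := zero_mem (AddSubgroup.closure (P.coroot '' b.support))
  mul_mem' {v w} hv hw := by
    change Multiplicative.toAdd (v * w).left ∈ AddSubgroup.closure (P.coroot '' b.support)
    rw [toAdd_left_mul]
    exact add_mem hv (coweightAct_mem_closure _ hw)
  inv_mem' {w} hw := by
    change Multiplicative.toAdd (w⁻¹).left ∈ AddSubgroup.closure (P.coroot '' b.support)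
    have h := toAdd_left_mul w⁻¹ w
    rw [inv_mul_cancel] at h
    rw [eq_neg_of_add_eq_zero_left h.symm]
    exact neg_mem (coweightAct_mem_closure _ hw)

omit [Finite ι] [P.IsReduced] in
lemma affRefl_mem_affineSubgroup (β : AffRoot P) : affRefl β ∈ affineSubgroup b := by
  change Multiplicative.toAdd (affRefl β).left ∈ AddSubgroup.closure (P.coroot '' b.support)
  rw [toAdd_left_affRefl]
  exact neg_mem (zsmul_mem (coroot_mem_closure b _) _)

omit [Finite ι] [P.IsReduced] in
lemma wordProd_mem_affineSubgroup (l : List (AffNode b)) : wordProd b l ∈ affineSubgroup b := by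
  induction l with
  | nil => exact one_mem _
  | cons a l ih =>
    rw [wordProd_cons, simpleRefl_eq]
    exact mul_mem (affRefl_mem_affineSubgroup _) ih

variable (b) in
/-- The subgroup generated by the simple reflections. -/
def wordSubgroup : Subgroup (ExtAffWeyl P) where
  carrier := Set.range (wordProd b)
  one_mem' := ⟨[], rfl⟩
  mul_mem' := by
    rintro _ _ ⟨l, rfl⟩ ⟨l', rfl⟩
    exact ⟨l ++ l', wordProd_append l l'⟩
  inv_mem' := by
    rintro _ ⟨l, rfl⟩
    exact ⟨l.reverse, wordProd_reverse l⟩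

lemma affRefl_mem_wordSubgroup (β : AffRoot P) : affRefl β ∈ wordSubgroup b := by
  obtain ⟨l, hl⟩ := exists_affRefl_eq_wordProd b β
  exact ⟨l, hl.symm⟩

omit [Finite ι] [P.IsReduced] in
lemma weylGroup_induction {p : P.weylGroup → Prop}
    (refl : ∀ i, p (RootPairing.weylGroup.ofIdx P i)) (one : p 1)
    (mul : ∀ u v, p u → p v → p (u * v)) (u : P.weylGroup) : p u := by
  obtain ⟨u, hu⟩ := u
  induction hu using RootPairing.weylGroup.induction with
  | mem i => exact refl i
  | one => exact one
  | mul x y hx hy h1 h2 => exact mul ⟨x, hx⟩ ⟨y, hy⟩ h1 h2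

omit [Finite ι] [P.IsReduced] in
lemma fin_mul (u v : P.weylGroup) : fin P (u * v) = fin P u * fin P v :=
  map_mul (SemidirectProduct.inr : P.weylGroup →* ExtAffWeyl P) u v

omit [Finite ι] [P.IsReduced] in
lemma affRefl_zero (i : ι) : affRefl ((i, 0) : AffRoot P) = fin P (RootPairing.weylGroup.ofIdx P i) := by
  simp [affRefl, trans_zero]

lemma fin_mem_wordSubgroup (u : P.weylGroup) : fin P u ∈ wordSubgroup b := by
  induction u using weylGroup_induction with
  | refl i => rw [← affRefl_zero]; exact affRefl_mem_wordSubgroup _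
  | one => exact one_mem _
  | mul u v hu hv => rw [fin_mul]; exact mul_mem hu hv

/-- A coroot translation is a product of two reflections: `t_{α^∨} = s_{α-δ} s_α`. -/
lemma trans_mem_wordSubgroup {y : Y} (hy : y ∈ AddSubgroup.closure (P.coroot '' b.support)) :
    trans P y ∈ wordSubgroup b := by
  induction hy using AddSubgroup.closure_induction with
  | mem y hy =>
    obtain ⟨i, -, rfl⟩ := hy
    have h : trans P (P.coroot i) = affRefl ((i, -1) : AffRoot P) * affRefl ((i, 0) : AffRoot P) := by
      rw [affRefl_zero]
      simp only [affRefl, mul_assoc, neg_smul, one_smul, neg_neg]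
      rw [← fin_mul, ofIdx_mul_self]
      exact (mul_one _).symm
    rw [h]
    exact mul_mem (affRefl_mem_wordSubgroup _) (affRefl_mem_wordSubgroup _)
  | zero => rw [trans_zero]; exact one_mem _
  | add y z _ _ hy hz => rw [trans_add]; exact mul_mem hy hz
  | neg y _ hy => rw [trans_neg]; exact inv_mem hy

lemma exists_wordProd_eq_of_isAffine {w : ExtAffWeyl P} (hw : IsAffine b w) :
    ∃ l, wordProd b l = w := by
  rw [← trans_mul_fin w]
  exact mul_mem (trans_mem_wordSubgroup hw) (fin_mem_wordSubgroup (cl P w))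

lemma eq_one_of_isAffine {w : ExtAffWeyl P} (hw : IsAffine b w) (h : invLength b w = 0) :
    w = 1 := by
  obtain ⟨l, rfl⟩ := exists_wordProd_eq_of_isAffine hw
  exact eq_one_of_invLength_wordProd h

/-- No word is shorter than the number of inversions of its product, and some word attains it. -/
lemma coxLength_eq {v : ExtAffWeyl P} (hv : IsAffine b v) : coxLength b v = invLength b v := by
  obtain ⟨l, rfl⟩ := exists_wordProd_eq_of_isAffine hv
  obtain ⟨l', h1, h2⟩ := exists_reduced_wordProd l
  apply le_antisymm
  · exact Nat.sInf_le ⟨l', h2, h1⟩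
  · refine le_csInf ⟨_, l, rfl, rfl⟩ ?_
    rintro n ⟨l'', rfl, h⟩
    rw [← h]; exact invLength_wordProd_le l''

/-! ### The decomposition into fundamental and affine part -/

/-- Two decompositions differ by an element of the affine Weyl group without inversions, and such an
element is `1`. -/
lemma isFundAffDecomp_unique {w : ExtAffWeyl P} {p q : ExtAffWeyl P × ExtAffWeyl P}
    (hp : IsFundAffDecomp b w p) (hq : IsFundAffDecomp b w q) : p = q := by
  obtain ⟨hp1, hp2, hp3⟩ := hp
  obtain ⟨hq1, hq2, hq3⟩ := hq
  rw [isFundamental_iff] at hp1 hq1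
  have h : q.1⁻¹ * p.1 = q.2 * p.2⁻¹ := by
    rw [inv_mul_eq_iff_eq_mul, ← mul_assoc, eq_mul_inv_iff_mul_eq, ← hp3, ← hq3]
  have h1 : q.1⁻¹ * p.1 = 1 := by
    refine eq_one_of_isAffine (b := b) ?_ ?_
    · rw [h]; exact (affineSubgroup b).mul_mem hq2 ((affineSubgroup b).inv_mem hp2)
    · rw [invLength_mul_of_left (by rwa [invLength_inv]), hp1]
  have h2 : p.1 = q.1 := (inv_mul_eq_one.mp h1).symm
  rw [h1] at h
  exact Prod.ext h2 (eq_mul_inv_iff_mul_eq.mp h ▸ (one_mul _).symm)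

lemma existsUnique_isFundAffDecomp (b : P.Base) (w : ExtAffWeyl P) :
    ∃! p, IsFundAffDecomp b w p := by
  obtain ⟨π, l, hπ, hw, -⟩ := exists_eq_mul_wordProd (b := b) w
  have : IsFundAffDecomp b w (π, wordProd b l) :=
    ⟨isFundamental_iff.mpr hπ, wordProd_mem_affineSubgroup l, hw⟩
  exact ⟨_, this, fun q hq ↦ isFundAffDecomp_unique hq this⟩

lemma isFundAffDecomp_fundAff (b : P.Base) (w : ExtAffWeyl P) :
    IsFundAffDecomp b w (fundPart b w, affPart b w) :=
  Classical.epsilon_spec (existsUnique_isFundAffDecomp b w).exists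

lemma fundPart_eq_and_affPart_eq {w π v : ExtAffWeyl P} (hπ : invLength b π = 0)
    (hv : v ∈ affineSubgroup b) (h : w = π * v) : fundPart b w = π ∧ affPart b w = v := by
  have := isFundAffDecomp_unique (isFundAffDecomp_fundAff b w)
    (q := (π, v)) ⟨isFundamental_iff.mpr hπ, hv, h⟩
  exact ⟨congrArg Prod.fst this, congrArg Prod.snd this⟩

lemma invLength_fundPart (w : ExtAffWeyl P) : invLength b (fundPart b w) = 0 :=
  isFundamental_iff.mp (isFundAffDecomp_fundAff b w).1

lemma affPart_mem (w : ExtAffWeyl P) : affPart b w ∈ affineSubgroup b :=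
  (isFundAffDecomp_fundAff b w).2.1

lemma fundPart_mul_affPart (b : P.Base) (w : ExtAffWeyl P) : fundPart b w * affPart b w = w :=
  (isFundAffDecomp_fundAff b w).2.2.symm

lemma invLength_affPart (w : ExtAffWeyl P) : invLength b (affPart b w) = invLength b w := by
  nth_rewrite 2 [← fundPart_mul_affPart b w]
  rw [invLength_mul_of_left (invLength_fundPart w)]

lemma length_eq (w : ExtAffWeyl P) : length b w = invLength b w := by
  rw [length, coxLength_eq (affPart_mem w), invLength_affPart]

lemma fundPart_mul {w v : ExtAffWeyl P} (hv : v ∈ affineSubgroup b) :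
    fundPart b (w * v) = fundPart b w ∧ affPart b (w * v) = affPart b w * v :=
  fundPart_eq_and_affPart_eq (invLength_fundPart w) (mul_mem (affPart_mem w) hv)
    (by rw [← mul_assoc, fundPart_mul_affPart])

end AffNilHecke

end

noncomputable section

namespace AffNilHecke

variable {ι X Y : Type*} [AddCommGroup X] [AddCommGroup Y] {P : RootPairing ι ℤ X Y}
variable {b : P.Base}

section Additivity

variable [Finite ι] [P.IsReduced]

/-! ### Length of products -/

lemma invLength_mul_le (v w : ExtAffWeyl P) :
    invLength b (v * w) ≤ invLength b v + invLength b w := by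
  obtain ⟨π, l, hπ, rfl, hl⟩ := exists_eq_mul_wordProd (b := b) v
  rw [← hl, mul_assoc, invLength_mul_of_left hπ]
  clear hl
  induction l with
  | nil => simp
  | cons a l ih =>
    have := invLength_simpleRefl_mul_le (wordProd b l * w) a
    rw [wordProd_cons, mul_assoc, List.length_cons]
    omega

/-- Induction on the length of `w`: a left descent `a` of `w` is moved to the right end of `v`. The
hypothesis survives because `s_a` permutes the positive roots other than `α_a`. -/
lemma invLength_mul_eq {v w : ExtAffWeyl P}
    (h : ∀ γ : AffRoot P, γ.Pos b → ¬ (w⁻¹ • γ).Pos b → (v • γ).Pos b) :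
    invLength b (v * w) = invLength b v + invLength b w := by
  induction hn : invLength b w generalizing v w with
  | zero => rw [invLength_mul_of_right hn, add_zero]
  | succ n ih =>
    have h0 : ¬ ∀ a, (w⁻¹ • nodeRoot b a).Pos b := by
      rw [← invLength_eq_zero_iff, invLength_inv]; omega
    rw [not_forall] at h0
    obtain ⟨a, ha⟩ := h0
    have h1 := invLength_simpleRefl_mul_of_not_pos ha
    have h2 := invLength_mul_simpleRefl (h _ (pos_nodeRoot a) ha)
    have h3 := ih (v := v * simpleRefl b a) (w := simpleRefl b a * w) (fun γ hγ hγ' ↦ by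
      rw [mul_inv_rev, simpleRefl_inv, mul_smul] at hγ'
      rw [mul_smul]
      refine h _ (pos_simpleRefl_smul a hγ fun hne ↦ ?_) hγ'
      rw [hne, simpleRefl_smul_nodeRoot, AffRoot.pos_smul_neg] at hγ'
      exact hγ' ha) (by omega)
    rw [← mul_assoc, mul_assoc v, simpleRefl_mul_self, mul_one] at h3
    omega

/-- If `v α_a` were negative, `v s_a` and `s_a w` would both be shorter, and their product `v w`
would lose at least two from the sum of the lengths. -/
lemma pos_smul_nodeRoot_of_invLength_mul {v w : ExtAffWeyl P} {a : AffNode b}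
    (h : invLength b (v * w) = invLength b v + invLength b w)
    (ha : ¬ (w⁻¹ • nodeRoot b a).Pos b) : (v • nodeRoot b a).Pos b := by
  by_contra h'
  have h1 := invLength_mul_simpleRefl_of_not_pos h'
  have h2 := invLength_simpleRefl_mul_of_not_pos ha
  have h3 := invLength_mul_le (b := b) (v * simpleRefl b a) (simpleRefl b a * w)
  rw [← mul_assoc, mul_assoc v, simpleRefl_mul_self, mul_one] at h3
  omega

/-! ### The Bruhat order on the extended affine Weyl group -/

lemma invLength_mul_affRefl_lt {w : ExtAffWeyl P} {β : AffRoot P} (hβ : β.Pos b)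
    (h : ¬ (w • β).Pos b) : invLength b (w * affRefl β) < invLength b w := by
  obtain ⟨π, l, hπ, rfl, hl⟩ := exists_eq_mul_wordProd (b := b) w
  rw [mul_smul] at h
  have h' : ¬ (wordProd b l • β).Pos b := fun h' ↦ h (pos_smul_of_invLength_eq_zero hπ h')
  obtain ⟨l', h1, h2⟩ := exists_wordProd_mul_affRefl hβ h'
  rw [mul_assoc, ← h1, ← hl, invLength_mul_of_left hπ]
  have := invLength_wordProd_le l'
  omega

lemma invLength_lt_mul_affRefl_iff {w : ExtAffWeyl P} {β : AffRoot P} (hβ : β.Pos b) :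
    invLength b w < invLength b (w * affRefl β) ↔ (w • β).Pos b := by
  refine ⟨fun h ↦ by_contra fun h' ↦ (invLength_mul_affRefl_lt hβ h').not_gt h, fun h ↦ ?_⟩
  have := invLength_mul_affRefl_lt (w := w * affRefl β) hβ (by
    rw [mul_smul, affRefl_smul_self, AffRoot.pos_smul_neg]; exact not_not.mpr h)
  rwa [mul_assoc, affRefl_mul_self, mul_one] at this

end Additivity

variable (b) in
/-- A step in the Bruhat order: multiplication by a reflection that increases the length. -/
def BruhatStep (u v : ExtAffWeyl P) : Prop :=
  invLength b u < invLength b v ∧ ∃ β : AffRoot P, v = u * affRefl β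

variable (b) in
/-- The Bruhat order, in terms of the number of inversions. -/
def BruhatChain : ExtAffWeyl P → ExtAffWeyl P → Prop := Relation.ReflTransGen (BruhatStep b)

lemma BruhatChain.refl (w : ExtAffWeyl P) : BruhatChain b w w := Relation.ReflTransGen.refl

lemma BruhatChain.invLength_le {u v : ExtAffWeyl P} (h : BruhatChain b u v) :
    invLength b u ≤ invLength b v := by
  induction h with
  | refl => exact le_rfl
  | tail _ h ih => exact ih.trans h.1.le

variable [Finite ι] [P.IsReduced]

lemma isRefl_iff {t : ExtAffWeyl P} : IsRefl b t ↔ ∃ β : AffRoot P, t = affRefl β := by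
  constructor
  · rintro ⟨v, a, -, rfl⟩
    exact ⟨_, by rw [simpleRefl_eq, affRefl_conj]⟩
  · rintro ⟨β, rfl⟩
    obtain ⟨l, a, rfl⟩ := exists_eq_smul_nodeRoot b β
    exact ⟨_, a, wordProd_mem_affineSubgroup l, by rw [simpleRefl_eq, affRefl_conj]⟩

lemma BruhatStep.parts {u v : ExtAffWeyl P} (h : BruhatStep b u v) :
    fundPart b u = fundPart b v ∧ coxLength b (affPart b u) < coxLength b (affPart b v) ∧
      ∃ t, IsRefl b t ∧ affPart b v = affPart b u * t := by
  obtain ⟨h1, β, rfl⟩ := h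
  obtain ⟨h2, h3⟩ := fundPart_mul (b := b) (w := u) (affRefl_mem_affineSubgroup β)
  rw [coxLength_eq (affPart_mem _), coxLength_eq (affPart_mem _), invLength_affPart,
    invLength_affPart]
  exact ⟨h2.symm, h1, _, isRefl_iff.mpr ⟨β, rfl⟩, h3⟩

lemma bruhatChain_of_affBruhatLE {π u v : ExtAffWeyl P} (hπ : invLength b π = 0)
    (hu : u ∈ affineSubgroup b) (h : affBruhatLE b u v) :
    v ∈ affineSubgroup b ∧ BruhatChain b (π * u) (π * v) := by
  induction h with
  | refl => exact ⟨hu, .refl _⟩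
  | @tail v w _ h ih =>
    obtain ⟨h1, t, ht, rfl⟩ := h
    obtain ⟨β, rfl⟩ := isRefl_iff.mp ht
    have hw := mul_mem ih.1 (affRefl_mem_affineSubgroup (b := b) β)
    refine ⟨hw, ih.2.tail ⟨?_, β, (mul_assoc _ _ _).symm⟩⟩
    rw [coxLength_eq ih.1, coxLength_eq hw] at h1
    rwa [invLength_mul_of_left hπ, invLength_mul_of_left hπ]

/-- Reflections lie in the affine Weyl group, so a chain never changes the component in `Ω`. From
here on the order needs no decompositions. -/
lemma bruhatLE_iff {u v : ExtAffWeyl P} : bruhatLE b u v ↔ BruhatChain b u v := by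
  constructor
  · rintro ⟨h1, h2⟩
    have := (bruhatChain_of_affBruhatLE (invLength_fundPart u) (affPart_mem u) h2).2
    rwa [fundPart_mul_affPart, h1, fundPart_mul_affPart] at this
  · intro h
    induction h with
    | refl => exact ⟨rfl, Relation.ReflTransGen.refl⟩
    | tail _ h ih =>
      obtain ⟨h1, h2⟩ := h.parts
      exact ⟨ih.1.trans h1, ih.2.tail h2⟩

/-- Everything below `w` has the same component in `Ω` as `w` and a word of length at most `ℓ(w)` in
a finite alphabet. -/
lemma finite_bruhatChain (b : P.Base) (w : ExtAffWeyl P) : {v | BruhatChain b v w}.Finite := by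
  have hfin : {l : List (AffNode b) | l.length ≤ invLength b w}.Finite :=
    List.finite_length_le _ _
  refine (hfin.image fun l ↦ fundPart b w * wordProd b l).subset fun v hv ↦ ?_
  obtain ⟨l, hl⟩ := exists_wordProd_eq_of_isAffine (affPart_mem (b := b) v)
  obtain ⟨l', h1, h2⟩ := exists_reduced_wordProd l
  refine ⟨l', ?_, ?_⟩
  · change l'.length ≤ _
    rw [h2, hl, invLength_affPart]
    exact BruhatChain.invLength_le hv
  · change _ * _ = _
    rw [h1, hl, ← (bruhatLE_iff.mpr hv).1, fundPart_mul_affPart]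

lemma BruhatStep.exists_pos {u v : ExtAffWeyl P} (h : BruhatStep b u v) :
    ∃ β : AffRoot P, β.Pos b ∧ (u • β).Pos b ∧ v = u * affRefl β := by
  obtain ⟨h1, β, rfl⟩ := h
  by_cases hβ : β.Pos b
  · exact ⟨β, hβ, (invLength_lt_mul_affRefl_iff hβ).mp h1, rfl⟩
  · have hβ' := (AffRoot.pos_neg_iff β).mpr hβ
    rw [← affRefl_neg] at h1 ⊢
    exact ⟨-β, hβ', (invLength_lt_mul_affRefl_iff hβ').mp h1, rfl⟩

lemma bruhatStep_simpleRefl_mul {w : ExtAffWeyl P} {a : AffNode b}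
    (h : (w⁻¹ • nodeRoot b a).Pos b) : BruhatStep b w (simpleRefl b a * w) := by
  refine ⟨by rw [invLength_simpleRefl_mul h]; omega, w⁻¹ • nodeRoot b a, ?_⟩
  rw [← affRefl_conj, simpleRefl_eq]
  group

lemma bruhatStep_of_not_pos {w : ExtAffWeyl P} {a : AffNode b}
    (h : ¬ (w⁻¹ • nodeRoot b a).Pos b) : BruhatStep b (simpleRefl b a * w) w := by
  have := bruhatStep_simpleRefl_mul (w := simpleRefl b a * w) (a := a) (by
    rw [mul_inv_rev, simpleRefl_inv, mul_smul, simpleRefl_smul_nodeRoot, AffRoot.pos_smul_neg]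
    exact h)
  rwa [← mul_assoc, simpleRefl_mul_self, one_mul] at this

/-- For a step from `u` to `u s_β`, left multiplication by `s_a` can spoil the increase of length
only if `uβ = α_a`; in that case `s_a u = u s_β`. -/
lemma BruhatStep.simpleRefl_mul {u v : ExtAffWeyl P} (h : BruhatStep b u v) (a : AffNode b) :
    simpleRefl b a * u = v ∨ BruhatStep b (simpleRefl b a * u) (simpleRefl b a * v) := by
  obtain ⟨β, h1, h2, rfl⟩ := h.exists_pos
  by_cases h3 : ((simpleRefl b a * u) • β).Pos b
  · exact Or.inr ⟨by rwa [← mul_assoc, invLength_lt_mul_affRefl_iff h1], β,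
      (mul_assoc _ _ _).symm⟩
  · rw [mul_smul] at h3
    rw [simpleRefl_eq, ← eq_nodeRoot_of_not_pos h2 h3, ← affRefl_conj, inv_mul_cancel_right]
    exact Or.inl rfl

lemma BruhatChain.simpleRefl_mul_left {u v : ExtAffWeyl P} (h : BruhatChain b u v)
    (a : AffNode b) : BruhatChain b (simpleRefl b a * u) v ∨
      BruhatChain b (simpleRefl b a * u) (simpleRefl b a * v) := by
  induction h using Relation.ReflTransGen.head_induction_on with
  | refl => exact Or.inr (.refl _)
  | head h h' ih =>
    rcases h.simpleRefl_mul a with h1 | h1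
    · rw [h1]; exact Or.inl h'
    · exact ih.imp (.head h1) (.head h1)

lemma BruhatChain.simpleRefl_mul_right {u v : ExtAffWeyl P} (h : BruhatChain b u v)
    (a : AffNode b) : BruhatChain b u (simpleRefl b a * v) ∨
      BruhatChain b (simpleRefl b a * u) (simpleRefl b a * v) := by
  induction h with
  | refl => exact Or.inr (.refl _)
  | tail h h' ih =>
    rcases h'.simpleRefl_mul a with h1 | h1
    · left
      rw [← h1, ← mul_assoc, simpleRefl_mul_self, one_mul]; exact h
    · exact ih.imp (·.tail h1) (·.tail h1)

/-- Together with the next equivalence this is the lifting property: if `s_a v > v`, then `x ≤ s_a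
v` exactly when the smaller of `x` and `s_a x` is below `v`. -/
lemma bruhatChain_simpleRefl_mul_iff_of_pos {x v : ExtAffWeyl P} {a : AffNode b}
    (hv : (v⁻¹ • nodeRoot b a).Pos b) (hx : (x⁻¹ • nodeRoot b a).Pos b) :
    BruhatChain b x (simpleRefl b a * v) ↔ BruhatChain b x v := by
  refine ⟨fun h ↦ ?_, fun h ↦ h.tail (bruhatStep_simpleRefl_mul hv)⟩
  have := h.simpleRefl_mul_right a
  rw [← mul_assoc, simpleRefl_mul_self, one_mul] at this
  exact this.elim id (.head (bruhatStep_simpleRefl_mul hx))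

lemma bruhatChain_simpleRefl_mul_iff_of_not_pos {x v : ExtAffWeyl P} {a : AffNode b}
    (hv : (v⁻¹ • nodeRoot b a).Pos b) (hx : ¬ (x⁻¹ • nodeRoot b a).Pos b) :
    BruhatChain b x (simpleRefl b a * v) ↔ BruhatChain b (simpleRefl b a * x) v := by
  constructor
  · intro h
    have := h.simpleRefl_mul_right a
    rw [← mul_assoc, simpleRefl_mul_self, one_mul] at this
    exact this.elim (.head (bruhatStep_of_not_pos hx)) id
  · intro h
    have := h.simpleRefl_mul_left a
    rw [← mul_assoc, simpleRefl_mul_self, one_mul] at this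
    exact this.elim (·.tail (bruhatStep_simpleRefl_mul hv)) id

/-! ### Affine Grassmannian elements -/

lemma isGrassmannian_iff {w : ExtAffWeyl P} :
    IsGrassmannian b w ↔ ∀ i : b.support, (w • nodeRoot b (.inl i)).Pos b := by
  refine forall_congr' fun i ↦ ?_
  rw [bruhatLE_iff]
  constructor
  · rintro ⟨h, -⟩
    by_contra h'
    have := h.invLength_le
    have := invLength_mul_simpleRefl_of_not_pos h'
    omega
  · intro h
    have h1 := invLength_mul_simpleRefl h
    refine ⟨.single ⟨by omega, _, congrArg (w * ·) (simpleRefl_eq _)⟩, fun h2 ↦ ?_⟩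
    rw [← h2] at h1
    omega

omit [Finite ι] [P.IsReduced] in
lemma fin_smul (u : P.weylGroup) (i : ι) (k : ℤ) :
    fin P u • AffRoot.mk P i k = AffRoot.mk P (P.weylGroupToPerm u i) k := by
  apply AffRoot.real_injective
  rw [AffRoot.real_smul]
  simp [affAct, AffRoot.real, smul_root]

omit [Finite ι] [P.IsReduced] in
lemma trans_smul (μ : Y) (i : ι) (k : ℤ) :
    trans P μ • AffRoot.mk P i k = AffRoot.mk P i (k - P.toLinearMap (P.root i) μ) := by
  apply AffRoot.real_injective
  rw [AffRoot.real_smul]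
  simp [affAct, AffRoot.real]

/-- The simple finite roots go to positive affine roots, the affine cone is closed under addition,
and `δ` is fixed. -/
lemma IsGrassmannian.pos_smul {w : ExtAffWeyl P} (hw : IsGrassmannian b w) {i : ι} {k : ℤ}
    (hi : b.IsPos i) (hk : 0 ≤ k) : (w • AffRoot.mk P i k).Pos b := by
  rw [isGrassmannian_iff] at hw
  rw [isPos_iff_mem_rootCone] at hi
  rw [pos_iff_real_mem_affCone, AffRoot.real_smul]
  have h0 : (((0, k) : X × ℤ)) ∈ affCone b := by
    rcases hk.eq_or_lt with rfl | hk
    · exact zero_mem _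
    · exact Or.inl hk
  have h1 : affAct P w (P.root i, 0) ∈ affCone b := by
    generalize P.root i = x at hi
    induction hi using AddSubmonoid.closure_induction with
    | mem x hx =>
      obtain ⟨j, hj, rfl⟩ := hx
      have := hw ⟨j, hj⟩
      rw [pos_iff_real_mem_affCone, AffRoot.real_smul, real_nodeRoot] at this
      exact this
    | zero => rw [affAct_delta]; exact zero_mem _
    | add x y _ _ hx hy =>
      rw [← add_zero (0 : ℤ), ← Prod.mk_add_mk, affAct_add]
      exact add_mem hx hy
  have h2 := add_mem h1 h0
  rw [← affAct_delta w, ← affAct_add] at h2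
  simpa [AffRoot.real] using h2

/-- Finite elements preserve levels, so the roots to be tested have level `0` and a positive finite
part, and `w` keeps these positive. In particular `w` is the strictly shortest element of `wW`. -/
lemma IsGrassmannian.invLength_mul_fin {w : ExtAffWeyl P} (hw : IsGrassmannian b w)
    (u : P.weylGroup) :
    invLength b (w * fin P u) = invLength b w + invLength b (fin P u) := by
  refine invLength_mul_eq ?_
  rintro ⟨i, k⟩ (h | ⟨h, h'⟩) hγ
  · refine absurd (Or.inl ?_) hγ
    change 0 < ((fin P u)⁻¹ • AffRoot.mk P i k).2
    have : (fin P u)⁻¹ = fin P u⁻¹ :=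
      (map_inv (SemidirectProduct.inr : P.weylGroup →* ExtAffWeyl P) u).symm
    rw [this, fin_smul]
    exact h
  · exact hw.pos_smul h' h.ge

lemma invLength_fin_eq_zero {u : P.weylGroup} (h : invLength b (fin P u) = 0) : u = 1 := by
  have : fin P u = 1 := eq_one_of_isAffine (b := b) (zero_mem (AddSubgroup.closure (P.coroot '' b.support))) h
  exact SemidirectProduct.inr_injective this

omit [Finite ι] [P.IsReduced] in
lemma IsAntidominant.le_zero {μ : Y} (hμ : IsAntidominant b μ) {i : ι} (hi : b.IsPos i) :
    P.toLinearMap (P.root i) μ ≤ 0 := by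
  rw [isPos_iff_mem_rootCone] at hi
  generalize P.root i = x at hi
  induction hi using AddSubmonoid.closure_induction with
  | mem x hx =>
    obtain ⟨j, hj, rfl⟩ := hx
    exact hμ j hj
  | zero => simp
  | add x y _ _ hx hy =>
    rw [map_add, LinearMap.add_apply]
    omega

omit [Finite ι] [P.IsReduced] in
-- The inverse of `t_μ` adds `⟨μ, α⟩` to the level over `α`, and this is nonnegative when `α` is
-- negative.
lemma IsAntidominant.pos_of_trans_inv {μ : Y} (hμ : IsAntidominant b μ) {γ : AffRoot P}
    (hγ : γ.Pos b) (h : ¬ ((trans P μ)⁻¹ • γ).Pos b) : b.IsPos γ.1 ∧ 0 ≤ γ.2 := by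
  obtain ⟨i, k⟩ := γ
  have hk : 0 ≤ k := by
    rcases hγ with h1 | h1
    · exact h1.le
    · exact h1.1.ge
  refine ⟨by_contra fun hi ↦ h ?_, hk⟩
  have hi' := hμ.le_zero ((isPos_neg_iff i).mpr hi)
  rw [root_reflectionPerm_self, map_neg, LinearMap.neg_apply] at hi'
  change ((trans P μ)⁻¹ • AffRoot.mk P i k).Pos b
  rw [← trans_neg, trans_smul, map_neg]
  rcases hγ with h1 | h1
  · exact Or.inl (by change 0 < k at h1; change 0 < k - -_; omega)
  · exact absurd h1.2 hi

lemma IsGrassmannian.mul_trans {w : ExtAffWeyl P} (hw : IsGrassmannian b w) {μ : Y}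
    (hμ : IsAntidominant b μ) : IsGrassmannian b (w * trans P μ) := by
  rw [isGrassmannian_iff]
  intro i
  have hi : b.IsPos (i : ι) := RootPairing.Base.isPos_of_mem_support i.2
  rw [mul_smul]
  change (w • trans P μ • AffRoot.mk P (i : ι) 0).Pos b
  rw [trans_smul]
  exact hw.pos_smul hi (by have := hμ.le_zero hi; omega)

lemma IsGrassmannian.invLength_mul_trans {w : ExtAffWeyl P} (hw : IsGrassmannian b w) {μ : Y}
    (hμ : IsAntidominant b μ) :
    invLength b (w * trans P μ) = invLength b w + invLength b (trans P μ) := by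
  refine invLength_mul_eq fun γ hγ h ↦ ?_
  obtain ⟨h1, h2⟩ := hμ.pos_of_trans_inv hγ h
  exact hw.pos_smul h1 h2

end AffNilHecke

end

noncomputable section

namespace AffNilHecke

variable {ι X Y : Type*} [AddCommGroup X] [AddCommGroup Y] {P : RootPairing ι ℤ X Y}
variable {b : P.Base}

/-! ### Pairs of nodes -/

lemma pairing_levelZeroIdx_inr_left (j : {j : ι // IsHighestRoot b j}) (i : ι) :
    P.pairing (levelZeroIdx b (.inr j)) i = -P.pairing j i :=
  P.pairing_reflectionPerm_self_left j i

lemma pairing_levelZeroIdx_inr_right (j : {j : ι // IsHighestRoot b j}) (i : ι) :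
    P.pairing i (levelZeroIdx b (.inr j)) = -P.pairing i j :=
  P.pairing_reflectionPerm_self_right i j

/-- A highest root pairs nonnegatively with positive roots and enters with a minus sign. Two
distinct highest roots with positive pairing would differ by a root that is both positive and
negative. -/
lemma pairing_levelZeroIdx_nonpos [Finite ι] {a a' : AffNode b} (h : a ≠ a') :
    P.pairing (levelZeroIdx b a) (levelZeroIdx b a') ≤ 0 := by
  rcases a with i | j <;> rcases a' with i' | j'
  · have := b.pairingIn_le_zero_of_ne (i := i) (j := i')
      (fun h' ↦ h (congrArg _ (Subtype.ext h'))) i.2 i'.2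
    rwa [pairingIn_int] at this
  · rw [pairing_levelZeroIdx_inr_right, neg_nonpos]
    exact j'.2.pairing_nonneg (RootPairing.Base.isPos_of_mem_support i.2)
  · have h0 := j.2.pairing_nonneg (RootPairing.Base.isPos_of_mem_support i'.2)
    have h1 := pairing_neg_comm (P := P) (i := j.1) (j := i'.1)
    rw [pairing_levelZeroIdx_inr_left, neg_nonpos]
    change 0 ≤ P.pairing j.1 i'.1
    omega
  · rw [pairing_levelZeroIdx_inr_left, pairing_levelZeroIdx_inr_right, neg_neg]
    by_contra! hp
    obtain ⟨k, hk⟩ := root_sub_mem_of_pairing_pos hp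
      (fun h' ↦ h (congrArg _ (Subtype.ext h')))
    have hk' : P.root (P.reflectionPerm k k) = P.root j' - P.root j := by
      rw [root_reflectionPerm_self, hk, neg_sub]
    exact (isPos_neg_iff k).mp (j'.2.isPos_of_root_eq_sub hk') (j.2.isPos_of_root_eq_sub hk)

/-- The hypothesis `hopp` excludes affine type A1, where both pairings are `-2` and the two
reflections generate an infinite group. -/
lemma pairing_levelZeroIdx_mem [Finite ι] [P.IsReduced] {a a' : AffNode b} (h : a ≠ a')
    (hopp : P.root (levelZeroIdx b a) ≠ -P.root (levelZeroIdx b a')) :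
    (P.pairing (levelZeroIdx b a) (levelZeroIdx b a'),
      P.pairing (levelZeroIdx b a') (levelZeroIdx b a)) ∈
      ({(0, 0), (-1, -1), (-1, -2), (-2, -1), (-1, -3), (-3, -1)} : Set (ℤ × ℤ)) := by
  have h1 := pairing_levelZeroIdx_nonpos h
  have hne : P.root (levelZeroIdx b a) ≠ P.root (levelZeroIdx b a') := fun he ↦ by
    rw [P.root.injective he, P.pairing_same] at h1
    omega
  have := P.pairingIn_pairingIn_mem_set_of_isCrystal_of_isRed' _ _ hne hopp
  rw [pairingIn_int, pairingIn_int] at this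
  simp only [Set.mem_insert_iff, Set.mem_singleton_iff, Prod.mk.injEq] at this ⊢
  omega

lemma simpleRefl_mul_conj (a a' : AffNode b) :
    simpleRefl b a * simpleRefl b a' * simpleRefl b a =
      affRefl (simpleRefl b a • nodeRoot b a') := by
  rw [← affRefl_conj, simpleRefl_inv, ← simpleRefl_eq]

/-- The combination `x α_a + y α_{a'}` of two affine simple roots. -/
def nodeComb (a a' : AffNode b) (x y : ℤ) : X × ℤ :=
  x • affSimpleRoot b a + y • affSimpleRoot b a'

lemma affAct_simpleRefl_nodeComb_left (a a' : AffNode b) (x y : ℤ) :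
    affAct P (simpleRefl b a) (nodeComb a a' x y) =
      nodeComb a a' (-x - P.pairing (levelZeroIdx b a') (levelZeroIdx b a) * y) y := by
  have h : P.toLinearMap (nodeComb a a' x y).1 (P.coroot (nodeRoot b a).1) =
      2 * x + P.pairing (levelZeroIdx b a') (levelZeroIdx b a) * y := by
    simp only [nodeComb, Prod.fst_add, Prod.smul_fst, ← root_levelZeroIdx, nodeRoot, map_add,
      map_zsmul, LinearMap.add_apply, LinearMap.smul_apply, RootPairing.root_coroot_eq_pairing,
      RootPairing.pairing_same, smul_eq_mul]
    ring
  rw [simpleRefl_eq, affAct_affRefl, real_nodeRoot, h, nodeComb, nodeComb]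
  module

lemma nodeComb_swap (a a' : AffNode b) (x y : ℤ) : nodeComb a a' x y = nodeComb a' a y x :=
  add_comm _ _

lemma affAct_simpleRefl_nodeComb_right (a a' : AffNode b) (x y : ℤ) :
    affAct P (simpleRefl b a') (nodeComb a a' x y) =
      nodeComb a a' x (-y - P.pairing (levelZeroIdx b a) (levelZeroIdx b a') * x) := by
  rw [nodeComb_swap, affAct_simpleRefl_nodeComb_left, nodeComb_swap]

lemma real_nodeRoot_left (a a' : AffNode b) : (nodeRoot b a).real = nodeComb a a' 1 0 := by
  rw [real_nodeRoot, nodeComb]; module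

lemma real_nodeRoot_right (a a' : AffNode b) : (nodeRoot b a').real = nodeComb a a' 0 1 := by
  rw [real_nodeRoot, nodeComb]; module

section GroupBraid

variable {a a' : AffNode b}

lemma simpleRefl_comm_of_pairing_eq_zero
    (hB : P.pairing (levelZeroIdx b a') (levelZeroIdx b a) = 0) :
    simpleRefl b a * simpleRefl b a' = simpleRefl b a' * simpleRefl b a := by
  have h : simpleRefl b a • nodeRoot b a' = nodeRoot b a' := AffRoot.real_injective (by
    rw [AffRoot.real_smul, real_nodeRoot_right a a', affAct_simpleRefl_nodeComb_left, hB]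
    norm_num)
  have := simpleRefl_mul_conj a a'
  rw [h, ← simpleRefl_eq, ← eq_mul_inv_iff_mul_eq, simpleRefl_inv] at this
  exact this

/-- Both sides are conjugates of simple reflections, and their roots coincide. -/
lemma simpleRefl_braid_three
    (hA : P.pairing (levelZeroIdx b a) (levelZeroIdx b a') = -1)
    (hB : P.pairing (levelZeroIdx b a') (levelZeroIdx b a) = -1) :
    simpleRefl b a * simpleRefl b a' * simpleRefl b a =
      simpleRefl b a' * simpleRefl b a * simpleRefl b a' := by
  rw [simpleRefl_mul_conj, simpleRefl_mul_conj]
  congr 1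
  apply AffRoot.real_injective
  rw [AffRoot.real_smul, real_nodeRoot_right a a', affAct_simpleRefl_nodeComb_left,
    AffRoot.real_smul, real_nodeRoot_left a a', affAct_simpleRefl_nodeComb_right, hA, hB]
  norm_num

/-- The root `s_a α_{a'}` is fixed by `s_{a'}`, which therefore commutes with its reflection `s_a
s_{a'} s_a`. -/
lemma simpleRefl_braid_four
    (hA : P.pairing (levelZeroIdx b a) (levelZeroIdx b a') = -1)
    (hB : P.pairing (levelZeroIdx b a') (levelZeroIdx b a) = -2) :
    simpleRefl b a * simpleRefl b a' * simpleRefl b a * simpleRefl b a' =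
      simpleRefl b a' * (simpleRefl b a * simpleRefl b a' * simpleRefl b a) := by
  have h : simpleRefl b a' • simpleRefl b a • nodeRoot b a' = simpleRefl b a • nodeRoot b a' :=
    AffRoot.real_injective (by
      simp only [AffRoot.real_smul, real_nodeRoot_right a a', affAct_simpleRefl_nodeComb_left,
        affAct_simpleRefl_nodeComb_right, hA, hB]
      norm_num)
  have h' := affRefl_conj (simpleRefl b a') (simpleRefl b a • nodeRoot b a')
  rw [h, ← simpleRefl_mul_conj, mul_inv_eq_iff_eq_mul] at h'
  exact h'.symm

/-- The root `s_{a'} s_a α_{a'}` is fixed by `s_a`, which therefore commutes with its reflection. -/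
lemma simpleRefl_braid_six
    (hA : P.pairing (levelZeroIdx b a) (levelZeroIdx b a') = -1)
    (hB : P.pairing (levelZeroIdx b a') (levelZeroIdx b a) = -3) :
    simpleRefl b a * (simpleRefl b a' * (simpleRefl b a * simpleRefl b a' * simpleRefl b a) *
        simpleRefl b a') =
      simpleRefl b a' * (simpleRefl b a * simpleRefl b a' * simpleRefl b a) *
        simpleRefl b a' * simpleRefl b a := by
  have h : simpleRefl b a • simpleRefl b a' • simpleRefl b a • nodeRoot b a' =
      simpleRefl b a' • simpleRefl b a • nodeRoot b a' :=
    AffRoot.real_injective (by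
      simp only [AffRoot.real_smul, real_nodeRoot_right a a', affAct_simpleRefl_nodeComb_left,
        affAct_simpleRefl_nodeComb_right, hA, hB]
      norm_num)
  have h' := affRefl_conj (simpleRefl b a) (simpleRefl b a' • simpleRefl b a • nodeRoot b a')
  rw [h, ← affRefl_conj, ← simpleRefl_mul_conj, simpleRefl_inv a', mul_inv_eq_iff_eq_mul] at h'
  exact h'

end GroupBraid

/-! ### Descents in rank two -/

/-- The inverse of `v` makes the combination `x α_a + y α_{a'}` nonpositive. -/
def NegComb (a a' : AffNode b) (v : ExtAffWeyl P) (x y : ℤ) : Prop :=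
  -affAct P v⁻¹ (nodeComb a a' x y) ∈ affCone b

lemma negComb_simpleRefl_left (a a' : AffNode b) (v : ExtAffWeyl P) (x y : ℤ) :
    NegComb a a' (simpleRefl b a * v) x y ↔ NegComb a a' v
      (-x - P.pairing (levelZeroIdx b a') (levelZeroIdx b a) * y) y := by
  rw [NegComb, mul_inv_rev, simpleRefl_inv, affAct_mul, affAct_simpleRefl_nodeComb_left]
  rfl

lemma negComb_simpleRefl_right (a a' : AffNode b) (v : ExtAffWeyl P) (x y : ℤ) :
    NegComb a a' (simpleRefl b a' * v) x y ↔ NegComb a a' v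
      x (-y - P.pairing (levelZeroIdx b a) (levelZeroIdx b a') * x) := by
  rw [NegComb, mul_inv_rev, simpleRefl_inv, affAct_mul, affAct_simpleRefl_nodeComb_right]
  rfl

lemma not_pos_iff_neg_mem {β : AffRoot P} : ¬ β.Pos b ↔ -β.real ∈ affCone b := by
  rw [← AffRoot.pos_neg_iff, pos_iff_real_mem_affCone, AffRoot.real_neg]

lemma not_pos_iff_negComb_left {a a' : AffNode b} {v : ExtAffWeyl P} :
    ¬ (v⁻¹ • nodeRoot b a).Pos b ↔ NegComb a a' v 1 0 := by
  rw [not_pos_iff_neg_mem, AffRoot.real_smul, real_nodeRoot_left a a', NegComb]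

lemma not_pos_iff_negComb_right {a a' : AffNode b} {v : ExtAffWeyl P} :
    ¬ (v⁻¹ • nodeRoot b a').Pos b ↔ NegComb a a' v 0 1 := by
  rw [not_pos_iff_neg_mem, AffRoot.real_smul, real_nodeRoot_right a a', NegComb]

/-- Two left descents of `v` turn their whole positive span negative; this makes every further
letter of a braid word a descent. -/
lemma negComb_of_nonneg {a a' : AffNode b} {v : ExtAffWeyl P} (h : NegComb a a' v 1 0)
    (h' : NegComb a a' v 0 1) {x y : ℤ} (hx : 0 ≤ x) (hy : 0 ≤ y) : NegComb a a' v x y := by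
  have := add_mem (nsmul_mem (show _ ∈ affCone b from h) x.toNat)
    (nsmul_mem (show _ ∈ affCone b from h') y.toNat)
  have key : ∀ (n : ℕ) (p : X × ℤ), n • affAct P v⁻¹ p = affAct P v⁻¹ (n • p) := fun n p ↦ by
    induction n with
    | zero => rw [zero_smul, zero_smul]; exact (affAct_delta _ _).symm
    | succ n ih => rw [succ_nsmul, ih, ← affAct_add, succ_nsmul]
  rw [smul_neg, smul_neg, key, key, ← neg_add, ← affAct_add, ← natCast_zsmul, ← natCast_zsmul,
    Int.toNat_of_nonneg hx, Int.toNat_of_nonneg hy] at this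
  have hc : nodeComb a a' x y = x • nodeComb a a' 1 0 + y • nodeComb a a' 0 1 := by
    simp only [nodeComb]
    module
  rw [NegComb, hc]
  exact this

/-- If the finite parts were opposite, the sum of the two simple roots would be a nonnegative
multiple of `δ`. It is fixed by `v⁻¹` and yet made nonpositive, so it vanishes, and the two positive
roots would be opposite. Hence two common left descents never form a pair of affine type A1. -/
lemma root_ne_neg_of_not_pos {a a' : AffNode b} {v : ExtAffWeyl P}
    (h : ¬ (v⁻¹ • nodeRoot b a).Pos b) (h' : ¬ (v⁻¹ • nodeRoot b a').Pos b) :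
    P.root (levelZeroIdx b a) ≠ -P.root (levelZeroIdx b a') := by
  intro he
  rw [not_pos_iff_neg_mem, AffRoot.real_smul] at h h'
  have h1 := add_mem h h'
  rw [← neg_add, ← affAct_add] at h1
  have h2 : (nodeRoot b a).real + (nodeRoot b a').real =
      (0, (nodeRoot b a).2 + (nodeRoot b a').2) := by
    ext
    · change P.root (levelZeroIdx b a) + P.root (levelZeroIdx b a') = 0
      rw [he, neg_add_cancel]
    · rfl
  rw [h2, affAct_delta] at h1
  have ha : 0 ≤ (nodeRoot b a).2 := by
    rcases pos_nodeRoot a with h | h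
    · exact h.le
    · exact h.1.ge
  have ha' : 0 ≤ (nodeRoot b a').2 := by
    rcases pos_nodeRoot a' with h | h
    · exact h.le
    · exact h.1.ge
  have h3 : (nodeRoot b a).2 + (nodeRoot b a').2 = 0 := by
    rcases h1 with h1 | h1
    · simp only [Prod.neg_mk] at h1; omega
    · have := h1.1; simp only [Prod.neg_mk] at this; omega
  have h4 : nodeRoot b a = -nodeRoot b a' := AffRoot.real_injective (by
    rw [AffRoot.real_neg]
    exact Prod.ext he (by change (nodeRoot b a).2 = -(nodeRoot b a').2; omega))
  have h5 := pos_nodeRoot a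
  rw [h4, AffRoot.pos_neg_iff] at h5
  exact h5 (pos_nodeRoot a')

/-! ### Products along reduced words -/

variable (b) in
/-- The word `t` can be split off from the left of `v`, letter by letter, in a length decreasing
way. -/
def DescentWord : ExtAffWeyl P → List (AffNode b) → Prop
  | _, [] => True
  | v, c :: t => ¬ (v⁻¹ • nodeRoot b c).Pos b ∧ DescentWord (simpleRefl b c * v) t

variable [Finite ι] [P.IsReduced]

lemma DescentWord.invLength_eq {v : ExtAffWeyl P} {t : List (AffNode b)} (h : DescentWord b v t) :
    invLength b v = t.length + invLength b ((wordProd b t)⁻¹ * v) := by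
  induction t generalizing v with
  | nil => simp
  | cons c t ih =>
    have h1 := invLength_simpleRefl_mul_of_not_pos h.1
    have h2 := ih h.2
    rw [← mul_assoc] at h2
    rw [wordProd_cons, mul_inv_rev, simpleRefl_inv, List.length_cons]
    omega

/-- A map to a monoid satisfies the braid relations of the affine Weyl group. -/
structure IsBraided {M : Type*} [Monoid M] (f : AffNode b → M) : Prop where
  two : ∀ {a a'}, P.pairing (levelZeroIdx b a) (levelZeroIdx b a') = 0 →
    P.pairing (levelZeroIdx b a') (levelZeroIdx b a) = 0 → f a * f a' = f a' * f a
  three : ∀ {a a'}, P.pairing (levelZeroIdx b a) (levelZeroIdx b a') = -1 →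
    P.pairing (levelZeroIdx b a') (levelZeroIdx b a) = -1 →
    f a * f a' * f a = f a' * f a * f a'
  four : ∀ {a a'}, P.pairing (levelZeroIdx b a) (levelZeroIdx b a') = -1 →
    P.pairing (levelZeroIdx b a') (levelZeroIdx b a) = -2 →
    f a * f a' * f a * f a' = f a' * f a * f a' * f a
  six : ∀ {a a'}, P.pairing (levelZeroIdx b a) (levelZeroIdx b a') = -1 →
    P.pairing (levelZeroIdx b a') (levelZeroIdx b a) = -3 →
    f a * f a' * f a * f a' * f a * f a' = f a' * f a * f a' * f a * f a' * f a

/-- Two left descents of `v` span a rank two system of finite type, and `v` starts with the longest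
element of its dihedral group, which is spelled by both sides of the braid relation. -/
lemma exists_common_word {M : Type*} [Monoid M] {f : AffNode b → M} (hf : IsBraided f)
    {v : ExtAffWeyl P} {a a' : AffNode b} (hne : a ≠ a')
    (h : ¬ (v⁻¹ • nodeRoot b a).Pos b) (h' : ¬ (v⁻¹ • nodeRoot b a').Pos b) :
    ∃ t t', t.length = t'.length ∧ wordProd b (a :: t) = wordProd b (a' :: t') ∧
      DescentWord b v (a :: t) ∧ ((a :: t).map f).prod = ((a' :: t').map f).prod := by
  have hopp := root_ne_neg_of_not_pos h h'
  have hmem := pairing_levelZeroIdx_mem hne hopp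
  rw [not_pos_iff_negComb_left (a' := a')] at h
  rw [not_pos_iff_negComb_right (a := a)] at h'
  have hN : ∀ {x y : ℤ}, 0 ≤ x → 0 ≤ y → NegComb a a' v x y := negComb_of_nonneg h h'
  have hl := fun (v : ExtAffWeyl P) ↦ not_pos_iff_negComb_left (a := a) (a' := a') (v := v)
  have hr := fun (v : ExtAffWeyl P) ↦ not_pos_iff_negComb_right (a := a) (a' := a') (v := v)
  simp only [Set.mem_insert_iff, Set.mem_singleton_iff, Prod.mk.injEq] at hmem
  -- Types A1 × A1, A2, B2 and G2, the last two in both orders.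
  rcases hmem with ⟨hA, hB⟩ | ⟨hA, hB⟩ | ⟨hA, hB⟩ | ⟨hA, hB⟩ | ⟨hA, hB⟩ | ⟨hA, hB⟩
  · refine ⟨[a'], [a], rfl, ?_, ?_, ?_⟩
    · simp [simpleRefl_comm_of_pairing_eq_zero hB]
    · simp only [DescentWord, hl, hr, negComb_simpleRefl_left, hB]
      refine ⟨hN ?_ ?_, hN ?_ ?_, trivial⟩ <;> norm_num
    · simp [hf.two hA hB]
  · refine ⟨[a', a], [a, a'], rfl, ?_, ?_, ?_⟩
    · simpa [mul_assoc] using simpleRefl_braid_three hA hB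
    · simp only [DescentWord, hl, hr, negComb_simpleRefl_left, negComb_simpleRefl_right, hA, hB]
      refine ⟨hN ?_ ?_, hN ?_ ?_, hN ?_ ?_, trivial⟩ <;> norm_num
    · simpa [mul_assoc] using hf.three hA hB
  · refine ⟨[a', a, a'], [a, a', a], rfl, ?_, ?_, ?_⟩
    · simpa [mul_assoc] using simpleRefl_braid_four hA hB
    · simp only [DescentWord, hl, hr, negComb_simpleRefl_left, negComb_simpleRefl_right, hA, hB]
      refine ⟨hN ?_ ?_, hN ?_ ?_, hN ?_ ?_, hN ?_ ?_, trivial⟩ <;> norm_num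
    · simpa [mul_assoc] using hf.four hA hB
  · refine ⟨[a', a, a'], [a, a', a], rfl, ?_, ?_, ?_⟩
    · simpa [mul_assoc] using (simpleRefl_braid_four hB hA).symm
    · simp only [DescentWord, hl, hr, negComb_simpleRefl_left, negComb_simpleRefl_right, hA, hB]
      refine ⟨hN ?_ ?_, hN ?_ ?_, hN ?_ ?_, hN ?_ ?_, trivial⟩ <;> norm_num
    · simpa [mul_assoc] using (hf.four hB hA).symm
  · refine ⟨[a', a, a', a, a'], [a, a', a, a', a], rfl, ?_, ?_, ?_⟩
    · simpa [mul_assoc] using simpleRefl_braid_six hA hB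
    · simp only [DescentWord, hl, hr, negComb_simpleRefl_left, negComb_simpleRefl_right, hA, hB]
      refine ⟨hN ?_ ?_, hN ?_ ?_, hN ?_ ?_, hN ?_ ?_, hN ?_ ?_, hN ?_ ?_, trivial⟩ <;> norm_num
    · simpa [mul_assoc] using hf.six hA hB
  · refine ⟨[a', a, a', a, a'], [a, a', a, a', a], rfl, ?_, ?_, ?_⟩
    · simpa [mul_assoc] using (simpleRefl_braid_six hB hA).symm
    · simp only [DescentWord, hl, hr, negComb_simpleRefl_left, negComb_simpleRefl_right, hA, hB]
      refine ⟨hN ?_ ?_, hN ?_ ?_, hN ?_ ?_, hN ?_ ?_, hN ?_ ?_, hN ?_ ?_, trivial⟩ <;> norm_num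
    · simpa [mul_assoc] using (hf.six hB hA).symm

lemma not_pos_of_reduced_cons {a : AffNode b} {l : List (AffNode b)}
    (h : (a :: l).length = invLength b (wordProd b (a :: l))) :
    ¬ ((wordProd b (a :: l))⁻¹ • nodeRoot b a).Pos b ∧
      l.length = invLength b (wordProd b l) := by
  have h1 := invLength_wordProd_le l
  have h2 : ((wordProd b l)⁻¹ • nodeRoot b a).Pos b := by
    by_contra h3
    have := invLength_simpleRefl_mul_of_not_pos h3
    rw [wordProd_cons, List.length_cons] at h
    omega
  have h3 := invLength_simpleRefl_mul h2
  rw [wordProd_cons, mul_inv_rev, simpleRefl_inv, mul_smul, simpleRefl_smul_nodeRoot,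
    AffRoot.pos_smul_neg]
  rw [wordProd_cons, List.length_cons] at h
  exact ⟨not_not.mpr h2, by omega⟩

/-- **Matsumoto's theorem** for the affine Weyl group. -/
theorem IsBraided.prod_eq {M : Type*} [Monoid M] {f : AffNode b → M} (hf : IsBraided f)
    {l l' : List (AffNode b)} (hl : l.length = invLength b (wordProd b l))
    (hl' : l'.length = invLength b (wordProd b l')) (h : wordProd b l = wordProd b l') :
    (l.map f).prod = (l'.map f).prod := by
  induction hn : l.length generalizing l l' with
  | zero =>
    have h1 : l = [] := List.length_eq_zero_iff.mp hn
    have h2 : l' = [] := List.length_eq_zero_iff.mp (by rw [hl', ← h, ← hl, hn])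
    rw [h1, h2]
  | succ n ih =>
    obtain ⟨a, l, rfl⟩ := List.exists_cons_of_length_eq_add_one hn
    have hn' : l'.length = n + 1 := by rw [hl', ← h, ← hl, hn]
    obtain ⟨a', l', rfl⟩ := List.exists_cons_of_length_eq_add_one hn'
    have h1 := not_pos_of_reduced_cons hl
    have h2 := not_pos_of_reduced_cons hl'
    rw [List.length_cons, Nat.add_right_cancel_iff] at hn hn'
    by_cases hne : a = a'
    · subst hne
      rw [wordProd_cons, wordProd_cons, mul_right_inj] at h
      rw [List.map_cons, List.map_cons, List.prod_cons, List.prod_cons, ih h1.2 h2.2 h hn]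
    -- The two words are linked through two further reduced words of the same element, which begin
    -- with the two sides of the braid relation and end in the same word `r'`. Each link shares a
    -- first letter, so induction applies after removing it.
    · obtain ⟨t, t', h3, h4, h5, h6⟩ := exists_common_word hf hne h1.1 (h ▸ h2.1)
      obtain ⟨r, hr⟩ : ∃ r, wordProd b r = (wordProd b (a :: t))⁻¹ * wordProd b (a :: l) :=
        ⟨(a :: t).reverse ++ a :: l, by rw [wordProd_append, wordProd_reverse]⟩
      obtain ⟨r', hr', hr''⟩ := exists_reduced_wordProd r
      have h7 := h5.invLength_eq
      rw [← hr, ← hr'', ← hl] at h7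
      simp only [List.length_cons] at h7
      have h8 : wordProd b (t ++ r') = wordProd b l := by
        rw [wordProd_append, hr', hr, wordProd_cons, wordProd_cons]
        group
      have h9 : wordProd b (t' ++ r') = wordProd b l' := by
        rw [wordProd_append, hr', hr, h4, h, wordProd_cons, wordProd_cons]
        group
      have h10 := ih (l' := t ++ r') h1.2 (by rw [h8, ← h1.2, List.length_append]; omega)
        h8.symm hn
      have h11 := ih (l' := t' ++ r') h2.2 (by rw [h9, ← h2.2, List.length_append]; omega)
        h9.symm hn'
      simp only [List.map_cons, List.prod_cons] at h6
      rw [List.map_cons, List.prod_cons, h10, List.map_cons, List.prod_cons, h11, List.map_append,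
        List.map_append, List.prod_append, List.prod_append, ← mul_assoc, ← mul_assoc, h6]

end AffNilHecke

end

noncomputable section

namespace AffNilHecke

/-! ### Braid relations for divided differences in a smash product -/

section DividedDifference

open SkewMonoidAlgebra

variable {G L K : Type*} [Group G] [CommRing L] [MulSemiringAction G L] [Field K] {f : L →+* K}

/-- The element `d (s - 1)` of the smash product. -/
def dividedDiff (s : G) (d : L) : SkewMonoidAlgebra L G := single 1 d * (of L G s - 1)

lemma dividedDiff_mul_single (s : G) (d : L) (v : G) (p : L) :
    dividedDiff s d * single v p = single (s * v) (d * s • p) - single v (d * p) := by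
  rw [dividedDiff, of_apply, sub_eq_add_neg, mul_add, single_mul_single, add_mul, mul_neg,
    single_mul_single, mul_one, neg_mul, single_mul_single]
  simp [sub_eq_add_neg]

variable (f) in
/-- `x` is the product with `e` of a sum of multiples of the group elements `v j`, whose
coefficients are mapped by `f` to `z j`. -/
def IsCosetSum {n : ℕ} (v : Fin n → G) (e : SkewMonoidAlgebra L G) (z : Fin n → K)
    (x : SkewMonoidAlgebra L G) : Prop :=
  ∃ p : Fin n → L, (∀ j, f (p j) = z j) ∧ x = (∑ j, single (v j) (p j)) * e

/-- Left multiplication by `s` permutes the cosets by `π`; a representative may come back with the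
reflection of the right factor attached, and `ε` records the resulting sign. The coefficients thus
evolve by a formula in `K`. -/
lemma IsCosetSum.dividedDiff_mul {n : ℕ} {v : Fin n → G} {e : SkewMonoidAlgebra L G}
    {z z' : Fin n → K} {x : SkewMonoidAlgebra L G} (h : IsCosetSum f v e z x) {s : G} {d : L}
    {σ : K →+* K} (hσ : ∀ p, σ (f p) = f (s • p)) {π : Fin n → Fin n}
    (hπ : Function.Involutive π) {ε : Fin n → ℤ}
    (hv : ∀ j q, single (s * v (π j)) q * e = single (v j) (ε j • q) * e)
    (hz : ∀ j, z' j = f d * (ε j • σ (z (π j)) - z j)) :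
    IsCosetSum f v e z' (dividedDiff s d * x) := by
  obtain ⟨p, hp, rfl⟩ := h
  refine ⟨fun j ↦ d * (ε j • s • p (π j) - p j), fun j ↦ ?_, ?_⟩
  · rw [hz, map_mul, map_sub, map_zsmul, ← hσ, hp, hp]
  · rw [← mul_assoc, Finset.mul_sum]
    simp only [dividedDiff_mul_single, Finset.sum_sub_distrib, sub_mul, mul_sub]
    rw [← Equiv.sum_comp (Function.Involutive.toPerm π hπ), Finset.sum_mul]
    simp only [Function.Involutive.coe_toPerm, hv, sub_eq_add_neg, single_add, single_neg,
      Finset.sum_add_distrib, add_mul, Finset.sum_mul, Finset.sum_neg_distrib, neg_mul, mul_smul_comm]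

lemma single_mul_of_sub_one (v s : G) (p : L) :
    single v p * (of L G s - 1) = single (v * s) p - single v p := by
  rw [of_apply, mul_sub, single_mul_single, smul_one, mul_one, mul_one]

lemma isCosetSum_dividedDiff {n : ℕ} (v : Fin (n + 1) → G) (hv : v 0 = 1) (s : G) (d : L)
    (z : Fin (n + 1) → K) (hz : z 0 = f d) (hz' : ∀ j : Fin n, z j.succ = 0) :
    IsCosetSum f v (of L G s - 1) z (dividedDiff s d) := by
  refine ⟨Fin.cons d 0, fun j ↦ ?_, ?_⟩
  · refine Fin.cases ?_ (fun j ↦ ?_) j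
    · rw [Fin.cons_zero, hz]
    · rw [Fin.cons_succ, hz', Pi.zero_apply, map_zero]
  · simp [Fin.sum_univ_succ, hv, dividedDiff]

/-- Since `s (s - 1) = -(s - 1)`; this is the source of the signs `-1`. -/
lemma single_mul_mul_of_sub_one {s : G} (hs : s * s = 1) (v : G) (p : L) :
    single (v * s) p * (of L G s - 1) = single v (-p) * (of L G s - 1) := by
  rw [single_mul_of_sub_one, single_mul_of_sub_one, mul_assoc, hs, mul_one, single_neg, single_neg]
  abel

/-- Allows the coefficients to be computed in the field `K` and then pulled back to `L`. -/
lemma IsCosetSum.eq_sum (hf : Function.Injective f) {n : ℕ} {v : Fin n → G}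
    {e : SkewMonoidAlgebra L G} {z : Fin n → K} {x : SkewMonoidAlgebra L G}
    (h : IsCosetSum f v e z x) {q : Fin n → L} (hq : ∀ j, f (q j) = z j) :
    x = ∑ j, single (v j) (q j) * e := by
  obtain ⟨p, hp, rfl⟩ := h
  rw [Finset.sum_mul]
  refine Finset.sum_congr rfl fun j _ ↦ ?_
  rw [hf ((hp j).trans (hq j).symm)]

/-- The data needed for the braid relation between the divided differences for two simple
reflections `s` and `t`: `σ` and `τ` are the actions of `s` and `t` on a field that contains the
coefficients and in which `x` and `y` are the exponentials of the simple roots. -/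
structure DihedralData (f : L →+* K) (s t : G) (σ τ : K →+* K) (d d' : L) (x y : K) : Prop where
  inj : Function.Injective f
  mul_self_left : s * s = 1
  mul_self_right : t * t = 1
  map_left : ∀ p, σ (f p) = f (s • p)
  map_right : ∀ p, τ (f p) = f (t • p)
  coeff_left : f d = (1 - x)⁻¹
  coeff_right : f d' = (1 - y)⁻¹
  ne_left : x ≠ 0
  ne_right : y ≠ 0
  apply_left : σ x = x⁻¹
  apply_right : τ y = y⁻¹

variable {s t : G} {σ τ : K →+* K} {d d' : L} {x y : K}

lemma DihedralData.symm (h : DihedralData f s t σ τ d d' x y) :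
    DihedralData f t s τ σ d' d y x :=
  ⟨h.inj, h.mul_self_right, h.mul_self_left, h.map_right, h.map_left, h.coeff_right, h.coeff_left,
    h.ne_right, h.ne_left, h.apply_right, h.apply_left⟩

lemma map_eq_of_mul_one_sub {a a' : K} {x' : K} (h : a * (1 - x) = 1) (h' : a' * (1 - x') = 1)
    (hx : σ x = x') : σ a = a' := by
  have h1 : σ a * (1 - x') = 1 := by rw [← hx, ← map_one σ, ← map_sub, ← map_mul, h]
  have h2 : 1 - x' ≠ 0 := right_ne_zero_of_mul_eq_one h'
  exact mul_right_cancel₀ h2 (h1.trans h'.symm)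

/-- The identity `1 / (1 - x⁻¹) = -x / (1 - x)`. -/
lemma map_eq_neg_of_mul_one_sub {a : K} (h : a * (1 - x) = 1) (h0 : x ≠ 0) (hx : σ x = x⁻¹) :
    σ a = -x * a :=
  map_eq_of_mul_one_sub h (by field_simp; linear_combination h) hx

lemma single_mul_of_eq_mul {e : SkewMonoidAlgebra L G} {v v' : G} (h : s * v' = v) (q : L) :
    single (s * v') q * e = single v ((1 : ℤ) • q) * e := by
  rw [h, one_smul]

lemma single_mul_of_eq_mul_right {r : G} (hr : r * r = 1) {v v' : G} (h : s * v' = v * r) (q : L) :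
    single (s * v') q * (of L G r - 1) = single v ((-1 : ℤ) • q) * (of L G r - 1) := by
  rw [h, neg_one_smul, single_mul_mul_of_sub_one hr]

/-! ### Alternating products of divided differences in rank two -/

set_option linter.unusedSimpArgs false in
-- `1`, `t`, `st` represent the dihedral group of order six modulo `s` on the right. At the end
-- every coefficient is, up to sign, the product of `1 / (1 - e^β)` over the positive roots `β`,
-- which is symmetric in `s` and `t`.
lemma DihedralData.isCosetSum_three (h : DihedralData f s t σ τ d d' x y)
    (hst : t * (s * t) = s * (t * s)) (hσy : σ y = x * y) (hτx : τ x = x * y)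
    {a b c : K} (ha : a * (1 - x) = 1) (hb : b * (1 - y) = 1) (hc : c * (1 - x * y) = 1) :
    IsCosetSum f ![1, t, s * t] (of L G s - 1)
      ![a * b * c, -(a * b * c), a * b * c]
      (dividedDiff s d * (dividedDiff t d' * dividedDiff s d)) := by
  have hσa : σ a = -x * a := map_eq_neg_of_mul_one_sub ha h.ne_left h.apply_left
  have hσb : σ b = c := map_eq_of_mul_one_sub hb hc (by simp only [hσy])
  have hσc : σ c = b := map_eq_of_mul_one_sub hc hb (by
    simp only [map_mul, map_pow, hσy, h.apply_left]
    field_simp [h.ne_left, h.ne_right])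
  have hτa : τ a = c := map_eq_of_mul_one_sub ha hc (by simp only [hτx])
  have hτb : τ b = -y * b := map_eq_neg_of_mul_one_sub hb h.ne_right h.apply_right
  have hτc : τ c = a := map_eq_of_mul_one_sub hc ha (by
    simp only [map_mul, map_pow, hτx, h.apply_right]
    field_simp [h.ne_left, h.ne_right])
  have ha' := right_ne_zero_of_mul_eq_one ha
  have hb' := right_ne_zero_of_mul_eq_one hb
  have hc' := right_ne_zero_of_mul_eq_one hc
  have ha'' := eq_inv_of_mul_eq_one_left ha
  have hb'' := eq_inv_of_mul_eq_one_left hb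
  have hc'' := eq_inv_of_mul_eq_one_left hc
  have hx := h.ne_left
  have hy := h.ne_right
  have hl : ∀ v, s * (s * v) = v := fun v ↦ by rw [← mul_assoc, h.mul_self_left, one_mul]
  have hr : ∀ v, t * (t * v) = v := fun v ↦ by rw [← mul_assoc, h.mul_self_right, one_mul]
  have hvs : ∀ j q, single (s * (![1, t, s * t] : Fin 3 → G) (![0, 2, 1] j)) q * (of L G s - 1) =
      single ((![1, t, s * t] : Fin 3 → G) j) ((![-1, 1, 1] : Fin 3 → ℤ) j • q) * (of L G s - 1) := fun j q ↦ by
    fin_cases j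
    · exact single_mul_of_eq_mul_right h.mul_self_left (by simp) q
    · exact single_mul_of_eq_mul (by simp [hl, h.mul_self_right]) q
    · exact single_mul_of_eq_mul (by simp [hl, h.mul_self_right]) q
  have hvt : ∀ j q, single (t * (![1, t, s * t] : Fin 3 → G) (![1, 0, 2] j)) q * (of L G s - 1) =
      single ((![1, t, s * t] : Fin 3 → G) j) ((![1, 1, -1] : Fin 3 → ℤ) j • q) * (of L G s - 1) := fun j q ↦ by
    fin_cases j
    · exact single_mul_of_eq_mul (by simp [hr, h.mul_self_right]) q
    · exact single_mul_of_eq_mul (by simp [hr, h.mul_self_right]) q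
    · exact single_mul_of_eq_mul_right h.mul_self_left (by simpa [mul_assoc] using hst) q
  -- The product is built from its rightmost factor; each `z'` lists the coefficients after one more
  -- factor on the left.
  have H0 := isCosetSum_dividedDiff (f := f) ![1, t, s * t] rfl s d ![a, 0, 0]
    (h.coeff_left.trans ha''.symm).symm (by simp [Fin.forall_fin_succ])
  have H1 := H0.dividedDiff_mul h.map_right (d := d') (π := ![1, 0, 2])
    (ε := ![1, 1, -1])
    (z' := ![-(a * b), b * c, 0])
    (fun j ↦ by fin_cases j <;> rfl) hvt (fun j ↦ by
      rw [h.coeff_right, ← hb'']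
      fin_cases j
      all_goals
        simp only [Fin.zero_eta, Fin.mk_one, Fin.reduceFinMk, Matrix.cons_val, map_mul, map_neg,
          map_add, map_one, map_pow, map_zero, one_smul, neg_one_smul, h.apply_left, h.apply_right, hτa, hτb, hτc, hτx]
        simp only [ha'', hb'', hc'']
        try field_simp
        try ring)
  have H2 := H1.dividedDiff_mul h.map_left (d := d) (π := ![0, 2, 1])
    (ε := ![-1, 1, 1])
    (z' := ![a * b * c, -(a * b * c), a * b * c])
    (fun j ↦ by fin_cases j <;> rfl) hvs (fun j ↦ by
      rw [h.coeff_left, ← ha'']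
      fin_cases j
      all_goals
        simp only [Fin.zero_eta, Fin.mk_one, Fin.reduceFinMk, Matrix.cons_val, map_mul, map_neg,
          map_add, map_one, map_pow, map_zero, one_smul, neg_one_smul, h.apply_left, h.apply_right, hσa, hσb, hσc, hσy]
        simp only [ha'', hb'', hc'']
        try field_simp
        try ring)
  exact H2

set_option linter.unusedSimpArgs false in
-- Type B2 with `s` attached to the short simple root, as `s α_t = α_t + 2 α_s`. The intermediate
-- coefficients depend on this choice, the final ones do not.
lemma DihedralData.isCosetSum_four_short (h : DihedralData f s t σ τ d d' x y)
    (hst : s * (t * (s * t)) = t * (s * (t * s))) (hσy : σ y = x ^ 2 * y) (hτx : τ x = x * y)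
    {a b c k : K} (ha : a * (1 - x) = 1) (hb : b * (1 - y) = 1) (hc : c * (1 - x * y) = 1) (hk : k * (1 - x ^ 2 * y) = 1) :
    IsCosetSum f ![1, t, s * t, t * (s * t)] (of L G s - 1)
      ![-(a * b * c * k), a * b * c * k, -(a * b * c * k), a * b * c * k]
      (dividedDiff t d' * (dividedDiff s d * (dividedDiff t d' * dividedDiff s d))) := by
  have hσa : σ a = -x * a := map_eq_neg_of_mul_one_sub ha h.ne_left h.apply_left
  have hσb : σ b = k := map_eq_of_mul_one_sub hb hk (by simp only [hσy])
  have hσc : σ c = c := map_eq_of_mul_one_sub hc hc (by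
    simp only [map_mul, map_pow, hσy, h.apply_left]
    field_simp [h.ne_left, h.ne_right])
  have hσk : σ k = b := map_eq_of_mul_one_sub hk hb (by
    simp only [map_mul, map_pow, hσy, h.apply_left]
    field_simp [h.ne_left, h.ne_right])
  have hτa : τ a = c := map_eq_of_mul_one_sub ha hc (by simp only [hτx])
  have hτb : τ b = -y * b := map_eq_neg_of_mul_one_sub hb h.ne_right h.apply_right
  have hτc : τ c = a := map_eq_of_mul_one_sub hc ha (by
    simp only [map_mul, map_pow, hτx, h.apply_right]
    field_simp [h.ne_left, h.ne_right])
  have hτk : τ k = k := map_eq_of_mul_one_sub hk hk (by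
    simp only [map_mul, map_pow, hτx, h.apply_right]
    field_simp [h.ne_left, h.ne_right])
  have ha' := right_ne_zero_of_mul_eq_one ha
  have hb' := right_ne_zero_of_mul_eq_one hb
  have hc' := right_ne_zero_of_mul_eq_one hc
  have hk' := right_ne_zero_of_mul_eq_one hk
  have ha'' := eq_inv_of_mul_eq_one_left ha
  have hb'' := eq_inv_of_mul_eq_one_left hb
  have hc'' := eq_inv_of_mul_eq_one_left hc
  have hk'' := eq_inv_of_mul_eq_one_left hk
  have hx := h.ne_left
  have hy := h.ne_right
  have hl : ∀ v, s * (s * v) = v := fun v ↦ by rw [← mul_assoc, h.mul_self_left, one_mul]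
  have hr : ∀ v, t * (t * v) = v := fun v ↦ by rw [← mul_assoc, h.mul_self_right, one_mul]
  have hvs : ∀ j q, single (s * (![1, t, s * t, t * (s * t)] : Fin 4 → G) (![0, 2, 1, 3] j)) q * (of L G s - 1) =
      single ((![1, t, s * t, t * (s * t)] : Fin 4 → G) j) ((![-1, 1, 1, -1] : Fin 4 → ℤ) j • q) * (of L G s - 1) := fun j q ↦ by
    fin_cases j
    · exact single_mul_of_eq_mul_right h.mul_self_left (by simp) q
    · exact single_mul_of_eq_mul (by simp [hl, h.mul_self_right]) q
    · exact single_mul_of_eq_mul (by simp [hl, h.mul_self_right]) q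
    · exact single_mul_of_eq_mul_right h.mul_self_left (by simpa [mul_assoc] using hst) q
  have hvt : ∀ j q, single (t * (![1, t, s * t, t * (s * t)] : Fin 4 → G) (![1, 0, 3, 2] j)) q * (of L G s - 1) =
      single ((![1, t, s * t, t * (s * t)] : Fin 4 → G) j) ((![1, 1, 1, 1] : Fin 4 → ℤ) j • q) * (of L G s - 1) := fun j q ↦ by
    fin_cases j
    · exact single_mul_of_eq_mul (by simp [hr, h.mul_self_right]) q
    · exact single_mul_of_eq_mul (by simp [hr, h.mul_self_right]) q
    · exact single_mul_of_eq_mul (by simp [hr, h.mul_self_right]) q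
    · exact single_mul_of_eq_mul (by simp [hr, h.mul_self_right]) q
  have H0 := isCosetSum_dividedDiff (f := f) ![1, t, s * t, t * (s * t)] rfl s d ![a, 0, 0, 0]
    (h.coeff_left.trans ha''.symm).symm (by simp [Fin.forall_fin_succ])
  have H1 := H0.dividedDiff_mul h.map_right (d := d') (π := ![1, 0, 3, 2])
    (ε := ![1, 1, 1, 1])
    (z' := ![-(a * b), b * c, 0, 0])
    (fun j ↦ by fin_cases j <;> rfl) hvt (fun j ↦ by
      rw [h.coeff_right, ← hb'']
      fin_cases j
      all_goals
        simp only [Fin.zero_eta, Fin.mk_one, Fin.reduceFinMk, Matrix.cons_val, map_mul, map_neg,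
          map_add, map_one, map_pow, map_zero, one_smul, neg_one_smul, h.apply_left, h.apply_right, hτa, hτb, hτc, hτk, hτx]
        simp only [ha'', hb'', hc'', hk'']
        try field_simp
        try ring)
  have H2 := H1.dividedDiff_mul h.map_left (d := d) (π := ![0, 2, 1, 3])
    (ε := ![-1, 1, 1, -1])
    (z' := ![(1 + x * y) * (a * b * k), -(a * b * c), a * c * k, 0])
    (fun j ↦ by fin_cases j <;> rfl) hvs (fun j ↦ by
      rw [h.coeff_left, ← ha'']
      fin_cases j
      all_goals
        simp only [Fin.zero_eta, Fin.mk_one, Fin.reduceFinMk, Matrix.cons_val, map_mul, map_neg,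
          map_add, map_one, map_pow, map_zero, one_smul, neg_one_smul, h.apply_left, h.apply_right, hσa, hσb, hσc, hσk, hσy]
        simp only [ha'', hb'', hc'', hk'']
        try field_simp
        try ring)
  have H3 := H2.dividedDiff_mul h.map_right (d := d') (π := ![1, 0, 3, 2])
    (ε := ![1, 1, 1, 1])
    (z' := ![-(a * b * c * k), a * b * c * k, -(a * b * c * k), a * b * c * k])
    (fun j ↦ by fin_cases j <;> rfl) hvt (fun j ↦ by
      rw [h.coeff_right, ← hb'']
      fin_cases j
      all_goals
        simp only [Fin.zero_eta, Fin.mk_one, Fin.reduceFinMk, Matrix.cons_val, map_mul, map_neg,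
          map_add, map_one, map_pow, map_zero, one_smul, neg_one_smul, h.apply_left, h.apply_right, hτa, hτb, hτc, hτk, hτx]
        simp only [ha'', hb'', hc'', hk'']
        try field_simp
        try ring)
  exact H3

set_option linter.unusedSimpArgs false in
-- Type B2 with `s` attached to the long simple root. Exchanging `s` and `t` turns one case into the
-- other, so the braid relation compares this computation with the previous one.
lemma DihedralData.isCosetSum_four_long (h : DihedralData f s t σ τ d d' x y)
    (hst : s * (t * (s * t)) = t * (s * (t * s))) (hσy : σ y = x * y) (hτx : τ x = x * y ^ 2)
    {a b c k : K} (ha : a * (1 - x) = 1) (hb : b * (1 - y) = 1) (hc : c * (1 - x * y) = 1) (hk : k * (1 - x * y ^ 2) = 1) :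
    IsCosetSum f ![1, t, s * t, t * (s * t)] (of L G s - 1)
      ![-(a * b * c * k), a * b * c * k, -(a * b * c * k), a * b * c * k]
      (dividedDiff t d' * (dividedDiff s d * (dividedDiff t d' * dividedDiff s d))) := by
  have hσa : σ a = -x * a := map_eq_neg_of_mul_one_sub ha h.ne_left h.apply_left
  have hσb : σ b = c := map_eq_of_mul_one_sub hb hc (by simp only [hσy])
  have hσc : σ c = b := map_eq_of_mul_one_sub hc hb (by
    simp only [map_mul, map_pow, hσy, h.apply_left]
    field_simp [h.ne_left, h.ne_right])
  have hσk : σ k = k := map_eq_of_mul_one_sub hk hk (by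
    simp only [map_mul, map_pow, hσy, h.apply_left]
    field_simp [h.ne_left, h.ne_right])
  have hτa : τ a = k := map_eq_of_mul_one_sub ha hk (by simp only [hτx])
  have hτb : τ b = -y * b := map_eq_neg_of_mul_one_sub hb h.ne_right h.apply_right
  have hτc : τ c = c := map_eq_of_mul_one_sub hc hc (by
    simp only [map_mul, map_pow, hτx, h.apply_right]
    field_simp [h.ne_left, h.ne_right])
  have hτk : τ k = a := map_eq_of_mul_one_sub hk ha (by
    simp only [map_mul, map_pow, hτx, h.apply_right]
    field_simp [h.ne_left, h.ne_right])
  have ha' := right_ne_zero_of_mul_eq_one ha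
  have hb' := right_ne_zero_of_mul_eq_one hb
  have hc' := right_ne_zero_of_mul_eq_one hc
  have hk' := right_ne_zero_of_mul_eq_one hk
  have ha'' := eq_inv_of_mul_eq_one_left ha
  have hb'' := eq_inv_of_mul_eq_one_left hb
  have hc'' := eq_inv_of_mul_eq_one_left hc
  have hk'' := eq_inv_of_mul_eq_one_left hk
  have hx := h.ne_left
  have hy := h.ne_right
  have hl : ∀ v, s * (s * v) = v := fun v ↦ by rw [← mul_assoc, h.mul_self_left, one_mul]
  have hr : ∀ v, t * (t * v) = v := fun v ↦ by rw [← mul_assoc, h.mul_self_right, one_mul]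
  have hvs : ∀ j q, single (s * (![1, t, s * t, t * (s * t)] : Fin 4 → G) (![0, 2, 1, 3] j)) q * (of L G s - 1) =
      single ((![1, t, s * t, t * (s * t)] : Fin 4 → G) j) ((![-1, 1, 1, -1] : Fin 4 → ℤ) j • q) * (of L G s - 1) := fun j q ↦ by
    fin_cases j
    · exact single_mul_of_eq_mul_right h.mul_self_left (by simp) q
    · exact single_mul_of_eq_mul (by simp [hl, h.mul_self_right]) q
    · exact single_mul_of_eq_mul (by simp [hl, h.mul_self_right]) q
    · exact single_mul_of_eq_mul_right h.mul_self_left (by simpa [mul_assoc] using hst) q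
  have hvt : ∀ j q, single (t * (![1, t, s * t, t * (s * t)] : Fin 4 → G) (![1, 0, 3, 2] j)) q * (of L G s - 1) =
      single ((![1, t, s * t, t * (s * t)] : Fin 4 → G) j) ((![1, 1, 1, 1] : Fin 4 → ℤ) j • q) * (of L G s - 1) := fun j q ↦ by
    fin_cases j
    · exact single_mul_of_eq_mul (by simp [hr, h.mul_self_right]) q
    · exact single_mul_of_eq_mul (by simp [hr, h.mul_self_right]) q
    · exact single_mul_of_eq_mul (by simp [hr, h.mul_self_right]) q
    · exact single_mul_of_eq_mul (by simp [hr, h.mul_self_right]) q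
  have H0 := isCosetSum_dividedDiff (f := f) ![1, t, s * t, t * (s * t)] rfl s d ![a, 0, 0, 0]
    (h.coeff_left.trans ha''.symm).symm (by simp [Fin.forall_fin_succ])
  have H1 := H0.dividedDiff_mul h.map_right (d := d') (π := ![1, 0, 3, 2])
    (ε := ![1, 1, 1, 1])
    (z' := ![-(a * b), b * k, 0, 0])
    (fun j ↦ by fin_cases j <;> rfl) hvt (fun j ↦ by
      rw [h.coeff_right, ← hb'']
      fin_cases j
      all_goals
        simp only [Fin.zero_eta, Fin.mk_one, Fin.reduceFinMk, Matrix.cons_val, map_mul, map_neg,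
          map_add, map_one, map_pow, map_zero, one_smul, neg_one_smul, h.apply_left, h.apply_right, hτa, hτb, hτc, hτk, hτx]
        simp only [ha'', hb'', hc'', hk'']
        try field_simp
        try ring)
  have H2 := H1.dividedDiff_mul h.map_left (d := d) (π := ![0, 2, 1, 3])
    (ε := ![-1, 1, 1, -1])
    (z' := ![a * b * c, -(a * b * k), a * c * k, 0])
    (fun j ↦ by fin_cases j <;> rfl) hvs (fun j ↦ by
      rw [h.coeff_left, ← ha'']
      fin_cases j
      all_goals
        simp only [Fin.zero_eta, Fin.mk_one, Fin.reduceFinMk, Matrix.cons_val, map_mul, map_neg,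
          map_add, map_one, map_pow, map_zero, one_smul, neg_one_smul, h.apply_left, h.apply_right, hσa, hσb, hσc, hσk, hσy]
        simp only [ha'', hb'', hc'', hk'']
        try field_simp
        try ring)
  have H3 := H2.dividedDiff_mul h.map_right (d := d') (π := ![1, 0, 3, 2])
    (ε := ![1, 1, 1, 1])
    (z' := ![-(a * b * c * k), a * b * c * k, -(a * b * c * k), a * b * c * k])
    (fun j ↦ by fin_cases j <;> rfl) hvt (fun j ↦ by
      rw [h.coeff_right, ← hb'']
      fin_cases j
      all_goals
        simp only [Fin.zero_eta, Fin.mk_one, Fin.reduceFinMk, Matrix.cons_val, map_mul, map_neg,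
          map_add, map_one, map_pow, map_zero, one_smul, neg_one_smul, h.apply_left, h.apply_right, hτa, hτb, hτc, hτk, hτx]
        simp only [ha'', hb'', hc'', hk'']
        try field_simp
        try ring)
  exact H3

set_option linter.unusedSimpArgs false in
-- Type G2 with `s` attached to the short simple root: `a, b, c, k, m, n` are the inverses of `1 -
-- e^β` for the six positive roots `β`.
lemma DihedralData.isCosetSum_six_short (h : DihedralData f s t σ τ d d' x y)
    (hst : s * (t * (s * (t * (s * t)))) = t * (s * (t * (s * (t * s))))) (hσy : σ y = x ^ 3 * y) (hτx : τ x = x * y)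
    {a b c k m n : K} (ha : a * (1 - x) = 1) (hb : b * (1 - y) = 1) (hc : c * (1 - x * y) = 1) (hk : k * (1 - x ^ 2 * y) = 1) (hm : m * (1 - x ^ 3 * y) = 1) (hn : n * (1 - x ^ 3 * y ^ 2) = 1) :
    IsCosetSum f ![1, t, s * t, t * (s * t), s * (t * (s * t)), t * (s * (t * (s * t)))] (of L G s - 1)
      ![-(a * b * c * k * m * n), a * b * c * k * m * n, -(a * b * c * k * m * n), a * b * c * k * m * n, -(a * b * c * k * m * n), a * b * c * k * m * n]
      (dividedDiff t d' * (dividedDiff s d * (dividedDiff t d' * (dividedDiff s d * (dividedDiff t d' * dividedDiff s d))))) := by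
  have hσa : σ a = -x * a := map_eq_neg_of_mul_one_sub ha h.ne_left h.apply_left
  have hσb : σ b = m := map_eq_of_mul_one_sub hb hm (by simp only [hσy])
  have hσc : σ c = k := map_eq_of_mul_one_sub hc hk (by
    simp only [map_mul, map_pow, hσy, h.apply_left]
    field_simp [h.ne_left, h.ne_right])
  have hσk : σ k = c := map_eq_of_mul_one_sub hk hc (by
    simp only [map_mul, map_pow, hσy, h.apply_left]
    field_simp [h.ne_left, h.ne_right])
  have hσm : σ m = b := map_eq_of_mul_one_sub hm hb (by
    simp only [map_mul, map_pow, hσy, h.apply_left]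
    field_simp [h.ne_left, h.ne_right])
  have hσn : σ n = n := map_eq_of_mul_one_sub hn hn (by
    simp only [map_mul, map_pow, hσy, h.apply_left]
    field_simp [h.ne_left, h.ne_right])
  have hτa : τ a = c := map_eq_of_mul_one_sub ha hc (by simp only [hτx])
  have hτb : τ b = -y * b := map_eq_neg_of_mul_one_sub hb h.ne_right h.apply_right
  have hτc : τ c = a := map_eq_of_mul_one_sub hc ha (by
    simp only [map_mul, map_pow, hτx, h.apply_right]
    field_simp [h.ne_left, h.ne_right])
  have hτk : τ k = k := map_eq_of_mul_one_sub hk hk (by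
    simp only [map_mul, map_pow, hτx, h.apply_right]
    field_simp [h.ne_left, h.ne_right])
  have hτm : τ m = n := map_eq_of_mul_one_sub hm hn (by
    simp only [map_mul, map_pow, hτx, h.apply_right]
    field_simp [h.ne_left, h.ne_right])
  have hτn : τ n = m := map_eq_of_mul_one_sub hn hm (by
    simp only [map_mul, map_pow, hτx, h.apply_right]
    field_simp [h.ne_left, h.ne_right])
  have ha' := right_ne_zero_of_mul_eq_one ha
  have hb' := right_ne_zero_of_mul_eq_one hb
  have hc' := right_ne_zero_of_mul_eq_one hc
  have hk' := right_ne_zero_of_mul_eq_one hk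
  have hm' := right_ne_zero_of_mul_eq_one hm
  have hn' := right_ne_zero_of_mul_eq_one hn
  have ha'' := eq_inv_of_mul_eq_one_left ha
  have hb'' := eq_inv_of_mul_eq_one_left hb
  have hc'' := eq_inv_of_mul_eq_one_left hc
  have hk'' := eq_inv_of_mul_eq_one_left hk
  have hm'' := eq_inv_of_mul_eq_one_left hm
  have hn'' := eq_inv_of_mul_eq_one_left hn
  have hx := h.ne_left
  have hy := h.ne_right
  have hl : ∀ v, s * (s * v) = v := fun v ↦ by rw [← mul_assoc, h.mul_self_left, one_mul]
  have hr : ∀ v, t * (t * v) = v := fun v ↦ by rw [← mul_assoc, h.mul_self_right, one_mul]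
  have hvs : ∀ j q, single (s * (![1, t, s * t, t * (s * t), s * (t * (s * t)), t * (s * (t * (s * t)))] : Fin 6 → G) (![0, 2, 1, 4, 3, 5] j)) q * (of L G s - 1) =
      single ((![1, t, s * t, t * (s * t), s * (t * (s * t)), t * (s * (t * (s * t)))] : Fin 6 → G) j) ((![-1, 1, 1, 1, 1, -1] : Fin 6 → ℤ) j • q) * (of L G s - 1) := fun j q ↦ by
    fin_cases j
    · exact single_mul_of_eq_mul_right h.mul_self_left (by simp) q
    · exact single_mul_of_eq_mul (by simp [hl, h.mul_self_right]) q
    · exact single_mul_of_eq_mul (by simp [hl, h.mul_self_right]) q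
    · exact single_mul_of_eq_mul (by simp [hl, h.mul_self_right]) q
    · exact single_mul_of_eq_mul (by simp [hl, h.mul_self_right]) q
    · exact single_mul_of_eq_mul_right h.mul_self_left (by simpa [mul_assoc] using hst) q
  have hvt : ∀ j q, single (t * (![1, t, s * t, t * (s * t), s * (t * (s * t)), t * (s * (t * (s * t)))] : Fin 6 → G) (![1, 0, 3, 2, 5, 4] j)) q * (of L G s - 1) =
      single ((![1, t, s * t, t * (s * t), s * (t * (s * t)), t * (s * (t * (s * t)))] : Fin 6 → G) j) ((![1, 1, 1, 1, 1, 1] : Fin 6 → ℤ) j • q) * (of L G s - 1) := fun j q ↦ by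
    fin_cases j
    · exact single_mul_of_eq_mul (by simp [hr, h.mul_self_right]) q
    · exact single_mul_of_eq_mul (by simp [hr, h.mul_self_right]) q
    · exact single_mul_of_eq_mul (by simp [hr, h.mul_self_right]) q
    · exact single_mul_of_eq_mul (by simp [hr, h.mul_self_right]) q
    · exact single_mul_of_eq_mul (by simp [hr, h.mul_self_right]) q
    · exact single_mul_of_eq_mul (by simp [hr, h.mul_self_right]) q
  have H0 := isCosetSum_dividedDiff (f := f) ![1, t, s * t, t * (s * t), s * (t * (s * t)), t * (s * (t * (s * t)))] rfl s d ![a, 0, 0, 0, 0, 0]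
    (h.coeff_left.trans ha''.symm).symm (by simp [Fin.forall_fin_succ])
  have H1 := H0.dividedDiff_mul h.map_right (d := d') (π := ![1, 0, 3, 2, 5, 4])
    (ε := ![1, 1, 1, 1, 1, 1])
    (z' := ![-(a * b), b * c, 0, 0, 0, 0])
    (fun j ↦ by fin_cases j <;> rfl) hvt (fun j ↦ by
      rw [h.coeff_right, ← hb'']
      fin_cases j
      all_goals
        simp only [Fin.zero_eta, Fin.mk_one, Fin.reduceFinMk, Matrix.cons_val, map_mul, map_neg,
          map_add, map_one, map_pow, map_zero, one_smul, neg_one_smul, h.apply_left, h.apply_right, hτa, hτb, hτc, hτk, hτm, hτn, hτx]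
        simp only [ha'', hb'', hc'', hk'', hm'', hn'']
        try field_simp
        try ring)
  have H2 := H1.dividedDiff_mul h.map_left (d := d) (π := ![0, 2, 1, 4, 3, 5])
    (ε := ![-1, 1, 1, 1, 1, -1])
    (z' := ![(1 + x * y + x ^ 2 * y) * (a * b * m), -(a * b * c), a * k * m, 0, 0, 0])
    (fun j ↦ by fin_cases j <;> rfl) hvs (fun j ↦ by
      rw [h.coeff_left, ← ha'']
      fin_cases j
      all_goals
        simp only [Fin.zero_eta, Fin.mk_one, Fin.reduceFinMk, Matrix.cons_val, map_mul, map_neg,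
          map_add, map_one, map_pow, map_zero, one_smul, neg_one_smul, h.apply_left, h.apply_right, hσa, hσb, hσc, hσk, hσm, hσn, hσy]
        simp only [ha'', hb'', hc'', hk'', hm'', hn'']
        try field_simp
        try ring)
  have H3 := H2.dividedDiff_mul h.map_right (d := d') (π := ![1, 0, 3, 2, 5, 4])
    (ε := ![1, 1, 1, 1, 1, 1])
    (z' := ![(-(1) + -(x ^ 2 * y)) * (a * b * c * m), (1 + x ^ 2 * y) * (a * b * c * n), -(a * b * k * m), b * c * k * n, 0, 0])
    (fun j ↦ by fin_cases j <;> rfl) hvt (fun j ↦ by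
      rw [h.coeff_right, ← hb'']
      fin_cases j
      all_goals
        simp only [Fin.zero_eta, Fin.mk_one, Fin.reduceFinMk, Matrix.cons_val, map_mul, map_neg,
          map_add, map_one, map_pow, map_zero, one_smul, neg_one_smul, h.apply_left, h.apply_right, hτa, hτb, hτc, hτk, hτm, hτn, hτx]
        simp only [ha'', hb'', hc'', hk'', hm'', hn'']
        try field_simp
        try ring)
  have H4 := H3.dividedDiff_mul h.map_left (d := d) (π := ![0, 2, 1, 4, 3, 5])
    (ε := ![-1, 1, 1, 1, 1, -1])
    (z' := ![(1 + x ^ 3 * y ^ 2) * (a * b * c * k * m), (-(1) + -(x ^ 2 * y) + -(x ^ 4 * y ^ 2)) * (a * b * c * m * n), (1 + x * y + x ^ 2 * y ^ 2) * (a * b * k * m * n), -(a * b * c * k * n), a * c * k * m * n, 0])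
    (fun j ↦ by fin_cases j <;> rfl) hvs (fun j ↦ by
      rw [h.coeff_left, ← ha'']
      fin_cases j
      all_goals
        simp only [Fin.zero_eta, Fin.mk_one, Fin.reduceFinMk, Matrix.cons_val, map_mul, map_neg,
          map_add, map_one, map_pow, map_zero, one_smul, neg_one_smul, h.apply_left, h.apply_right, hσa, hσb, hσc, hσk, hσm, hσn, hσy]
        simp only [ha'', hb'', hc'', hk'', hm'', hn'']
        try field_simp
        try ring)
  have H5 := H4.dividedDiff_mul h.map_right (d := d') (π := ![1, 0, 3, 2, 5, 4])
    (ε := ![1, 1, 1, 1, 1, 1])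
    (z' := ![-(a * b * c * k * m * n), a * b * c * k * m * n, -(a * b * c * k * m * n), a * b * c * k * m * n, -(a * b * c * k * m * n), a * b * c * k * m * n])
    (fun j ↦ by fin_cases j <;> rfl) hvt (fun j ↦ by
      rw [h.coeff_right, ← hb'']
      fin_cases j
      all_goals
        simp only [Fin.zero_eta, Fin.mk_one, Fin.reduceFinMk, Matrix.cons_val, map_mul, map_neg,
          map_add, map_one, map_pow, map_zero, one_smul, neg_one_smul, h.apply_left, h.apply_right, hτa, hτb, hτc, hτk, hτm, hτn, hτx]
        simp only [ha'', hb'', hc'', hk'', hm'', hn'']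
        try field_simp
        try ring)
  exact H5

set_option linter.unusedSimpArgs false in
-- Type G2 with `s` attached to the long simple root; the final coefficients again have the
-- symmetric form.
lemma DihedralData.isCosetSum_six_long (h : DihedralData f s t σ τ d d' x y)
    (hst : s * (t * (s * (t * (s * t)))) = t * (s * (t * (s * (t * s))))) (hσy : σ y = x * y) (hτx : τ x = x * y ^ 3)
    {a b c k m n : K} (ha : a * (1 - x) = 1) (hb : b * (1 - y) = 1) (hc : c * (1 - x * y) = 1) (hk : k * (1 - x * y ^ 2) = 1) (hm : m * (1 - x * y ^ 3) = 1) (hn : n * (1 - x ^ 2 * y ^ 3) = 1) :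
    IsCosetSum f ![1, t, s * t, t * (s * t), s * (t * (s * t)), t * (s * (t * (s * t)))] (of L G s - 1)
      ![-(a * b * c * k * m * n), a * b * c * k * m * n, -(a * b * c * k * m * n), a * b * c * k * m * n, -(a * b * c * k * m * n), a * b * c * k * m * n]
      (dividedDiff t d' * (dividedDiff s d * (dividedDiff t d' * (dividedDiff s d * (dividedDiff t d' * dividedDiff s d))))) := by
  have hσa : σ a = -x * a := map_eq_neg_of_mul_one_sub ha h.ne_left h.apply_left
  have hσb : σ b = c := map_eq_of_mul_one_sub hb hc (by simp only [hσy])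
  have hσc : σ c = b := map_eq_of_mul_one_sub hc hb (by
    simp only [map_mul, map_pow, hσy, h.apply_left]
    field_simp [h.ne_left, h.ne_right])
  have hσk : σ k = k := map_eq_of_mul_one_sub hk hk (by
    simp only [map_mul, map_pow, hσy, h.apply_left]
    field_simp [h.ne_left, h.ne_right])
  have hσm : σ m = n := map_eq_of_mul_one_sub hm hn (by
    simp only [map_mul, map_pow, hσy, h.apply_left]
    field_simp [h.ne_left, h.ne_right])
  have hσn : σ n = m := map_eq_of_mul_one_sub hn hm (by
    simp only [map_mul, map_pow, hσy, h.apply_left]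
    field_simp [h.ne_left, h.ne_right])
  have hτa : τ a = m := map_eq_of_mul_one_sub ha hm (by simp only [hτx])
  have hτb : τ b = -y * b := map_eq_neg_of_mul_one_sub hb h.ne_right h.apply_right
  have hτc : τ c = k := map_eq_of_mul_one_sub hc hk (by
    simp only [map_mul, map_pow, hτx, h.apply_right]
    field_simp [h.ne_left, h.ne_right])
  have hτk : τ k = c := map_eq_of_mul_one_sub hk hc (by
    simp only [map_mul, map_pow, hτx, h.apply_right]
    field_simp [h.ne_left, h.ne_right])
  have hτm : τ m = a := map_eq_of_mul_one_sub hm ha (by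
    simp only [map_mul, map_pow, hτx, h.apply_right]
    field_simp [h.ne_left, h.ne_right])
  have hτn : τ n = n := map_eq_of_mul_one_sub hn hn (by
    simp only [map_mul, map_pow, hτx, h.apply_right]
    field_simp [h.ne_left, h.ne_right])
  have ha' := right_ne_zero_of_mul_eq_one ha
  have hb' := right_ne_zero_of_mul_eq_one hb
  have hc' := right_ne_zero_of_mul_eq_one hc
  have hk' := right_ne_zero_of_mul_eq_one hk
  have hm' := right_ne_zero_of_mul_eq_one hm
  have hn' := right_ne_zero_of_mul_eq_one hn
  have ha'' := eq_inv_of_mul_eq_one_left ha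
  have hb'' := eq_inv_of_mul_eq_one_left hb
  have hc'' := eq_inv_of_mul_eq_one_left hc
  have hk'' := eq_inv_of_mul_eq_one_left hk
  have hm'' := eq_inv_of_mul_eq_one_left hm
  have hn'' := eq_inv_of_mul_eq_one_left hn
  have hx := h.ne_left
  have hy := h.ne_right
  have hl : ∀ v, s * (s * v) = v := fun v ↦ by rw [← mul_assoc, h.mul_self_left, one_mul]
  have hr : ∀ v, t * (t * v) = v := fun v ↦ by rw [← mul_assoc, h.mul_self_right, one_mul]
  have hvs : ∀ j q, single (s * (![1, t, s * t, t * (s * t), s * (t * (s * t)), t * (s * (t * (s * t)))] : Fin 6 → G) (![0, 2, 1, 4, 3, 5] j)) q * (of L G s - 1) =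
      single ((![1, t, s * t, t * (s * t), s * (t * (s * t)), t * (s * (t * (s * t)))] : Fin 6 → G) j) ((![-1, 1, 1, 1, 1, -1] : Fin 6 → ℤ) j • q) * (of L G s - 1) := fun j q ↦ by
    fin_cases j
    · exact single_mul_of_eq_mul_right h.mul_self_left (by simp) q
    · exact single_mul_of_eq_mul (by simp [hl, h.mul_self_right]) q
    · exact single_mul_of_eq_mul (by simp [hl, h.mul_self_right]) q
    · exact single_mul_of_eq_mul (by simp [hl, h.mul_self_right]) q
    · exact single_mul_of_eq_mul (by simp [hl, h.mul_self_right]) q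
    · exact single_mul_of_eq_mul_right h.mul_self_left (by simpa [mul_assoc] using hst) q
  have hvt : ∀ j q, single (t * (![1, t, s * t, t * (s * t), s * (t * (s * t)), t * (s * (t * (s * t)))] : Fin 6 → G) (![1, 0, 3, 2, 5, 4] j)) q * (of L G s - 1) =
      single ((![1, t, s * t, t * (s * t), s * (t * (s * t)), t * (s * (t * (s * t)))] : Fin 6 → G) j) ((![1, 1, 1, 1, 1, 1] : Fin 6 → ℤ) j • q) * (of L G s - 1) := fun j q ↦ by
    fin_cases j
    · exact single_mul_of_eq_mul (by simp [hr, h.mul_self_right]) q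
    · exact single_mul_of_eq_mul (by simp [hr, h.mul_self_right]) q
    · exact single_mul_of_eq_mul (by simp [hr, h.mul_self_right]) q
    · exact single_mul_of_eq_mul (by simp [hr, h.mul_self_right]) q
    · exact single_mul_of_eq_mul (by simp [hr, h.mul_self_right]) q
    · exact single_mul_of_eq_mul (by simp [hr, h.mul_self_right]) q
  have H0 := isCosetSum_dividedDiff (f := f) ![1, t, s * t, t * (s * t), s * (t * (s * t)), t * (s * (t * (s * t)))] rfl s d ![a, 0, 0, 0, 0, 0]
    (h.coeff_left.trans ha''.symm).symm (by simp [Fin.forall_fin_succ])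
  have H1 := H0.dividedDiff_mul h.map_right (d := d') (π := ![1, 0, 3, 2, 5, 4])
    (ε := ![1, 1, 1, 1, 1, 1])
    (z' := ![-(a * b), b * m, 0, 0, 0, 0])
    (fun j ↦ by fin_cases j <;> rfl) hvt (fun j ↦ by
      rw [h.coeff_right, ← hb'']
      fin_cases j
      all_goals
        simp only [Fin.zero_eta, Fin.mk_one, Fin.reduceFinMk, Matrix.cons_val, map_mul, map_neg,
          map_add, map_one, map_pow, map_zero, one_smul, neg_one_smul, h.apply_left, h.apply_right, hτa, hτb, hτc, hτk, hτm, hτn, hτx]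
        simp only [ha'', hb'', hc'', hk'', hm'', hn'']
        try field_simp
        try ring)
  have H2 := H1.dividedDiff_mul h.map_left (d := d) (π := ![0, 2, 1, 4, 3, 5])
    (ε := ![-1, 1, 1, 1, 1, -1])
    (z' := ![a * b * c, -(a * b * m), a * c * n, 0, 0, 0])
    (fun j ↦ by fin_cases j <;> rfl) hvs (fun j ↦ by
      rw [h.coeff_left, ← ha'']
      fin_cases j
      all_goals
        simp only [Fin.zero_eta, Fin.mk_one, Fin.reduceFinMk, Matrix.cons_val, map_mul, map_neg,
          map_add, map_one, map_pow, map_zero, one_smul, neg_one_smul, h.apply_left, h.apply_right, hσa, hσb, hσc, hσk, hσm, hσn, hσy]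
        simp only [ha'', hb'', hc'', hk'', hm'', hn'']
        try field_simp
        try ring)
  have H3 := H2.dividedDiff_mul h.map_right (d := d') (π := ![1, 0, 3, 2, 5, 4])
    (ε := ![1, 1, 1, 1, 1, 1])
    (z' := ![(-(1) + -(x * y ^ 2)) * (a * b * c * m), (1 + x * y) * (a * b * k * m), -(a * b * c * n), b * k * m * n, 0, 0])
    (fun j ↦ by fin_cases j <;> rfl) hvt (fun j ↦ by
      rw [h.coeff_right, ← hb'']
      fin_cases j
      all_goals
        simp only [Fin.zero_eta, Fin.mk_one, Fin.reduceFinMk, Matrix.cons_val, map_mul, map_neg,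
          map_add, map_one, map_pow, map_zero, one_smul, neg_one_smul, h.apply_left, h.apply_right, hτa, hτb, hτc, hτk, hτm, hτn, hτx]
        simp only [ha'', hb'', hc'', hk'', hm'', hn'']
        try field_simp
        try ring)
  have H4 := H3.dividedDiff_mul h.map_left (d := d) (π := ![0, 2, 1, 4, 3, 5])
    (ε := ![-1, 1, 1, 1, 1, -1])
    (z' := ![(1 + x * y ^ 2) * (a * b * c * m * n), -(a * b * c * k * m), a * b * c * k * n, -(a * b * k * m * n), a * c * k * m * n, 0])
    (fun j ↦ by fin_cases j <;> rfl) hvs (fun j ↦ by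
      rw [h.coeff_left, ← ha'']
      fin_cases j
      all_goals
        simp only [Fin.zero_eta, Fin.mk_one, Fin.reduceFinMk, Matrix.cons_val, map_mul, map_neg,
          map_add, map_one, map_pow, map_zero, one_smul, neg_one_smul, h.apply_left, h.apply_right, hσa, hσb, hσc, hσk, hσm, hσn, hσy]
        simp only [ha'', hb'', hc'', hk'', hm'', hn'']
        try field_simp
        try ring)
  have H5 := H4.dividedDiff_mul h.map_right (d := d') (π := ![1, 0, 3, 2, 5, 4])
    (ε := ![1, 1, 1, 1, 1, 1])
    (z' := ![-(a * b * c * k * m * n), a * b * c * k * m * n, -(a * b * c * k * m * n), a * b * c * k * m * n, -(a * b * c * k * m * n), a * b * c * k * m * n])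
    (fun j ↦ by fin_cases j <;> rfl) hvt (fun j ↦ by
      rw [h.coeff_right, ← hb'']
      fin_cases j
      all_goals
        simp only [Fin.zero_eta, Fin.mk_one, Fin.reduceFinMk, Matrix.cons_val, map_mul, map_neg,
          map_add, map_one, map_pow, map_zero, one_smul, neg_one_smul, h.apply_left, h.apply_right, hτa, hτb, hτc, hτk, hτm, hτn, hτx]
        simp only [ha'', hb'', hc'', hk'', hm'', hn'']
        try field_simp
        try ring)
  exact H5

/-! ### The braid relations of types A2, B2 and G2 -/

/-- Expanded in group elements, each side is the same coefficient times the alternating sum over the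
dihedral group, and that sum is symmetric in `s` and `t`. -/
lemma DihedralData.dividedDiff_braid_three (h : DihedralData f s t σ τ d d' x y)
    (hst : t * (s * t) = s * (t * s)) (hσy : σ y = x * y) (hτx : τ x = x * y)
    {a b c : K} (ha : a * (1 - x) = 1) (hb : b * (1 - y) = 1) (hc : c * (1 - x * y) = 1) :
    dividedDiff s d * (dividedDiff t d' * dividedDiff s d) =
      dividedDiff t d' * (dividedDiff s d * dividedDiff t d') := by
  have hA := h.isCosetSum_three hst hσy hτx ha hb hc
  have hB := h.symm.isCosetSum_three hst.symm (hτx.trans (mul_comm _ _)) (hσy.trans (mul_comm _ _))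
    hb ha (mul_comm x y ▸ hc)
  -- The common coefficient is known as an element of `K`; its preimage in `L` is the coefficient at
  -- the last representative.
  obtain ⟨q, hq, -⟩ := id hA
  have hk' : f (q 2) = a * b * c := hq 2
  rw [hA.eq_sum h.inj (q := ![q 2, -q 2, q 2]) (fun j ↦ by
      fin_cases j
      all_goals simp only [Fin.zero_eta, Fin.mk_one, Fin.reduceFinMk, Matrix.cons_val, map_neg, hk']), hB.eq_sum h.inj (q := ![q 2, -q 2, q 2]) (fun j ↦ by
      fin_cases j
      all_goals
        simp only [Fin.zero_eta, Fin.mk_one, Fin.reduceFinMk, Matrix.cons_val, map_neg, hk']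
        ring)]
  simp only [Fin.sum_univ_succ, single_mul_of_sub_one, single_neg, Finset.univ_eq_empty, Finset.sum_empty,
    Matrix.cons_val_zero, Matrix.cons_val_succ, one_mul, mul_assoc, hst]
  abel

lemma DihedralData.dividedDiff_braid_four (h : DihedralData f s t σ τ d d' x y)
    (hst : s * (t * (s * t)) = t * (s * (t * s))) (hσy : σ y = x ^ 2 * y) (hτx : τ x = x * y)
    {a b c k : K} (ha : a * (1 - x) = 1) (hb : b * (1 - y) = 1) (hc : c * (1 - x * y) = 1) (hk : k * (1 - x ^ 2 * y) = 1) :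
    dividedDiff t d' * (dividedDiff s d * (dividedDiff t d' * dividedDiff s d)) =
      dividedDiff s d * (dividedDiff t d' * (dividedDiff s d * dividedDiff t d')) := by
  have hA := h.isCosetSum_four_short hst hσy hτx ha hb hc hk
  have hB := h.symm.isCosetSum_four_long hst.symm (hτx.trans (mul_comm _ _)) (hσy.trans (mul_comm _ _))
    hb ha (mul_comm x y ▸ hc) (mul_comm (x ^ 2) y ▸ hk)
  obtain ⟨q, hq, -⟩ := id hA
  have hk' : f (q 3) = a * b * c * k := hq 3
  rw [hA.eq_sum h.inj (q := ![-q 3, q 3, -q 3, q 3]) (fun j ↦ by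
      fin_cases j
      all_goals simp only [Fin.zero_eta, Fin.mk_one, Fin.reduceFinMk, Matrix.cons_val, map_neg, hk']), hB.eq_sum h.inj (q := ![-q 3, q 3, -q 3, q 3]) (fun j ↦ by
      fin_cases j
      all_goals
        simp only [Fin.zero_eta, Fin.mk_one, Fin.reduceFinMk, Matrix.cons_val, map_neg, hk']
        ring)]
  simp only [Fin.sum_univ_succ, single_mul_of_sub_one, single_neg, Finset.univ_eq_empty, Finset.sum_empty,
    Matrix.cons_val_zero, Matrix.cons_val_succ, one_mul, mul_assoc, hst]
  abel

lemma DihedralData.dividedDiff_braid_six (h : DihedralData f s t σ τ d d' x y)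
    (hst : s * (t * (s * (t * (s * t)))) = t * (s * (t * (s * (t * s))))) (hσy : σ y = x ^ 3 * y) (hτx : τ x = x * y)
    {a b c k m n : K} (ha : a * (1 - x) = 1) (hb : b * (1 - y) = 1) (hc : c * (1 - x * y) = 1) (hk : k * (1 - x ^ 2 * y) = 1) (hm : m * (1 - x ^ 3 * y) = 1) (hn : n * (1 - x ^ 3 * y ^ 2) = 1) :
    dividedDiff t d' * (dividedDiff s d * (dividedDiff t d' * (dividedDiff s d * (dividedDiff t d' * dividedDiff s d)))) =
      dividedDiff s d * (dividedDiff t d' * (dividedDiff s d * (dividedDiff t d' * (dividedDiff s d * dividedDiff t d')))) := by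
  have hA := h.isCosetSum_six_short hst hσy hτx ha hb hc hk hm hn
  have hB := h.symm.isCosetSum_six_long hst.symm (hτx.trans (mul_comm _ _)) (hσy.trans (mul_comm _ _))
    hb ha (mul_comm x y ▸ hc) (mul_comm (x ^ 2) y ▸ hk) (mul_comm (x ^ 3) y ▸ hm)
    (mul_comm (x ^ 3) (y ^ 2) ▸ hn)
  obtain ⟨q, hq, -⟩ := id hA
  have hk' : f (q 5) = a * b * c * k * m * n := hq 5
  rw [hA.eq_sum h.inj (q := ![-q 5, q 5, -q 5, q 5, -q 5, q 5]) (fun j ↦ by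
      fin_cases j
      all_goals simp only [Fin.zero_eta, Fin.mk_one, Fin.reduceFinMk, Matrix.cons_val, map_neg, hk']), hB.eq_sum h.inj (q := ![-q 5, q 5, -q 5, q 5, -q 5, q 5]) (fun j ↦ by
      fin_cases j
      all_goals
        simp only [Fin.zero_eta, Fin.mk_one, Fin.reduceFinMk, Matrix.cons_val, map_neg, hk']
        ring)]
  simp only [Fin.sum_univ_succ, single_mul_of_sub_one, single_neg, Finset.univ_eq_empty, Finset.sum_empty,
    Matrix.cons_val_zero, Matrix.cons_val_succ, one_mul, mul_assoc, hst]
  abel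

end DividedDifference

end AffNilHecke

end

noncomputable section

namespace AffNilHecke

variable {ι X Y : Type*} [AddCommGroup X] [AddCommGroup Y] {P : RootPairing ι ℤ X Y}
variable {b : P.Base}

open SkewMonoidAlgebra

/-! ### The localized representation ring -/

section LocRep

/-- The perfect pairing makes the character lattice torsion free. As the group ring is then a
domain, it embeds in the localization, and the rank two computations can be done in a fraction
field. -/
lemma isDomain_repRing [Module.Finite ℤ X] (P : RootPairing ι ℤ X Y) : IsDomain (RepRing X) := by
  have := Module.isTorsionFree_int_iff_isAddTorsionFree.mp (isTorsionFree_of_rootPairing P)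
  have : AddMonoid.FG X := AddGroup.fg_iff_addMonoid_fg.mp (Module.Finite.iff_addGroup_fg.mp ‹_›)
  infer_instance

lemma c_ne_zero {x : X} (hx : x ≠ 0) : c x ≠ 0 := by
  rw [c, AddMonoidAlgebra.one_def, sub_ne_zero]
  intro h
  exact hx (AddMonoidAlgebra.single_left_injective one_ne_zero h).symm

variable [Module.Finite ℤ X]

lemma rootMonoid_le (P : RootPairing ι ℤ X Y) :
    rootMonoid P ≤ nonZeroDivisors (RepRing X) := by
  have := isDomain_repRing P
  rw [rootMonoid, Submonoid.closure_le]
  rintro _ ⟨i, rfl⟩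
  exact mem_nonZeroDivisors_of_ne_zero (c_ne_zero (P.ne_zero i))

instance : IsDomain (LocRep P) :=
  have := isDomain_repRing P
  IsLocalization.isDomain_localization (rootMonoid_le P)

lemma algebraMap_locRep_injective : Function.Injective (algebraMap (RepRing X) (LocRep P)) :=
  IsLocalization.injective _ (rootMonoid_le P)

end LocRep

variable (P) in
/-- The exponential `e^x` in the localized representation ring. -/
def expo (x : X) : LocRep P := algebraMap (RepRing X) (LocRep P) (AddMonoidAlgebra.single x 1)

lemma expo_zero : expo P 0 = 1 := by
  rw [expo, ← AddMonoidAlgebra.one_def, map_one]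

lemma expo_add (x y : X) : expo P (x + y) = expo P x * expo P y := by
  rw [expo, expo, expo, ← map_mul, AddMonoidAlgebra.single_mul_single, one_mul]

lemma expo_neg_mul (x : X) : expo P (-x) * expo P x = 1 := by
  rw [← expo_add, neg_add_cancel, expo_zero]

lemma algebraMap_c (x : X) : algebraMap (RepRing X) (LocRep P) (c x) = 1 - expo P x := by
  rw [c, map_sub, map_one, expo]

lemma smul_algebraMap (w : ExtAffWeyl P) (r : RepRing X) :
    w • algebraMap (RepRing X) (LocRep P) r = algebraMap _ _ (repAct P (cl P w) r) :=
  locMap_algebraMap _ _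

lemma smul_expo (w : ExtAffWeyl P) (x : X) : w • expo P x = expo P (cl P w • x) := by
  rw [expo, smul_algebraMap, expo]
  congr 1
  simp [repAct]

lemma cInv_mul (i : ι) : cInv P i * (1 - expo P (P.root i)) = 1 := by
  rw [← algebraMap_c, cInv, ← Localization.mk_one_eq_algebraMap, Localization.mk_mul, one_mul, mul_one]
  exact Localization.mk_self (⟨c (P.root i), Submonoid.subset_closure ⟨i, rfl⟩⟩ : rootMonoid P)

lemma eq_cInv {i : ι} {d : LocRep P} (h : d * (1 - expo P (P.root i)) = 1) : d = cInv P i := by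
  have := cInv_mul (P := P) i
  linear_combination cInv P i * h - d * this

lemma smul_cInv (w : ExtAffWeyl P) (i : ι) :
    w • cInv P i = cInv P (P.weylGroupToPerm (cl P w) i) := by
  apply eq_cInv
  rw [← P.weylGroup_apply_root, ← smul_expo]
  have := congrArg (w • ·) (cInv_mul (P := P) i)
  simpa [smul_mul', smul_sub] using this

lemma TNode_eq_dividedDiff (a : AffNode b) :
    TNode b a = dividedDiff (simpleRefl b a) (cInv P (levelZeroIdx b a)) := rfl

lemma cl_simpleRefl_smul_root [Finite ι] [P.IsReduced] (a a' : AffNode b) :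
    cl P (simpleRefl b a) • P.root (levelZeroIdx b a') = P.root (levelZeroIdx b a') -
      P.pairing (levelZeroIdx b a') (levelZeroIdx b a) • P.root (levelZeroIdx b a) := by
  rw [simpleRefl_eq, cl_affRefl, ofIdx_smul_eq, reflection_eq]
  rfl

lemma algebraMap_cInv_mul (i : ι) : algebraMap (LocRep P) (FractionRing (LocRep P)) (cInv P i) *
    (1 - algebraMap _ _ (expo P (P.root i))) = 1 := by
  rw [← map_one (algebraMap (LocRep P) (FractionRing (LocRep P))), ← map_sub, ← map_mul, cInv_mul]

section Braid

variable [Finite ι] [P.IsReduced] [Module.Finite ℤ X]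

/-- The level zero action extends to the fraction field, where the two reflections act on the
exponentials of the simple roots through the Cartan integers. -/
lemma exists_dihedralData (a a' : AffNode b) : ∃ σ τ,
    DihedralData (algebraMap (LocRep P) (FractionRing (LocRep P))) (simpleRefl b a)
      (simpleRefl b a') σ τ (cInv P (levelZeroIdx b a)) (cInv P (levelZeroIdx b a'))
      (algebraMap _ _ (expo P (P.root (levelZeroIdx b a))))
      (algebraMap _ _ (expo P (P.root (levelZeroIdx b a')))) ∧
    σ (algebraMap _ _ (expo P (P.root (levelZeroIdx b a')))) = algebraMap _ _
      (expo P (P.root (levelZeroIdx b a') -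
        P.pairing (levelZeroIdx b a') (levelZeroIdx b a) • P.root (levelZeroIdx b a))) ∧
    τ (algebraMap _ _ (expo P (P.root (levelZeroIdx b a)))) = algebraMap _ _
      (expo P (P.root (levelZeroIdx b a) -
        P.pairing (levelZeroIdx b a) (levelZeroIdx b a') • P.root (levelZeroIdx b a'))) := by
  have hσ : ∀ (w : ExtAffWeyl P) (p : LocRep P),
      (IsFractionRing.ringEquivOfRingEquiv (K := FractionRing (LocRep P))
        (L := FractionRing (LocRep P)) (MulSemiringAction.toRingEquiv _ (LocRep P) w))
        (algebraMap _ _ p) = algebraMap _ _ (w • p) := fun w p ↦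
    IsFractionRing.ringEquivOfRingEquiv_algebraMap _ _
  have hne : ∀ x, algebraMap (LocRep P) (FractionRing (LocRep P)) (expo P x) ≠ 0 := fun x h ↦ by
    have := congrArg (algebraMap (LocRep P) (FractionRing (LocRep P))) (expo_neg_mul (P := P) x)
    rw [map_mul, h, mul_zero, map_one] at this
    exact zero_ne_one this
  have hd : ∀ i, algebraMap (LocRep P) (FractionRing (LocRep P)) (cInv P i) =
      (1 - algebraMap _ _ (expo P (P.root i)))⁻¹ := fun i ↦ by
    apply eq_inv_of_mul_eq_one_left
    rw [← map_one (algebraMap (LocRep P) (FractionRing (LocRep P))), ← map_sub, ← map_mul, cInv_mul]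
  have hi : ∀ a : AffNode b, simpleRefl b a • expo P (P.root (levelZeroIdx b a)) =
      expo P (-P.root (levelZeroIdx b a)) := fun a ↦ by
    rw [smul_expo, cl_simpleRefl_smul_root, P.pairing_same]
    congr 1
    module
  have hinv : ∀ x, algebraMap (LocRep P) (FractionRing (LocRep P)) (expo P (-x)) =
      (algebraMap _ _ (expo P x))⁻¹ := fun x ↦ by
    apply eq_inv_of_mul_eq_one_left
    rw [← map_mul, expo_neg_mul, map_one]
  refine ⟨(IsFractionRing.ringEquivOfRingEquiv (MulSemiringAction.toRingEquiv _ (LocRep P)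
    (simpleRefl b a))).toRingHom, (IsFractionRing.ringEquivOfRingEquiv
      (MulSemiringAction.toRingEquiv _ (LocRep P) (simpleRefl b a'))).toRingHom,
      ⟨IsFractionRing.injective _ _, simpleRefl_mul_self a, simpleRefl_mul_self a', hσ _, hσ _,
        hd _, hd _, hne _, hne _, ?_, ?_⟩, ?_, ?_⟩
  · exact (hσ _ _).trans (by rw [hi, hinv])
  · exact (hσ _ _).trans (by rw [hi, hinv])
  · exact (hσ _ _).trans (by rw [smul_expo, cl_simpleRefl_smul_root])
  · exact (hσ _ _).trans (by rw [smul_expo, cl_simpleRefl_smul_root])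

lemma dividedDiff_comm {G L : Type*} [Group G] [CommRing L] [MulSemiringAction G L] {s t : G}
    (hst : s * t = t * s) {d d' : L} (hs : s • d' = d') (ht : t • d = d) :
    dividedDiff s d * dividedDiff t d' = dividedDiff t d' * dividedDiff s d := by
  rw [dividedDiff, dividedDiff, of_apply, of_apply, one_def]
  simp only [sub_eq_add_neg, mul_add, add_mul, mul_neg, neg_mul, single_mul_single, one_mul,
    mul_one, one_smul, hs, ht, hst, smul_one, mul_comm d d']
  abel

lemma isBraided_TNode : IsBraided (TNode b) where
  two {a a'} hA hB := by
    rw [TNode_eq_dividedDiff, TNode_eq_dividedDiff]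
    refine dividedDiff_comm (simpleRefl_comm_of_pairing_eq_zero hB) ?_ ?_ <;>
    · rw [smul_cInv]
      congr 1
      apply P.root.injective
      rw [← P.weylGroup_apply_root, cl_simpleRefl_smul_root]
      simp [hA, hB]
  three {a a'} hA hB := by
    obtain ⟨σ, τ, h, hσ, hτ⟩ := exists_dihedralData a a'
    have ha := algebraMap_cInv_mul (P := P) (levelZeroIdx b a)
    have hb := algebraMap_cInv_mul (P := P) (levelZeroIdx b a')
    rw [hB, neg_one_smul, sub_neg_eq_add, add_comm, expo_add, map_mul] at hσ
    rw [hA, neg_one_smul, sub_neg_eq_add, expo_add, map_mul] at hτ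
    have hc := congrArg τ ha
    rw [map_mul, map_sub, hτ, map_one] at hc
    rw [mul_assoc, mul_assoc]
    exact h.dividedDiff_braid_three (by simpa [mul_assoc] using (simpleRefl_braid_three hA hB).symm)
      hσ hτ ha hb hc
  four {a a'} hA hB := by
    obtain ⟨σ, τ, h, hσ, hτ⟩ := exists_dihedralData a a'
    have ha := algebraMap_cInv_mul (P := P) (levelZeroIdx b a)
    have hb := algebraMap_cInv_mul (P := P) (levelZeroIdx b a')
    rw [hB, sub_eq_add_neg, ← neg_smul, neg_neg, two_smul, add_comm, expo_add, expo_add, ← pow_two,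
      map_mul, map_pow] at hσ
    rw [hA, neg_one_smul, sub_neg_eq_add, expo_add, map_mul] at hτ
    have hc := congrArg τ ha
    rw [map_mul, map_sub, hτ, map_one] at hc
    have hk := congrArg σ hb
    rw [map_mul, map_sub, hσ, map_one] at hk
    simp only [mul_assoc]
    exact (h.dividedDiff_braid_four (by simpa [mul_assoc] using simpleRefl_braid_four hA hB)
      hσ hτ ha hb hc hk).symm
  six {a a'} hA hB := by
    obtain ⟨σ, τ, h, hσ, hτ⟩ := exists_dihedralData a a'
    have ha := algebraMap_cInv_mul (P := P) (levelZeroIdx b a)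
    have hb := algebraMap_cInv_mul (P := P) (levelZeroIdx b a')
    have h3 : ∀ x : X, expo P ((3 : ℤ) • x) = expo P x ^ 3 := fun x ↦ by
      rw [show (3 : ℤ) • x = x + x + x by module, expo_add, expo_add]
      ring
    rw [hB, sub_eq_add_neg, ← neg_smul, neg_neg, add_comm, expo_add, h3, map_mul, map_pow] at hσ
    rw [hA, neg_one_smul, sub_neg_eq_add, expo_add, map_mul] at hτ
    have hc := congrArg τ ha
    rw [map_mul, map_sub, hτ, map_one] at hc
    have hm := congrArg σ hb
    rw [map_mul, map_sub, hσ, map_one] at hm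
    -- The inverses for the remaining positive roots are obtained by transport: `x²y = σ(xy)` and
    -- `x³y² = τ(x³y)`.
    have hk := congrArg σ hc
    rw [map_mul σ, map_sub, map_mul σ, hσ, map_one, h.apply_left] at hk
    have hn := congrArg τ hm
    rw [map_mul τ, map_sub, map_mul τ, map_pow, hτ, map_one, h.apply_right] at hn
    set x := algebraMap (LocRep P) (FractionRing (LocRep P)) (expo P (P.root (levelZeroIdx b a)))
    set y := algebraMap (LocRep P) (FractionRing (LocRep P)) (expo P (P.root (levelZeroIdx b a')))
    have h1 : x⁻¹ * (x ^ 3 * y) = x ^ 2 * y := by field_simp [h.ne_left]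
    have h2 : (x * y) ^ 3 * y⁻¹ = x ^ 3 * y ^ 2 := by field_simp [h.ne_right]
    rw [h1] at hk
    rw [h2] at hn
    simp only [mul_assoc]
    exact (h.dividedDiff_braid_six (by simpa [mul_assoc] using simpleRefl_braid_six hA hB)
      hσ hτ ha hb hc hk hm hn).symm

end Braid

end AffNilHecke

end

noncomputable section

namespace AffNilHecke

variable {ι X Y : Type*} [AddCommGroup X] [AddCommGroup Y] {P : RootPairing ι ℤ X Y}
variable {b : P.Base}

open SkewMonoidAlgebra

/-! ### The elements `T_w` -/

lemma _root_.SkewMonoidAlgebra.mul_neg' {L G : Type*} [CommRing L] [Group G] [MulSemiringAction G L]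
    (x y : SkewMonoidAlgebra L G) : x * -y = -(x * y) := mul_neg x y

lemma _root_.SkewMonoidAlgebra.neg_mul' {L G : Type*} [CommRing L] [Group G] [MulSemiringAction G L]
    (x y : SkewMonoidAlgebra L G) : -x * y = -(x * y) := neg_mul x y

section SmashRing

/-! Ring identities stated for the smash product itself, where unification of the ring operations
of the generic statements does not find the instances. -/

namespace Smash

variable (x y z : Smash P)

lemma mul_sub : x * (y - z) = x * y - x * z := _root_.mul_sub x y z

lemma sub_mul : (x - y) * z = x * z - y * z := _root_.sub_mul x y z

lemma mul_neg : x * -y = -(x * y) := SkewMonoidAlgebra.mul_neg' x y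

lemma neg_mul : -x * y = -(x * y) := SkewMonoidAlgebra.neg_mul' x y

lemma add_neg_cancel : x + -x = 0 := _root_.add_neg_cancel x

end Smash

end SmashRing

lemma elt_eq_single (w : ExtAffWeyl P) : elt w = (single w 1 : Smash P) := by
  rw [elt, of_apply]

lemma elt_one : elt (1 : ExtAffWeyl P) = 1 := map_one _

lemma elt_mul (v w : ExtAffWeyl P) : elt (v * w) = elt v * elt w := map_mul _ _ _

lemma elt_mul_inv (w : ExtAffWeyl P) : elt w * elt w⁻¹ = 1 := by
  rw [← elt_mul, mul_inv_cancel, elt_one]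

lemma elt_inv_mul (w : ExtAffWeyl P) : elt w⁻¹ * elt w = 1 := by
  rw [← elt_mul, inv_mul_cancel, elt_one]

lemma elt_mul_single (w v : ExtAffWeyl P) (p : LocRep P) :
    elt w * single v p = single (w * v) (w • p) := by
  rw [elt_eq_single, single_mul_single, one_mul]

lemma single_mul_elt (w v : ExtAffWeyl P) (p : LocRep P) :
    single v p * elt w = single (v * w) p := by
  rw [elt_eq_single, single_mul_single, smul_one, mul_one]

lemma elt_mul_cInv_mul (w v : ExtAffWeyl P) (i : ι) :
    elt w * (single 1 (cInv P i) * (elt v - 1)) =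
      single 1 (cInv P (P.weylGroupToPerm (cl P w) i)) * (elt (w * v * w⁻¹) - 1) * elt w := by
  rw [← mul_assoc, elt_mul_single, mul_one, smul_cInv, mul_assoc, Smash.sub_mul, ← elt_mul,
    inv_mul_cancel_right, elt_mul, Smash.mul_sub, Smash.mul_sub, one_mul, mul_one, ← mul_assoc]
  simp only [single_mul_elt, one_mul]

section

variable [Finite ι] [P.IsReduced]

lemma elt_mul_TNode {w : ExtAffWeyl P} {a a' : AffNode b} (h : w • nodeRoot b a = nodeRoot b a') :
    elt w * TNode b a = TNode b a' * elt w := by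
  have h1 : P.weylGroupToPerm (cl P w) (levelZeroIdx b a) = levelZeroIdx b a' :=
    (AffRoot.smul_fst w (nodeRoot b a)).symm.trans (congrArg Prod.fst h)
  rw [TNode, elt_mul_cInv_mul, h1, TNode]
  congr 4
  rw [simpleRefl_eq, affRefl_conj, h, simpleRefl_eq]

/-- The identity `1 / (1 - x) + 1 / (1 - x⁻¹) = 1`, which is behind `T_a² = -T_a`. -/
lemma cInv_add_smul_cInv (a : AffNode b) : cInv P (levelZeroIdx b a) +
    simpleRefl b a • cInv P (levelZeroIdx b a) = 1 := by
  have h1 := cInv_mul (P := P) (levelZeroIdx b a)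
  have h2 := congrArg (simpleRefl b a • ·) h1
  simp only [smul_mul', smul_sub, smul_one, smul_expo, cl_simpleRefl_smul_root, P.pairing_same] at h2
  rw [show P.root (levelZeroIdx b a) - (2 : ℤ) • P.root (levelZeroIdx b a) =
    -P.root (levelZeroIdx b a) by module] at h2
  have h3 := expo_neg_mul (P := P) (P.root (levelZeroIdx b a))
  set x := expo P (P.root (levelZeroIdx b a))
  set y := expo P (-P.root (levelZeroIdx b a))
  set d := cInv P (levelZeroIdx b a)
  set d' := simpleRefl b a • d
  linear_combination (1 - d') * h1 - d * x * h2 - d * d' * h3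

lemma TNode_eq (a : AffNode b) : TNode b a =
    single (simpleRefl b a) (cInv P (levelZeroIdx b a)) - single 1 (cInv P (levelZeroIdx b a)) := by
  rw [TNode, Smash.mul_sub, single_mul_elt, one_mul, mul_one]

lemma TNode_mul_self (a : AffNode b) : TNode b a * TNode b a = -TNode b a := by
  have h := cInv_add_smul_cInv a
  set d := cInv P (levelZeroIdx b a)
  rw [show TNode b a * TNode b a = dividedDiff (simpleRefl b a) d * TNode b a from rfl, TNode_eq,
    Smash.mul_sub, dividedDiff_mul_single, dividedDiff_mul_single, simpleRefl_mul_self, mul_one]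
  have h1 : d * simpleRefl b a • d = d - d * d := by linear_combination d * h
  rw [h1, sub_eq_add_neg d, single_add, single_add, single_neg, single_neg]
  abel

lemma coeff_TNode_mul (a : AffNode b) (x : Smash P) (v : ExtAffWeyl P) :
    (TNode b a * x).coeff v = cInv P (levelZeroIdx b a) *
      (simpleRefl b a • x.coeff (simpleRefl b a * v) - x.coeff v) := by
  rw [TNode, mul_assoc, coeff_single_one_mul, Smash.sub_mul, one_mul, coeff_sub, elt_eq_single,
    Finsupp.sub_apply, coeff_single_mul, one_mul, simpleRefl_inv]

variable [Module.Finite ℤ X]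

lemma cInv_ne_zero (i : ι) : cInv P i ≠ 0 := by
  intro h
  have := cInv_mul (P := P) i
  rw [h, zero_mul] at this
  exact zero_ne_one this

/-- Any two reduced words of the affine part give the same product, by Matsumoto's theorem for the
braided family `TNode`. -/
lemma existsUnique_isTElt (b : P.Base) (w : ExtAffWeyl P) : ∃! x, IsTElt b w x := by
  obtain ⟨l, hl⟩ := exists_wordProd_eq_of_isAffine (affPart_mem (b := b) w)
  obtain ⟨l', h1, h2⟩ := exists_reduced_wordProd l
  rw [hl] at h1 h2
  refine ⟨_, ⟨l', ⟨h1, h2.trans (coxLength_eq (affPart_mem w)).symm⟩, rfl⟩, ?_⟩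
  rintro _ ⟨l'', ⟨h3, h4⟩, rfl⟩
  rw [coxLength_eq (affPart_mem w)] at h4
  rw [isBraided_TNode.prod_eq (by rw [h3, h4]) (by rw [h1, h2]) (h3.trans h1.symm)]

lemma isTElt_T (b : P.Base) (w : ExtAffWeyl P) : IsTElt b w (T b w) :=
  Classical.epsilon_spec (existsUnique_isTElt b w).exists

lemma T_mul_wordProd {π : ExtAffWeyl P} (hπ : invLength b π = 0) {l : List (AffNode b)}
    (hl : l.length = invLength b (wordProd b l)) :
    T b (π * wordProd b l) = elt π * (l.map (TNode b)).prod := by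
  obtain ⟨h1, h2⟩ := fundPart_eq_and_affPart_eq hπ (wordProd_mem_affineSubgroup l)
    (rfl : π * wordProd b l = π * wordProd b l)
  refine (existsUnique_isTElt b (π * wordProd b l)).unique (isTElt_T b _) ⟨l, ?_, ?_⟩
  · rw [h2]
    exact ⟨rfl, hl.trans (coxLength_eq (wordProd_mem_affineSubgroup l)).symm⟩
  · rw [h1]

lemma exists_T_eq (w : ExtAffWeyl P) : ∃ π l, invLength b π = 0 ∧
    l.length = invLength b (wordProd b l) ∧ w = π * wordProd b l := by
  obtain ⟨π, l, hπ, rfl, hl⟩ := exists_eq_mul_wordProd (b := b) w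
  exact ⟨π, l, hπ, hl.trans (invLength_mul_of_left hπ), rfl⟩

lemma T_fund_mul {π : ExtAffWeyl P} (hπ : invLength b π = 0) (w : ExtAffWeyl P) :
    T b (π * w) = elt π * T b w := by
  obtain ⟨π', l, hπ', hl, rfl⟩ := exists_T_eq (b := b) w
  rw [T_mul_wordProd hπ' hl, ← mul_assoc, T_mul_wordProd _ hl, elt_mul, mul_assoc]
  rw [invLength_mul_of_left hπ, hπ']

lemma T_one : T b 1 = 1 := by
  have := T_mul_wordProd (b := b) (invLength_one (b := b)) (l := []) (by simp [invLength_one])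
  simpa [elt_one] using this

/-- The letter `a` has to pass the component `π` in `Ω`; it becomes the letter `a'` with `π α_{a'} =
α_a`. -/
lemma T_simpleRefl_mul {w : ExtAffWeyl P} {a : AffNode b} (h : (w⁻¹ • nodeRoot b a).Pos b) :
    T b (simpleRefl b a * w) = TNode b a * T b w := by
  have hlen := invLength_simpleRefl_mul h
  obtain ⟨π, l, hπ, hl, rfl⟩ := exists_T_eq (b := b) w
  obtain ⟨a', ha'⟩ := exists_smul_nodeRoot_eq (show invLength b π⁻¹ = 0 by rwa [invLength_inv]) a
  rw [inv_smul_eq_iff] at ha'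
  have h1 : simpleRefl b a * (π * wordProd b l) = π * wordProd b (a' :: l) := by
    have : π * simpleRefl b a' * π⁻¹ = simpleRefl b a := by
      rw [simpleRefl_eq, affRefl_conj, ← ha', simpleRefl_eq]
    rw [wordProd_cons, ← this]
    group
  rw [h1, invLength_mul_of_left hπ, invLength_mul_of_left hπ, ← hl] at hlen
  rw [h1, T_mul_wordProd hπ (l := a' :: l) hlen.symm, T_mul_wordProd hπ hl, List.map_cons, List.prod_cons,
    ← mul_assoc, elt_mul_TNode ha'.symm, mul_assoc]

lemma TNode_mul_T_of_not_pos {w : ExtAffWeyl P} {a : AffNode b}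
    (h : ¬ (w⁻¹ • nodeRoot b a).Pos b) : TNode b a * T b w = -T b w := by
  have h1 : ((simpleRefl b a * w)⁻¹ • nodeRoot b a).Pos b := by
    rw [mul_inv_rev, simpleRefl_inv, pos_mul_simpleRefl_smul_nodeRoot]
    exact h
  have h2 := T_simpleRefl_mul h1
  rw [← mul_assoc, simpleRefl_mul_self, one_mul] at h2
  rw [h2, ← mul_assoc, TNode_mul_self, Smash.neg_mul]

/-- Induction on the length, by multiplication on the left. -/
lemma length_induction {p : ExtAffWeyl P → Prop} (fund : ∀ π, invLength b π = 0 → p π)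
    (simpleRefl_mul : ∀ a w, (w⁻¹ • nodeRoot b a).Pos b → p w → p (simpleRefl b a * w))
    (w : ExtAffWeyl P) : p w := by
  induction hn : invLength b w generalizing w with
  | zero => exact fund w hn
  | succ n ih =>
    have h1 : ¬ ∀ a, (w⁻¹ • nodeRoot b a).Pos b := fun h ↦ by
      rw [← invLength_eq_zero_iff, invLength_inv] at h
      omega
    push Not at h1
    obtain ⟨a, ha⟩ := h1
    have h2 := invLength_simpleRefl_mul_of_not_pos ha
    have h3 := simpleRefl_mul a (simpleRefl b a * w) (by
      rw [mul_inv_rev, simpleRefl_inv, pos_mul_simpleRefl_smul_nodeRoot]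
      exact ha) (ih _ (by omega))
    rwa [← mul_assoc, simpleRefl_mul_self, one_mul] at h3

lemma pos_of_invLength_mul {v w : ExtAffWeyl P} {a : AffNode b}
    (hv : (v⁻¹ • nodeRoot b a).Pos b)
    (h : invLength b (simpleRefl b a * v * w) = invLength b (simpleRefl b a * v) + invLength b w) :
    ((v * w)⁻¹ • nodeRoot b a).Pos b ∧ invLength b (v * w) = invLength b v + invLength b w := by
  have h1 := invLength_simpleRefl_mul hv
  have h2 := invLength_simpleRefl_mul_le (v * w) a
  have h3 := invLength_mul_le (b := b) v w
  rw [mul_assoc] at h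
  refine ⟨by_contra fun hn ↦ ?_, by omega⟩
  have := invLength_simpleRefl_mul_of_not_pos hn
  omega

lemma T_mul {v w : ExtAffWeyl P} (h : invLength b (v * w) = invLength b v + invLength b w) :
    T b (v * w) = T b v * T b w := by
  induction v using length_induction (b := b) with
  | fund π hπ => rw [T_fund_mul hπ, ← mul_one π, T_fund_mul hπ, T_one, mul_one, mul_one]
  | simpleRefl_mul a v hv ih =>
    obtain ⟨h1, h2⟩ := pos_of_invLength_mul hv h
    rw [mul_assoc, T_simpleRefl_mul h1, ih h2, T_simpleRefl_mul hv, mul_assoc]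

lemma T_simpleRefl (a : AffNode b) : T b (simpleRefl b a) = TNode b a := by
  have := T_simpleRefl_mul (b := b) (w := 1) (a := a) (by simpa using pos_nodeRoot a)
  rwa [mul_one, T_one, mul_one] at this

/-- `T_w` is triangular in the group elements. -/
lemma coeff_T (b : P.Base) (w : ExtAffWeyl P) : (T b w).coeff w ≠ 0 ∧
    ∀ v, (T b w).coeff v ≠ 0 → v = w ∨ invLength b v < invLength b w := by
  induction w using length_induction (b := b) with
  | fund π hπ =>
    have h1 := T_fund_mul hπ 1
    rw [mul_one, T_one, mul_one] at h1
    classical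
    rw [h1, elt_eq_single]
    simp only [coeff_single_apply]
    refine ⟨by simp, fun v hv ↦ .inl ?_⟩
    by_contra hne
    simp [Ne.symm hne] at hv
  | simpleRefl_mul a w hw ih =>
    obtain ⟨h1, h2⟩ := ih
    have h3 := invLength_simpleRefl_mul hw
    rw [T_simpleRefl_mul hw]
    refine ⟨?_, fun v hv ↦ ?_⟩
    · have h4 : (T b w).coeff (simpleRefl b a * w) = 0 := by
        by_contra h4
        rcases h2 _ h4 with h | h
        · rw [h] at h3; omega
        · omega
      rw [coeff_TNode_mul, h4, sub_zero, ← mul_assoc, simpleRefl_mul_self, one_mul]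
      exact mul_ne_zero (cInv_ne_zero _) ((smul_ne_zero_iff_ne _).mpr h1)
    · have h4 : (T b w).coeff (simpleRefl b a * v) ≠ 0 ∨ (T b w).coeff v ≠ 0 := by
        by_contra! h4
        rw [coeff_TNode_mul, h4.1, h4.2, smul_zero, sub_zero, mul_zero] at hv
        exact hv rfl
      rcases h4 with h4 | h4 <;> rcases h2 _ h4 with h5 | h5
      · left
        rw [← h5, ← mul_assoc, simpleRefl_mul_self, one_mul]
      · right
        have := invLength_simpleRefl_mul_le (simpleRefl b a * v) a
        rw [← mul_assoc, simpleRefl_mul_self, one_mul] at this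
        omega
      · right; rw [h5]; omega
      · right; omega

/-! ### Sums of the `T_v` over lower intervals -/

/-- The sum of the `T_v` over the Bruhat interval below `w`. -/
def lowerSum (b : P.Base) (w : ExtAffWeyl P) : Smash P :=
  ∑ v ∈ (finite_bruhatChain b w).toFinset, T b v

/-- The factor `1 + T_a` kills `T_v` if `s_a v < v` and sends it to `T_v + T_{s_a v}` otherwise. By
the lifting property the interval below `s_a w` consists of the `v ≤ w` with `s_a v > v` and of
their products `s_a v`. -/
lemma lowerSum_simpleRefl_mul {w : ExtAffWeyl P} {a : AffNode b}
    (h : (w⁻¹ • nodeRoot b a).Pos b) :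
    lowerSum b (simpleRefl b a * w) = (1 + TNode b a) * lowerSum b w := by
  classical
  rw [lowerSum, lowerSum, Finset.mul_sum,
    ← Finset.sum_filter_add_sum_filter_not (finite_bruhatChain b w).toFinset
      (fun v ↦ (v⁻¹ • nodeRoot b a).Pos b),
    ← Finset.sum_filter_add_sum_filter_not (finite_bruhatChain b (simpleRefl b a * w)).toFinset
      (fun v ↦ (v⁻¹ • nodeRoot b a).Pos b),
    Finset.sum_eq_zero (s := Finset.filter (fun v ↦ ¬ (v⁻¹ • nodeRoot b a).Pos b)
      (finite_bruhatChain b w).toFinset), add_zero]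
  · simp only [add_mul, one_mul, Finset.sum_add_distrib]
    congr 1
    · refine Finset.sum_congr (Finset.ext fun v ↦ ?_) fun _ _ ↦ rfl
      simp only [Finset.mem_filter, Set.Finite.mem_toFinset, Set.mem_ofPred_eq]
      exact and_congr_left fun hv ↦ bruhatChain_simpleRefl_mul_iff_of_pos h hv
    · symm
      refine Finset.sum_nbij' (simpleRefl b a * ·) (simpleRefl b a * ·) ?_ ?_ ?_ ?_ ?_
      · intro v hv
        simp only [Finset.mem_filter, Set.Finite.mem_toFinset, Set.mem_ofPred_eq] at hv ⊢
        have h1 : ¬ ((simpleRefl b a * v)⁻¹ • nodeRoot b a).Pos b := by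
          rw [mul_inv_rev, simpleRefl_inv, pos_mul_simpleRefl_smul_nodeRoot, not_not]
          exact hv.2
        refine ⟨?_, h1⟩
        rw [bruhatChain_simpleRefl_mul_iff_of_not_pos h h1, ← mul_assoc, simpleRefl_mul_self,
          one_mul]
        exact hv.1
      · intro v hv
        simp only [Finset.mem_filter, Set.Finite.mem_toFinset, Set.mem_ofPred_eq] at hv ⊢
        rw [mul_inv_rev, simpleRefl_inv, pos_mul_simpleRefl_smul_nodeRoot]
        exact ⟨(bruhatChain_simpleRefl_mul_iff_of_not_pos h hv.2).mp hv.1, hv.2⟩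
      · intro v _
        rw [← mul_assoc, simpleRefl_mul_self, one_mul]
      · intro v _
        rw [← mul_assoc, simpleRefl_mul_self, one_mul]
      · intro v hv
        simp only [Finset.mem_filter] at hv
        rw [T_simpleRefl_mul hv.2]
  · intro v hv
    rw [Finset.mem_filter] at hv
    rw [add_mul, one_mul, TNode_mul_T_of_not_pos hv.2, Smash.add_neg_cancel]

lemma bruhatChain_fund_mul {π v w : ExtAffWeyl P} (hπ : invLength b π = 0)
    (h : BruhatChain b v w) : BruhatChain b (π * v) (π * w) := by
  induction h with
  | refl => exact .refl _
  | tail _ h ih =>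
    obtain ⟨h1, β, rfl⟩ := h
    refine Relation.ReflTransGen.tail ih ⟨?_, β, (mul_assoc _ _ _).symm⟩
    rwa [invLength_mul_of_left hπ, invLength_mul_of_left hπ]

lemma lowerSum_fund_mul {π : ExtAffWeyl P} (hπ : invLength b π = 0) (w : ExtAffWeyl P) :
    lowerSum b (π * w) = elt π * lowerSum b w := by
  rw [lowerSum, lowerSum, Finset.mul_sum]
  refine Finset.sum_nbij' (π⁻¹ * ·) (π * ·) ?_ ?_ ?_ ?_ ?_
  · intro v hv
    simp only [Set.Finite.mem_toFinset, Set.mem_ofPred_eq] at hv ⊢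
    have := bruhatChain_fund_mul (π := π⁻¹) (by rwa [invLength_inv]) hv
    rwa [inv_mul_cancel_left] at this
  · intro v hv
    simp only [Set.Finite.mem_toFinset, Set.mem_ofPred_eq] at hv ⊢
    exact bruhatChain_fund_mul hπ hv
  · intro v _
    rw [mul_inv_cancel_left]
  · intro v _
    rw [inv_mul_cancel_left]
  · intro v _
    rw [← T_fund_mul hπ, mul_inv_cancel_left]

lemma lowerSum_one : lowerSum b 1 = 1 := by
  have : (finite_bruhatChain b 1).toFinset = {1} := by
    ext v
    simp only [Set.Finite.mem_toFinset, Set.mem_ofPred_eq, Finset.mem_singleton]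
    refine ⟨fun h ↦ ?_, fun h ↦ h ▸ .refl _⟩
    rcases Relation.ReflTransGen.cases_tail h with h | ⟨c, -, h, -⟩
    · exact h.symm
    · rw [invLength_one] at h
      omega
  rw [lowerSum, this, Finset.sum_singleton, T_one]

lemma lowerSum_mul {v w : ExtAffWeyl P}
    (h : invLength b (v * w) = invLength b v + invLength b w) :
    lowerSum b (v * w) = lowerSum b v * lowerSum b w := by
  induction v using length_induction (b := b) with
  | fund π hπ =>
    rw [lowerSum_fund_mul hπ, ← mul_one π, lowerSum_fund_mul hπ, lowerSum_one, mul_one, mul_one]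
  | simpleRefl_mul a v hv ih =>
    obtain ⟨h1, h2⟩ := pos_of_invLength_mul hv h
    rw [mul_assoc, lowerSum_simpleRefl_mul h1, ih h2, lowerSum_simpleRefl_mul hv, mul_assoc]

/-- The sum already has a left factor `1 + T_a`, and this element is idempotent. -/
lemma lowerSum_simpleRefl_mul_of_not_pos {w : ExtAffWeyl P} {a : AffNode b}
    (h : ¬ (w⁻¹ • nodeRoot b a).Pos b) : (1 + TNode b a) * lowerSum b w = lowerSum b w := by
  have h1 : ((simpleRefl b a * w)⁻¹ • nodeRoot b a).Pos b := by
    rw [mul_inv_rev, simpleRefl_inv, pos_mul_simpleRefl_smul_nodeRoot]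
    exact h
  have h2 := lowerSum_simpleRefl_mul h1
  rw [← mul_assoc, simpleRefl_mul_self, one_mul] at h2
  rw [h2, ← mul_assoc]
  congr 1
  rw [mul_add, add_mul, add_mul, TNode_mul_self]
  noncomm_ring

lemma lowerSum_simpleRefl (a : AffNode b) : lowerSum b (simpleRefl b a) = 1 + TNode b a := by
  have := lowerSum_simpleRefl_mul (b := b) (w := 1) (a := a) (by simpa using pos_nodeRoot a)
  rwa [mul_one, lowerSum_one, mul_one] at this

end

end AffNilHecke

end

noncomputable section

namespace AffNilHecke

open SkewMonoidAlgebra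

/-! ### Projection to the translation part -/

section TransProj

variable {L G : Type*} [CommRing L] [Group G] [MulSemiringAction G L]

/-- A map `τ` from a group to a commutative subgroup that acts trivially on the coefficients, with
the cocycle property of the translation part in a semidirect product. -/
structure IsTransPart (L : Type*) {G : Type*} [CommRing L] [Group G] [MulSemiringAction G L]
    (τ : G → G) : Prop where
  map_mul (v w : G) : τ (v * w) = v * τ w * v⁻¹ * τ v
  map_map (v : G) : τ (τ v) = τ v
  comm (v w : G) : τ v * τ w = τ w * τ v
  smul (v : G) (p : L) : τ v • p = p

variable {τ : G → G} (h : IsTransPart L τ)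

include h

lemma IsTransPart.map_one : τ 1 = 1 := by
  have := h.map_mul 1 1
  simpa using this

lemma IsTransPart.map_mul_of_map_eq_one {w : G} (hw : τ w = 1) (v : G) : τ (v * w) = τ v := by
  rw [h.map_mul, hw]
  group

lemma IsTransPart.map_map_mul (v w : G) : τ (τ v * w) = τ v * τ w := by
  rw [h.map_mul, h.map_map]
  group

lemma IsTransPart.map_mul_map (v w : G) : τ (v * τ w) = τ (v * w) := by
  rw [h.map_mul, h.map_map, ← h.map_mul]

/-- In particular the kernel of the projection is a left ideal, and a product can be projected one
factor at a time, starting from the right. -/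
lemma IsTransPart.mapDomain_mul_mapDomain (x y : SkewMonoidAlgebra L G) :
    mapDomain τ (x * mapDomain τ y) = mapDomain τ (x * y) := by
  induction x using SkewMonoidAlgebra.induction_on with
  | zero => simp
  | add x x' hx hx' => rw [add_mul, add_mul, map_add, hx, hx', map_add]
  | single v p =>
    induction y using SkewMonoidAlgebra.induction_on with
    | zero => simp
    | add y y' hy hy' => rw [map_add, mul_add, mul_add, map_add, hy, hy', map_add]
    | single w q =>
      simp only [mapDomain_single, single_mul_single, h.map_mul_map]

lemma IsTransPart.mapDomain_mapDomain (x : SkewMonoidAlgebra L G) :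
    mapDomain τ (mapDomain τ x) = mapDomain τ x := by
  simpa using h.mapDomain_mul_mapDomain 1 x

lemma IsTransPart.mapDomain_mapDomain_mul (x y : SkewMonoidAlgebra L G) :
    mapDomain τ (mapDomain τ x * y) = mapDomain τ x * mapDomain τ y := by
  induction x using SkewMonoidAlgebra.induction_on with
  | zero => simp
  | add x x' hx hx' => rw [map_add, add_mul, add_mul, map_add, hx, hx']
  | single v p =>
    induction y using SkewMonoidAlgebra.induction_on with
    | zero => simp
    | add y y' hy hy' => rw [map_add, mul_add, mul_add, map_add, hy, hy']
    | single w q =>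
      simp only [mapDomain_single, single_mul_single, h.map_map_mul]

lemma IsTransPart.mapDomain_mul_comm (x y : SkewMonoidAlgebra L G) :
    mapDomain τ x * mapDomain τ y = mapDomain τ y * mapDomain τ x := by
  induction x using SkewMonoidAlgebra.induction_on with
  | zero => simp
  | add x x' hx hx' => rw [map_add, add_mul, mul_add, hx, hx']
  | single v p =>
    induction y using SkewMonoidAlgebra.induction_on with
    | zero => simp
    | add y y' hy hy' => rw [map_add, mul_add, add_mul, hy, hy']
    | single w q =>
      simp only [mapDomain_single, single_mul_single, h.smul, h.comm v w, mul_comm p]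

lemma IsTransPart.mapDomain_mul_of {w : G} (hw : τ w = 1) (x : SkewMonoidAlgebra L G) :
    mapDomain τ (x * of L G w) = mapDomain τ x := by
  induction x using SkewMonoidAlgebra.induction_on with
  | zero => simp
  | add x x' hx hx' => rw [add_mul, map_add, map_add, hx, hx']
  | single v p =>
    simp only [of_apply, mapDomain_single, single_mul_single, smul_one, mul_one,
      h.map_mul_of_map_eq_one hw]

lemma IsTransPart.mapDomain_single_one_mul (p : L) (x : SkewMonoidAlgebra L G) :
    mapDomain τ (single 1 p * x) = single 1 p * mapDomain τ x := by
  have := h.mapDomain_mapDomain_mul (single 1 p) x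
  rwa [mapDomain_single, h.map_one] at this

lemma IsTransPart.mapDomain_of_mul (w : G) (x : SkewMonoidAlgebra L G) :
    mapDomain τ (of L G w * x) =
      of L G w * mapDomain τ x * of L G w⁻¹ * mapDomain τ (of L G w) := by
  induction x using SkewMonoidAlgebra.induction_on with
  | zero => simp
  | add x x' hx hx' => rw [mul_add, map_add, map_add, mul_add, add_mul, add_mul, hx, hx']
  | single v p =>
    simp only [of_apply, mapDomain_single, single_mul_single, smul_one, mul_one, one_mul,
      h.map_mul]

/-- `s` and `1` have the same image, so `d (s - 1)` lies in the kernel, which is a left ideal. -/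
lemma IsTransPart.mapDomain_mul_dividedDiff {s : G} (hs : τ s = 1) (d : L)
    (x : SkewMonoidAlgebra L G) : mapDomain τ (x * dividedDiff s d) = 0 := by
  have h1 : mapDomain τ (dividedDiff s d) = 0 := by
    rw [dividedDiff, h.mapDomain_single_one_mul, map_sub, of_apply, mapDomain_single, hs,
      single_one_one, ← single_one_one, mapDomain_single, h.map_one, sub_self, mul_zero]
  rw [← h.mapDomain_mul_mapDomain, h1, mul_zero, map_zero]

/-- The right side is arranged so that each of its terms stays in the nil-Hecke ring when `y` does:
it involves only `y`, the divided difference for `s`, group elements, and the divided difference `d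
(r - 1)` for the linear part `r` of `s`. -/
lemma IsTransPart.mapDomain_dividedDiff_mul {s r : G} (hs : s * s = 1) (hr : s * r = τ s) (d : L)
    {y : SkewMonoidAlgebra L G} (hy : mapDomain τ y = y) :
    mapDomain τ (dividedDiff s d * y) =
      (dividedDiff s d * y - y * dividedDiff s d) * (of L G s * of L G (τ s)) +
        y * (dividedDiff s d * of L G r + single 1 d * (of L G r - 1)) := by
  have h1 : s⁻¹ = s := inv_eq_of_mul_eq_one_left hs
  have h2 : y * single 1 d = single 1 d * y := by
    have := h.mapDomain_mul_comm y (single 1 d)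
    rwa [mapDomain_single, h.map_one, hy] at this
  have h3 : of L G s * of L G s = 1 := by rw [← _root_.map_mul, hs, _root_.map_one]
  have h4 : of L G s * of L G r = of L G (τ s) := by rw [← _root_.map_mul, hr]
  have h5 : mapDomain τ (of L G s) = of L G (τ s) := by
    rw [of_apply, mapDomain_single, of_apply]
  have h6 := h.mapDomain_of_mul s y
  rw [h1, h5, hy] at h6
  have h7 : mapDomain τ (dividedDiff s d * y) =
      single 1 d * (of L G s * y * of L G s * (of L G s * of L G r) - y) := by
    rw [dividedDiff, mul_assoc, h.mapDomain_single_one_mul, sub_mul, one_mul, map_sub, h6, hy, h4]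
  rw [h7, dividedDiff, ← h4]
  have key (D S R : SkewMonoidAlgebra L G) (hS : S * S = 1) (hD : y * D = D * y) :
      D * (S * y * S * (S * R) - y) =
      (D * (S - 1) * y - y * (D * (S - 1))) * (S * (S * R)) +
        y * (D * (S - 1) * R + D * (R - 1)) := by
    have e1 : S * (S * R) = R := by rw [← mul_assoc, hS, one_mul]
    have e2 : S * y * S * (S * R) = S * y * R := by rw [mul_assoc (S * y), e1]
    rw [e2, e1, mul_add, ← mul_assoc y, ← mul_assoc y, ← mul_assoc y, ← mul_assoc y, hD]
    noncomm_ring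
  exact key _ _ _ h3 h2

omit h in
/-- The value of the projection at a point whose fibre meets the support in at most one point. -/
lemma coeff_mapDomain_of_forall {x : SkewMonoidAlgebra L G} {v : G}
    (hx : ∀ w, x.coeff w ≠ 0 → τ w = τ v → w = v) : (mapDomain τ x).coeff (τ v) = x.coeff v := by
  classical
  rw [coeff_mapDomain, Finsupp.mapDomain, Finsupp.sum, Finsupp.finsetSum_apply,
    Finset.sum_eq_single v]
  · simp
  · intro w hw hne
    rw [Finsupp.single_apply, if_neg]
    exact fun e ↦ hne (hx w (Finsupp.mem_support_iff.1 hw) e)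
  · intro hv
    simp [Finsupp.notMem_support_iff.1 hv]

end TransProj

/-! ### The translation part in the extended affine Weyl group -/

section

variable {ι X Y : Type*} [AddCommGroup X] [AddCommGroup Y] {P : RootPairing ι ℤ X Y}
variable {b : P.Base}

variable (P) in
/-- The translation part of an element of the extended affine Weyl group. -/
def transPart (w : ExtAffWeyl P) : ExtAffWeyl P := trans P (Multiplicative.toAdd w.left)

lemma cl_trans_smul (μ : Y) (p : LocRep P) : trans P μ • p = p := by
  change locMap P (cl P (trans P μ)) p = p
  rw [show cl P (trans P μ) = cl P 1 from rfl]
  exact one_smul (ExtAffWeyl P) p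

lemma isTransPart_transPart (P : RootPairing ι ℤ X Y) : IsTransPart (LocRep P) (transPart P) where
  map_mul v w := by
    rw [transPart, toAdd_left_mul, add_comm, trans_add, ← conj_trans]
    rfl
  map_map v := rfl
  comm v w := by
    rw [transPart, transPart, ← trans_add, add_comm, trans_add]
  smul v p := cl_trans_smul _ p

lemma transPart_mul_fin (w : ExtAffWeyl P) : transPart P w * fin P (cl P w) = w :=
  trans_mul_fin w

lemma transPart_fin (u : P.weylGroup) : transPart P (fin P u) = 1 := trans_zero

end

end AffNilHecke

end

noncomputable section

namespace AffNilHecke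

variable {ι X Y : Type*} [AddCommGroup X] [AddCommGroup Y] {P : RootPairing ι ℤ X Y}
variable {b : P.Base}

open SkewMonoidAlgebra

/-! ### The nil-Hecke ring is spanned by the elements `T_w` over the representation ring -/

lemma scalar_eq (r : RepRing X) :
    scalar P r = single 1 (algebraMap (RepRing X) (LocRep P) r) := rfl

lemma elt_mul_scalar (w : ExtAffWeyl P) (r : RepRing X) :
    elt w * scalar P r = scalar P (repAct P (cl P w) r) * elt w := by
  rw [scalar_eq, scalar_eq, elt_mul_single, single_mul_elt, smul_algebraMap, one_mul, mul_one]

lemma repAct_single (u : P.weylGroup) (x : X) (n : ℤ) :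
    repAct P u (AddMonoidAlgebra.single x n) = AddMonoidAlgebra.single (u • x) n := by
  simp [repAct]

lemma c_dvd_one_sub_single_nat (x : X) (k : ℕ) :
    c x ∣ 1 - (AddMonoidAlgebra.single (k • x) 1 : RepRing X) := by
  have : (AddMonoidAlgebra.single (k • x) 1 : RepRing X) = AddMonoidAlgebra.single x 1 ^ k := by
    rw [AddMonoidAlgebra.single_pow, one_pow]
  rw [this]
  exact one_sub_dvd_one_sub_pow _ _

lemma c_dvd_one_sub_single (x : X) (k : ℤ) :
    c x ∣ 1 - (AddMonoidAlgebra.single (k • x) 1 : RepRing X) := by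
  obtain ⟨n, rfl | rfl⟩ := k.eq_nat_or_neg
  · rw [natCast_zsmul]
    exact c_dvd_one_sub_single_nat x n
  · have : 1 - (AddMonoidAlgebra.single (-(n : ℤ) • x) 1 : RepRing X) =
        (1 - AddMonoidAlgebra.single (n • x) 1) * -AddMonoidAlgebra.single (-(n : ℤ) • x) 1 := by
      rw [mul_neg, sub_mul, one_mul, AddMonoidAlgebra.single_mul_single, ← natCast_zsmul,
        ← add_smul, add_neg_cancel, zero_smul, mul_one, neg_sub]
      rfl
    rw [this]
    exact (c_dvd_one_sub_single_nat x n).mul_right _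

/-- On `e^x` the difference is `-e^x (1 - e^{-kα})` with `k = ⟨x, α^∨⟩`, and `1 - e^α` divides `1 -
e^{-kα}` by the geometric sum. So divided differences preserve the representation ring. -/
lemma c_dvd_repAct_ofIdx_sub (i : ι) (r : RepRing X) :
    c (P.root i) ∣ repAct P (RootPairing.weylGroup.ofIdx P i) r - r := by
  induction r using AddMonoidAlgebra.induction_linear with
  | zero => simp
  | add f g hf hg =>
    rw [map_add, add_sub_add_comm]
    exact dvd_add hf hg
  | single x n =>
    rw [repAct_single, ofIdx_smul_eq, reflection_eq]
    set k := P.toLinearMap x (P.coroot i)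
    have : (AddMonoidAlgebra.single (x - k • P.root i) n : RepRing X) -
        AddMonoidAlgebra.single x n = -AddMonoidAlgebra.single x n *
          (1 - AddMonoidAlgebra.single ((-k) • P.root i) 1) := by
      rw [mul_sub, mul_one, neg_mul, AddMonoidAlgebra.single_mul_single, mul_one, neg_smul,
        ← sub_eq_add_neg]
      abel
    rw [this]
    exact (c_dvd_one_sub_single _ _).mul_left _

lemma algebraMap_c_mul_cInv (i : ι) :
    algebraMap (RepRing X) (LocRep P) (c (P.root i)) * cInv P i = 1 := by
  rw [algebraMap_c, mul_comm, cInv_mul]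

section

variable [Finite ι] [P.IsReduced]

lemma cl_simpleRefl (a : AffNode b) :
    cl P (simpleRefl b a) = RootPairing.weylGroup.ofIdx P (levelZeroIdx b a) := by
  rw [simpleRefl_eq, cl_affRefl]
  rfl

/-- A twisted Leibniz rule; `r'` is the divided difference of `r`. -/
lemma exists_TNode_mul_scalar (a : AffNode b) (r : RepRing X) : ∃ r', TNode b a * scalar P r =
    scalar P (repAct P (cl P (simpleRefl b a)) r) * TNode b a + scalar P r' := by
  obtain ⟨r', hr'⟩ := c_dvd_repAct_ofIdx_sub (P := P) (levelZeroIdx b a) r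
  refine ⟨r', ?_⟩
  have h1 := congrArg (algebraMap (RepRing X) (LocRep P)) hr'
  rw [← cl_simpleRefl, map_sub, map_mul, ← smul_algebraMap] at h1
  have h2 := algebraMap_c_mul_cInv (P := P) (levelZeroIdx b a)
  set d := cInv P (levelZeroIdx b a)
  rw [TNode_eq, scalar_eq, scalar_eq, scalar_eq, Smash.sub_mul, Smash.mul_sub, single_mul_single,
    single_mul_single, single_mul_single, single_mul_single, ← smul_algebraMap]
  simp only [one_mul, mul_one, one_smul]
  set q := algebraMap (RepRing X) (LocRep P) r
  set q' := algebraMap (RepRing X) (LocRep P) r'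
  have h3 : simpleRefl b a • q * d = q' + d * q := by
    linear_combination d * h1 + q' * h2
  have h4 : (single 1 (simpleRefl b a • q * d) : Smash P) = single 1 q' + single 1 (d * q) := by
    rw [h3, single_add]
  rw [h4, mul_comm d (simpleRefl b a • q)]
  abel

lemma scalar_c_mul_TNode (a : AffNode b) :
    scalar P (c (P.root (levelZeroIdx b a))) * TNode b a = elt (simpleRefl b a) - 1 := by
  rw [scalar_eq, TNode, ← mul_assoc, single_mul_single, one_smul, algebraMap_c_mul_cInv, one_mul,
    single_one_one, one_mul]

lemma scalar_mem (r : RepRing X) : scalar P r ∈ nilHecke b :=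
  Subring.subset_closure (.inl (.inl ⟨r, rfl⟩))

lemma TNode_mem (a : AffNode b) : TNode b a ∈ nilHecke b :=
  Subring.subset_closure (.inl (.inr ⟨a, rfl⟩))

lemma elt_mem_of_invLength_eq_zero {π : ExtAffWeyl P} (hπ : invLength b π = 0) :
    elt π ∈ nilHecke b :=
  Subring.subset_closure (.inr ⟨π, isFundamental_iff.2 hπ, rfl⟩)

lemma elt_simpleRefl_mem (a : AffNode b) : elt (simpleRefl b a) ∈ nilHecke b := by
  have h := (nilHecke b).add_mem ((nilHecke b).mul_mem
    (scalar_mem (b := b) (c (P.root (levelZeroIdx b a)))) (TNode_mem a)) (nilHecke b).one_mem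
  rw [scalar_c_mul_TNode] at h
  convert h using 1
  abel

variable [Module.Finite ℤ X]

/-- The group elements come from `Ω` and from `s_a = 1 + c(α_a) T_a`. -/
lemma elt_mem (b : P.Base) (w : ExtAffWeyl P) : elt w ∈ nilHecke b := by
  induction w using length_induction (b := b) with
  | fund π hπ => exact elt_mem_of_invLength_eq_zero hπ
  | simpleRefl_mul a w _ hw =>
    rw [elt_mul]
    exact (nilHecke b).mul_mem (elt_simpleRefl_mem a) hw

/-- Every finite root is conjugate to an affine simple root, so the divided difference in question
is a conjugate of some `T_a` by a group element. -/
lemma cInv_mul_elt_ofIdx_sub_one_mem (b : P.Base) (i : ι) :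
    (single 1 (cInv P i) * (elt (fin P (RootPairing.weylGroup.ofIdx P i)) - 1) : Smash P) ∈
      nilHecke b := by
  obtain ⟨l, a, h⟩ := exists_eq_smul_nodeRoot b (AffRoot.mk P i 0)
  have h1 : P.weylGroupToPerm (cl P (wordProd b l)) (levelZeroIdx b a) = i := by
    have := AffRoot.smul_fst (wordProd b l) (nodeRoot b a)
    rw [← h] at this
    exact this.symm
  have h2 := elt_mul_cInv_mul (wordProd b l) (simpleRefl b a) (levelZeroIdx b a)
  rw [h1, simpleRefl_eq, affRefl_conj, ← h, affRefl_zero, ← simpleRefl_eq] at h2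
  have h3 := congrArg (· * elt (wordProd b l)⁻¹) h2
  simp only [mul_assoc, elt_mul_inv, mul_one] at h3
  rw [← h3, ← mul_assoc (single 1 (cInv P _) : Smash P)]
  exact (nilHecke b).mul_mem (elt_mem b _) ((nilHecke b).mul_mem (TNode_mem a) (elt_mem b _))

lemma T_mem (b : P.Base) (w : ExtAffWeyl P) : T b w ∈ nilHecke b := by
  induction w using length_induction (b := b) with
  | fund π hπ =>
    have := T_fund_mul hπ (1 : ExtAffWeyl P)
    rw [mul_one, T_one, mul_one] at this
    rw [this]
    exact elt_mem b π
  | simpleRefl_mul a w h hw =>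
    rw [T_simpleRefl_mul h]
    exact (nilHecke b).mul_mem (TNode_mem a) hw

variable (b) in
/-- The combination of the elements `T_v` with coefficients `f v` in the representation ring. -/
def tComb : (ExtAffWeyl P →₀ RepRing X) →+ Smash P :=
  Finsupp.liftAddHom fun v ↦
    (AddMonoidHom.mulRight (T b v)).comp (scalar P : RepRing X →+* Smash P).toAddMonoidHom

lemma tComb_apply (f : ExtAffWeyl P →₀ RepRing X) :
    tComb b f = f.sum fun v r ↦ scalar P r * T b v := rfl

lemma tComb_single (v : ExtAffWeyl P) (r : RepRing X) :
    tComb b (Finsupp.single v r) = scalar P r * T b v := by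
  rw [tComb_apply, Finsupp.sum_single_index]
  rw [map_zero, zero_mul]

lemma mul_mem_range_tComb {x y : Smash P} (hy : y ∈ (tComb b).range)
    (hx : ∀ v r, x * (scalar P r * T b v) ∈ (tComb b).range) : x * y ∈ (tComb b).range := by
  obtain ⟨f, rfl⟩ := hy
  induction f using Finsupp.induction_linear with
  | zero => rw [map_zero, mul_zero]; exact zero_mem _
  | add f g hf hg => rw [map_add, mul_add]; exact add_mem hf hg
  | single v r => rw [tComb_single]; exact hx v r

/-- The generators preserve the span: `T_a` passes a scalar by the twisted Leibniz rule, after which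
`T_a T_v` is `T_{s_a v}` or `-T_v`, and `Ω` permutes the `T_v`. -/
lemma mul_mem_range_tComb_of_mem {x y : Smash P} (hx : x ∈ nilHecke b)
    (hy : y ∈ (tComb b).range) : x * y ∈ (tComb b).range := by
  have hT (v : ExtAffWeyl P) (r : RepRing X) : scalar P r * T b v ∈ (tComb b).range :=
    ⟨Finsupp.single v r, tComb_single v r⟩
  induction hx using Subring.closure_induction generalizing y with
  | mem x hx =>
    refine mul_mem_range_tComb hy fun v r ↦ ?_
    rcases hx with (⟨r', rfl⟩ | ⟨a, rfl⟩) | ⟨π, hπ, rfl⟩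
    · rw [← mul_assoc, ← map_mul]
      exact hT _ _
    · obtain ⟨r', hr'⟩ := exists_TNode_mul_scalar a r
      rw [← mul_assoc, hr', add_mul, mul_assoc]
      refine add_mem ?_ (hT _ _)
      by_cases h : (v⁻¹ • nodeRoot b a).Pos b
      · rw [← T_simpleRefl_mul h]
        exact hT _ _
      · rw [TNode_mul_T_of_not_pos h, Smash.mul_neg]
        exact neg_mem (hT _ _)
    · rw [← mul_assoc, elt_mul_scalar, mul_assoc, ← T_fund_mul (isFundamental_iff.1 hπ)]
      exact hT _ _
  | zero => rw [zero_mul]; exact zero_mem _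
  | one => rwa [one_mul]
  | add x x' _ _ h h' => rw [add_mul]; exact add_mem (h hy) (h' hy)
  | neg x _ h => rw [Smash.neg_mul]; exact neg_mem (h hy)
  | mul x x' _ _ h h' => rw [mul_assoc]; exact h (h' hy)

lemma mem_range_tComb {x : Smash P} (hx : x ∈ nilHecke b) : x ∈ (tComb b).range := by
  rw [← mul_one x, ← T_one (b := b), ← one_mul (T b 1), ← map_one (scalar P)]
  exact mul_mem_range_tComb_of_mem hx ⟨Finsupp.single 1 1, tComb_single 1 1⟩

end

end AffNilHecke

end

noncomputable section

namespace AffNilHecke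

variable {ι X Y : Type*} [AddCommGroup X] [AddCommGroup Y] {P : RootPairing ι ℤ X Y}
variable {b : P.Base}

open SkewMonoidAlgebra

/-! ### The projection of the nil-Hecke ring to the Peterson algebra -/

variable (P) in
/-- The `LocRep P`-linear projection of the smash product to the span of the translations, with
`t_μ u ↦ t_μ`. -/
def proj : Smash P →+ Smash P := mapDomain (transPart P)

lemma proj_single (w : ExtAffWeyl P) (p : LocRep P) :
    proj P (single w p) = single (transPart P w) p := mapDomain_single

lemma proj_elt (w : ExtAffWeyl P) : proj P (elt w) = elt (transPart P w) := by
  rw [elt_eq_single, proj_single, elt_eq_single]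

lemma proj_neg (x : Smash P) : proj P (-x) = -proj P x :=
  _root_.map_neg (proj P) x

lemma proj_mul_proj (x y : Smash P) : proj P (x * proj P y) = proj P (x * y) :=
  (isTransPart_transPart P).mapDomain_mul_mapDomain x y

lemma proj_proj (x : Smash P) : proj P (proj P x) = proj P x :=
  (isTransPart_transPart P).mapDomain_mapDomain x

lemma proj_proj_mul (x y : Smash P) : proj P (proj P x * y) = proj P x * proj P y :=
  (isTransPart_transPart P).mapDomain_mapDomain_mul x y

lemma proj_mul_comm (x y : Smash P) : proj P x * proj P y = proj P y * proj P x :=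
  (isTransPart_transPart P).mapDomain_mul_comm x y

lemma proj_mul_elt_fin (x : Smash P) (u : P.weylGroup) :
    proj P (x * elt (fin P u)) = proj P x :=
  (isTransPart_transPart P).mapDomain_mul_of (transPart_fin u) x

lemma proj_scalar (r : RepRing X) : proj P (scalar P r) = scalar P r := by
  rw [scalar_eq, proj_single]
  rfl

lemma proj_one : proj P 1 = 1 := by
  rw [← map_one (scalar P), proj_scalar]

lemma proj_scalar_mul (r : RepRing X) (x : Smash P) :
    proj P (scalar P r * x) = scalar P r * proj P x :=
  (isTransPart_transPart P).mapDomain_single_one_mul _ x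

lemma proj_elt_mul (w : ExtAffWeyl P) (x : Smash P) :
    proj P (elt w * x) = elt w * proj P x * elt w⁻¹ * elt (transPart P w) := by
  rw [← proj_elt]
  exact (isTransPart_transPart P).mapDomain_of_mul w x

lemma proj_mul_TNode_inl (x : Smash P) (i : b.support) : proj P (x * TNode b (.inl i)) = 0 :=
  (isTransPart_transPart P).mapDomain_mul_dividedDiff (transPart_fin _) _ x

lemma coeff_proj_of_forall {x : Smash P} {v : ExtAffWeyl P}
    (hx : ∀ w, x.coeff w ≠ 0 → transPart P w = transPart P v → w = v) :
    (proj P x).coeff (transPart P v) = x.coeff v :=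
  coeff_mapDomain_of_forall hx

section

variable [Finite ι] [P.IsReduced]

lemma simpleRefl_mul_fin (a : AffNode b) :
    simpleRefl b a * fin P (RootPairing.weylGroup.ofIdx P (levelZeroIdx b a)) =
      transPart P (simpleRefl b a) := by
  have h := transPart_mul_fin (simpleRefl b a)
  rw [cl_simpleRefl] at h
  nth_rw 1 [← h]
  rw [mul_assoc, ← fin_mul, ofIdx_mul_self]
  exact mul_one _

lemma proj_TNode_mul (a : AffNode b) {y : Smash P} (hy : proj P y = y) :
    proj P (TNode b a * y) =
      (TNode b a * y - y * TNode b a) * (elt (simpleRefl b a) * elt (transPart P (simpleRefl b a))) +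
        y * (TNode b a * elt (fin P (RootPairing.weylGroup.ofIdx P (levelZeroIdx b a))) +
          single 1 (cInv P (levelZeroIdx b a)) *
            (elt (fin P (RootPairing.weylGroup.ofIdx P (levelZeroIdx b a))) - 1)) :=
  (isTransPart_transPart P).mapDomain_dividedDiff_mul (simpleRefl_mul_self a)
    (simpleRefl_mul_fin a) _ hy

variable [Module.Finite ℤ X]

/-! ### The projection preserves the nil-Hecke ring, with the Peterson algebra as image -/

/-- Keeping a fixed point `y` of the projection as a variable makes the induction pass to products:
`x x' y` has the same projection as `x proj (x' y)`. -/
lemma proj_mul_mem {x y : Smash P} (hx : x ∈ nilHecke b) (hy : y ∈ nilHecke b)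
    (hy' : proj P y = y) : proj P (x * y) ∈ nilHecke b := by
  induction hx using Subring.closure_induction generalizing y with
  | mem x hx =>
    rcases hx with (⟨r, rfl⟩ | ⟨a, rfl⟩) | ⟨π, hπ, rfl⟩
    · rw [proj_scalar_mul, hy']
      exact (nilHecke b).mul_mem (scalar_mem r) hy
    · rw [proj_TNode_mul a hy']
      have hT := TNode_mem a
      exact (nilHecke b).add_mem ((nilHecke b).mul_mem ((nilHecke b).sub_mem
          ((nilHecke b).mul_mem hT hy) ((nilHecke b).mul_mem hy hT))
          ((nilHecke b).mul_mem (elt_mem b _) (elt_mem b _)))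
        ((nilHecke b).mul_mem hy ((nilHecke b).add_mem
          ((nilHecke b).mul_mem hT (elt_mem b _)) (cInv_mul_elt_ofIdx_sub_one_mem b _)))
    · rw [proj_elt_mul, hy']
      exact (nilHecke b).mul_mem ((nilHecke b).mul_mem ((nilHecke b).mul_mem (elt_mem b _) hy)
        (elt_mem b _)) (elt_mem b _)
  | zero => rw [zero_mul, map_zero]; exact (nilHecke b).zero_mem
  | one => rwa [one_mul, hy']
  | add x x' _ _ h h' => rw [add_mul, map_add]; exact (nilHecke b).add_mem (h hy hy') (h' hy hy')
  | neg x _ h => rw [Smash.neg_mul, proj_neg]; exact (nilHecke b).neg_mem (h hy hy')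
  | mul x x' _ _ h h' =>
    rw [mul_assoc, ← proj_mul_proj]
    exact h (h' hy hy') (proj_proj _)

lemma proj_mem {x : Smash P} (hx : x ∈ nilHecke b) : proj P x ∈ nilHecke b := by
  rw [← mul_one x]
  exact proj_mul_mem hx (nilHecke b).one_mem proj_one

/-- Commuting with `e^y` and comparing coefficients at `w` gives `e^{cl(w) y} = e^y` for all `y`
whenever the coefficient is nonzero; so the support consists of translations. -/
lemma proj_eq_self_of_mem_peterson {x : Smash P} (hx : x ∈ peterson b) : proj P x = x := by
  have key (w : ExtAffWeyl P) (hw : x.coeff w ≠ 0) : transPart P w = w := by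
    have h1 : cl P w = 1 := by
      refine weylGroup_smul_injective fun y ↦ ?_
      have h2 := (Subring.mem_centralizer_iff.1 hx.2) _ ⟨AddMonoidAlgebra.single y 1, rfl⟩
      have h3 := congrArg (fun z : Smash P ↦ z.coeff w) h2
      simp only [scalar_eq, coeff_single_one_mul, coeff_mul_single_one] at h3
      rw [mul_comm, smul_algebraMap, repAct_single] at h3
      have h4 := algebraMap_locRep_injective (mul_left_cancel₀ hw h3)
      rw [one_smul]
      exact (AddMonoidAlgebra.of_injective (R := ℤ) (M := X) (Multiplicative.ofAdd.injective h4)).symm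
    have h2 := transPart_mul_fin w
    rwa [h1, show fin P (1 : P.weylGroup) = 1 from rfl, mul_one] at h2
  refine (SkewMonoidAlgebra.sum_congr fun w hw ↦ ?_).trans x.sum_single
  rw [key w (mem_support_iff.1 hw)]

lemma mem_peterson_iff {x : Smash P} : x ∈ peterson b ↔ x ∈ nilHecke b ∧ proj P x = x := by
  refine ⟨fun h ↦ ⟨h.1, proj_eq_self_of_mem_peterson h⟩, fun ⟨h1, h2⟩ ↦ ⟨h1, ?_⟩⟩
  refine Subring.mem_centralizer_iff.2 ?_
  rintro _ ⟨r, rfl⟩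
  rw [← h2, ← proj_scalar, proj_mul_comm]

/-! ### Projections of the `T_w` and the classes `k_w` -/

omit [Module.Finite ℤ X] in
lemma invLength_simpleRefl (a : AffNode b) : invLength b (simpleRefl b a) = 1 := by
  have := invLength_mul_simpleRefl (w := (1 : ExtAffWeyl P)) (a := a)
    (by rw [one_smul]; exact pos_nodeRoot (b := b) _)
  rwa [one_mul, invLength_one] at this

/-- A finite right descent `s_i` of `w` gives `T_w = T_{w s_i} T_i`. -/
lemma proj_T_of_not_isGrassmannian {w : ExtAffWeyl P} (hw : ¬ IsGrassmannian b w) :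
    proj P (T b w) = 0 := by
  rw [isGrassmannian_iff] at hw
  push Not at hw
  obtain ⟨i, hi⟩ := hw
  have h1 := invLength_mul_simpleRefl_of_not_pos hi
  have h2 : w * simpleRefl b (.inl i) * simpleRefl b (.inl i) = w := by
    rw [mul_assoc, simpleRefl_mul_self, mul_one]
  rw [← h2, T_mul, T_simpleRefl, proj_mul_TNode_inl]
  rw [h2, invLength_simpleRefl, h1]

/-- Equal translation parts mean that `w` lies in `vW`, where `v` is strictly shortest. -/
lemma IsGrassmannian.eq_of_transPart_eq {v w : ExtAffWeyl P} (hv : IsGrassmannian b v)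
    (h : transPart P w = transPart P v) (hl : invLength b w ≤ invLength b v) : w = v := by
  have h1 : w = v * fin P ((cl P v)⁻¹ * cl P w) := by
    calc w = transPart P v * fin P (cl P w) := by rw [← h, transPart_mul_fin]
      _ = transPart P v * fin P (cl P v * ((cl P v)⁻¹ * cl P w)) := by rw [mul_inv_cancel_left]
      _ = v * fin P ((cl P v)⁻¹ * cl P w) := by
        rw [fin_mul, ← mul_assoc, transPart_mul_fin]
  rw [h1, hv.invLength_mul_fin] at hl
  have h2 : (cl P v)⁻¹ * cl P w = 1 := invLength_fin_eq_zero (b := b) (by omega)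
  rw [h1, h2, show fin P (1 : P.weylGroup) = 1 from rfl, mul_one]

/-- Besides `v`, the support of `T_v` contains only shorter elements, and none of these lies in
`vW`; so nothing cancels the leading coefficient. -/
lemma coeff_proj_T {v : ExtAffWeyl P} (hv : IsGrassmannian b v) :
    (proj P (T b v)).coeff (transPart P v) ≠ 0 := by
  rw [coeff_proj_of_forall fun w hw h ↦ ?_]
  · exact (coeff_T b v).1
  · refine hv.eq_of_transPart_eq h ?_
    rcases (coeff_T b v).2 w hw with rfl | h
    exacts [le_rfl, h.le]

lemma coeff_proj_T_eq_zero {v w : ExtAffWeyl P} (hv : IsGrassmannian b v)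
    (hl : invLength b w ≤ invLength b v) (hne : w ≠ v) :
    (proj P (T b w)).coeff (transPart P v) = 0 := by
  have key (u : ExtAffWeyl P) (hu : (T b w).coeff u ≠ 0) (h : transPart P u = transPart P v) :
      u = v ∧ u = w := by
    rcases (coeff_T b w).2 u hu with rfl | hlt
    · exact ⟨hv.eq_of_transPart_eq h hl, rfl⟩
    · have := hv.eq_of_transPart_eq h (by omega)
      subst this
      omega
  rw [coeff_proj_of_forall fun u hu h ↦ (key u hu h).1]
  by_contra h
  exact hne ((key v h rfl).2.symm)

lemma proj_tComb (f : ExtAffWeyl P →₀ RepRing X) :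
    proj P (tComb b f) = f.sum fun v r ↦ scalar P r * proj P (T b v) := by
  rw [tComb_apply, Finsupp.sum, Finsupp.sum, _root_.map_sum]
  exact Finset.sum_congr rfl fun v _ ↦ proj_scalar_mul _ _

/-- The projections of the `T_v` for affine Grassmannian `v` are linearly independent. -/
lemma not_isGrassmannian_of_proj_tComb_eq_zero {f : ExtAffWeyl P →₀ RepRing X}
    (h : proj P (tComb b f) = 0) {v : ExtAffWeyl P} (hv : v ∈ f.support) :
    ¬ IsGrassmannian b v := by
  classical
  intro hv'
  -- For a longest affine Grassmannian index `w`, no other term contributes to the coefficient at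
  -- the translation part of `w`.
  obtain ⟨w, hw, hmax⟩ := (f.support.filter (IsGrassmannian b)).exists_max_image (invLength b)
    ⟨v, Finset.mem_filter.2 ⟨hv, hv'⟩⟩
  rw [Finset.mem_filter] at hw
  rw [proj_tComb, Finsupp.sum, Finset.sum_eq_add_sum_sdiff_singleton_of_mem hw.1] at h
  have h1 := congrArg (fun z : Smash P ↦ z.coeff (transPart P w)) h
  have h2 : (∑ u ∈ f.support \ {w}, scalar P (f u) * proj P (T b u)).coeff (transPart P w) = 0 := by
    refine Finset.sum_induction _ (fun z : Smash P ↦ z.coeff (transPart P w) = 0)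
      (fun x y hx hy ↦ ?_) rfl fun u hu ↦ ?_
    · rw [coeff_add, Finsupp.add_apply, hx, hy, add_zero]
    · rw [Finset.mem_sdiff, Finset.mem_singleton] at hu
      rw [scalar_eq, coeff_single_one_mul]
      by_cases hG : IsGrassmannian b u
      · rw [coeff_proj_T_eq_zero hw.2 (hmax u (Finset.mem_filter.2 ⟨hu.1, hG⟩)) hu.2, mul_zero]
      · rw [proj_T_of_not_isGrassmannian hG, coeff_zero, Finsupp.zero_apply, mul_zero]
  simp only [coeff_add, Finsupp.add_apply, h2, add_zero] at h1
  rw [scalar_eq, coeff_single_one_mul, coeff_zero, Finsupp.zero_apply] at h1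
  rcases mul_eq_zero.1 h1 with h3 | h3
  · rw [← map_zero (algebraMap (RepRing X) (LocRep P))] at h3
    exact Finsupp.mem_support_iff.1 hw.1 (algebraMap_locRep_injective h3)
  · exact coeff_proj_T hw.2 h3

/-- `proj T_w - T_w` lies in the nil-Hecke ring and in the kernel of the projection. Expanded in the
`T_v`, it involves no affine Grassmannian index, by linear independence. -/
lemma isKClass_proj_T (b : P.Base) (w : ExtAffWeyl P) : IsKClass b w (proj P (T b w)) := by
  have hm := proj_mem (T_mem b w)
  refine ⟨mem_peterson_iff.2 ⟨hm, proj_proj _⟩, ?_⟩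
  obtain ⟨f, hf⟩ := mem_range_tComb ((nilHecke b).sub_mem hm (T_mem b w))
  refine ⟨f, fun v hv ↦ not_isGrassmannian_of_proj_tComb_eq_zero ?_ hv, ?_⟩
  · rw [hf, map_sub, proj_proj, sub_self]
  · rw [← tComb_apply, hf]
    abel

/-- The projection fixes such an element and kills all its terms except `T_w`. -/
lemma existsUnique_isKClass (b : P.Base) (w : ExtAffWeyl P) : ∃! x, IsKClass b w x := by
  refine ⟨_, isKClass_proj_T b w, ?_⟩
  rintro x ⟨hx, f, hf, h⟩
  rw [← proj_eq_self_of_mem_peterson hx, h, map_add, ← tComb_apply, proj_tComb,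
    Finsupp.sum, Finset.sum_eq_zero, add_zero]
  intro v hv
  rw [proj_T_of_not_isGrassmannian (hf v hv), mul_zero]

lemma kClass_eq (b : P.Base) (w : ExtAffWeyl P) : kClass b w = proj P (T b w) :=
  (existsUnique_isKClass b w).unique (Classical.epsilon_spec (existsUnique_isKClass b w).exists)
    (isKClass_proj_T b w)

end

end AffNilHecke

end

noncomputable section

namespace AffNilHecke

variable {ι X Y : Type*} [AddCommGroup X] [AddCommGroup Y] {P : RootPairing ι ℤ X Y}
variable {b : P.Base}

open SkewMonoidAlgebra

variable [Finite ι] [P.IsReduced]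

/-! ### Products of the elements `ℓ_w` -/

lemma _root_.SkewMonoidAlgebra.add_left_cancel' {L G : Type*} [CommRing L] [Group G]
    [MulSemiringAction G L] {x y z : SkewMonoidAlgebra L G} (h : x + y = x + z) : y = z :=
  _root_.add_left_cancel h

omit [Finite ι] [P.IsReduced] in
lemma Smash.add_left_cancel {x y z : Smash P} (h : x + y = x + z) : y = z :=
  SkewMonoidAlgebra.add_left_cancel' h

lemma fin_induction (b : P.Base) {p : P.weylGroup → Prop} (one : p 1)
    (mul : ∀ u (i : b.support), p u → p (u * RootPairing.weylGroup.ofIdx P i)) (u : P.weylGroup) :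
    p u := by
  induction hn : invLength b (fin P u) using Nat.strong_induction_on generalizing u with
  | _ n ih =>
    by_cases h0 : invLength b (fin P u) = 0
    · rwa [invLength_fin_eq_zero h0]
    · rw [invLength_eq_zero_iff] at h0
      push Not at h0
      obtain ⟨i | j, ha⟩ := h0
      · have h1 := invLength_mul_simpleRefl_of_not_pos ha
        have h2 : fin P u * simpleRefl b (.inl i) = fin P (u * RootPairing.weylGroup.ofIdx P i) :=
          (fin_mul _ _).symm
        rw [h2] at h1
        have h3 := mul _ i (ih _ (by omega) (u * RootPairing.weylGroup.ofIdx P i) rfl)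
        rwa [mul_assoc, ofIdx_mul_self, mul_one] at h3
      -- Finite elements preserve levels, so an affine node, whose root has level `1`, is never a
      -- descent.
      · refine absurd ?_ ha
        rw [show nodeRoot b (.inr j) = AffRoot.mk P (P.reflectionPerm j j) 1 from rfl, fin_smul]
        exact .inl one_pos

variable [Module.Finite ℤ X]

/-- The terms that are not affine Grassmannian project to zero and may be added freely, which
replaces the sum by one with a product formula. -/
lemma ellClass_eq (b : P.Base) (w : ExtAffWeyl P) : ellClass b w = proj P (lowerSum b w) := by
  classical
  have h : {v | IsGrassmannian b v ∧ bruhatLE b v w} =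
      ↑((finite_bruhatChain b w).toFinset.filter (IsGrassmannian b)) := by
    ext v
    simp [bruhatLE_iff, and_comm]
  rw [ellClass, h, finsum_mem_coe_finset, lowerSum, _root_.map_sum,
    Finset.sum_congr rfl fun v _ ↦ kClass_eq b v]
  refine Finset.sum_filter_of_ne fun v _ hv ↦ ?_
  by_contra hG
  exact hv (proj_T_of_not_isGrassmannian hG)

/-- From `s_i x = c(α_i) T_i x + x` the elements `s_i x` and `x` have the same projection, while the
projection of `s_i x` is `s_i proj (x) s_i⁻¹`. -/
lemma elt_mul_proj_comm_of_proj_TNode_mul_eq_zero {i : b.support} {x : Smash P}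
    (h : proj P (TNode b (.inl i) * x) = 0) :
    elt (simpleRefl b (.inl i)) * proj P x = proj P x * elt (simpleRefl b (.inl i)) := by
  have h1 : elt (simpleRefl b (.inl i)) * x =
      scalar P (c (P.root (levelZeroIdx b (.inl i)))) * (TNode b (.inl i) * x) + x := by
    rw [← mul_assoc, scalar_c_mul_TNode, Smash.sub_mul, one_mul]
    abel
  have h2 := proj_elt_mul (simpleRefl b (.inl i)) x
  rw [show transPart P (simpleRefl b (.inl i)) = 1 from transPart_fin _, elt_one, mul_one, h1,
    map_add, proj_scalar_mul, h, mul_zero, zero_add] at h2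
  nth_rw 2 [h2]
  rw [mul_assoc, elt_inv_mul, mul_one]

/-- If `⟨μ, α_i⟩ < 0`, then `s_i` is a left descent of `t_μ` and the product itself is zero. If `⟨μ,
α_i⟩ = 0`, then `s_i` commutes with `t_μ`, so `T_i` can be moved to the right end, where the
projection kills it. -/
lemma proj_TNode_mul_lowerSum_trans (i : b.support) {μ : Y} (hμ : IsAntidominant b μ) :
    proj P (TNode b (.inl i) * lowerSum b (trans P μ)) = 0 := by
  have hs : (trans P μ)⁻¹ • nodeRoot b (.inl i) =
      AffRoot.mk P i (P.toLinearMap (P.root i) μ) := by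
    rw [← trans_neg, show nodeRoot b (.inl i) = AffRoot.mk P i 0 from rfl, trans_smul]
    simp
  rcases (hμ i i.2).lt_or_eq with h | h
  · have h1 : ¬ ((trans P μ)⁻¹ • nodeRoot b (.inl i)).Pos b := by
      rw [hs]
      rintro (h' | h')
      · exact absurd h h'.not_gt
      · exact h.ne h'.1
    have h2 := lowerSum_simpleRefl_mul_of_not_pos h1
    rw [add_mul, one_mul] at h2
    rw [Smash.add_left_cancel (h2.trans (add_zero _).symm), map_zero]
  · rw [h] at hs
    have h1 : ((trans P μ)⁻¹ • nodeRoot b (.inl i)).Pos b := by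
      rw [hs]
      exact pos_nodeRoot (b := b) (.inl i)
    have h2 : simpleRefl b (.inl i) * trans P μ = trans P μ * simpleRefl b (.inl i) := by
      have h3 := affRefl_conj (trans P μ) (nodeRoot b (.inl i))
      have h6 : trans P μ • nodeRoot b (.inl i) = nodeRoot b (.inl i) := (inv_smul_eq_iff.1 hs).symm
      rw [h6, ← simpleRefl_eq] at h3
      nth_rw 1 [← h3]
      group
    have h5 := lowerSum_simpleRefl_mul h1
    rw [h2, lowerSum_mul (by rw [← h2, invLength_simpleRefl_mul h1,
        invLength_simpleRefl]), lowerSum_simpleRefl,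
      mul_add, add_mul, mul_one, one_mul] at h5
    rw [← Smash.add_left_cancel h5, proj_mul_TNode_inl]

lemma elt_fin_mul_proj_lowerSum_trans (u : P.weylGroup) {μ : Y} (hμ : IsAntidominant b μ) :
    elt (fin P u) * proj P (lowerSum b (trans P μ)) =
      proj P (lowerSum b (trans P μ)) * elt (fin P u) := by
  induction u using fin_induction b with
  | one => rw [show fin P (1 : P.weylGroup) = 1 from rfl, elt_one, one_mul, mul_one]
  | mul u i hu =>
    have h := elt_mul_proj_comm_of_proj_TNode_mul_eq_zero (proj_TNode_mul_lowerSum_trans i hμ)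
    rw [show simpleRefl b (.inl i) = fin P (RootPairing.weylGroup.ofIdx P i) from rfl] at h
    rw [fin_mul, elt_mul, mul_assoc, h, ← mul_assoc, hu, mul_assoc]

omit [Finite ι] [P.IsReduced] [Module.Finite ℤ X] in
/-- The projection is right linear over the Weyl group invariants. -/
lemma proj_mul_proj_of_comm {y : Smash P}
    (h : ∀ u, elt (fin P u) * proj P y = proj P y * elt (fin P u)) (x : Smash P) :
    proj P (x * proj P y) = proj P x * proj P y := by
  induction x using SkewMonoidAlgebra.induction_on with
  | zero => rw [zero_mul, map_zero, zero_mul]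
  | add x x' hx hx' => rw [add_mul, map_add, map_add, add_mul, hx, hx']
  | single v p =>
    -- Write `v` as a translation times a finite element; the latter passes `proj y` and is absorbed
    -- by the projection at the right end.
    have h1 : (single v p : Smash P) = proj P (single v p) * elt (fin P (cl P v)) := by
      rw [proj_single, single_mul_elt, transPart_mul_fin]
    nth_rw 1 [h1]
    rw [mul_assoc, h, ← mul_assoc, proj_mul_elt_fin, proj_proj_mul, proj_proj]

lemma proj_mul_lowerSum_trans (x : Smash P) {μ : Y} (hμ : IsAntidominant b μ) :
    proj P (x * lowerSum b (trans P μ)) = proj P x * ellClass b (trans P μ) := by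
  rw [ellClass_eq, ← proj_mul_proj]
  exact proj_mul_proj_of_comm (fun u ↦ elt_fin_mul_proj_lowerSum_trans u hμ) x

lemma ellClass_mul_trans {w : ExtAffWeyl P} (hw : IsGrassmannian b w) {μ : Y}
    (hμ : IsAntidominant b μ) :
    ellClass b (w * trans P μ) = ellClass b w * ellClass b (trans P μ) := by
  rw [ellClass_eq b (w * _), lowerSum_mul (hw.invLength_mul_trans hμ), proj_mul_lowerSum_trans _ hμ,
    ellClass_eq b w]

/-! ### Minuscule translations -/

omit [Module.Finite ℤ X] in
-- The affine Weyl group is generated by reflections, and conjugates of reflections are reflections.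
lemma conj_mem_affineSubgroup (π : ExtAffWeyl P) {v : ExtAffWeyl P}
    (hv : v ∈ affineSubgroup b) : π * v * π⁻¹ ∈ affineSubgroup b := by
  obtain ⟨l, rfl⟩ := exists_wordProd_eq_of_isAffine hv
  induction l with
  | nil =>
    rw [wordProd_nil, mul_one, mul_inv_cancel]
    exact one_mem _
  | cons a l ih =>
    have h1 : π * wordProd b (a :: l) * π⁻¹ =
        (π * simpleRefl b a * π⁻¹) * (π * wordProd b l * π⁻¹) := by
      rw [wordProd_cons]
      group
    rw [h1, simpleRefl_eq, affRefl_conj]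
    exact mul_mem (affRefl_mem_affineSubgroup _) (ih (wordProd_mem_affineSubgroup l))

omit [Module.Finite ℤ X] in
-- If `t_ϖ = π v`, then `t_{-ϖ} = π⁻¹ (π v⁻¹ π⁻¹)`, and the bracket is affine by normality.
lemma kappa_eq (b : P.Base) (ϖ : Y) : kappa b ϖ = fundElt b ϖ * trans P (-ϖ) := by
  have h1 := fundPart_mul_affPart b (trans P ϖ)
  have hπ' : invLength b (fundElt b ϖ)⁻¹ = 0 := by rw [invLength_inv]; exact invLength_fundPart _
  refine (fundPart_eq_and_affPart_eq hπ' ?_ (inv_mul_cancel_left _ _).symm).2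
  have h2 : fundElt b ϖ * trans P (-ϖ) =
      fundElt b ϖ * (affPart b (trans P ϖ))⁻¹ * (fundElt b ϖ)⁻¹ := by
    rw [trans_neg, ← h1, mul_inv_rev, mul_assoc]
    rw [h1]
    rfl
  rw [h2]
  exact conj_mem_affineSubgroup _ (inv_mem (affPart_mem _))

omit [Module.Finite ℤ X] in
lemma IsGrassmannian.fund_mul {π w : ExtAffWeyl P} (hπ : invLength b π = 0)
    (hw : IsGrassmannian b w) : IsGrassmannian b (π * w) := by
  rw [isGrassmannian_iff] at hw ⊢
  intro i
  rw [mul_smul]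
  exact pos_smul_of_invLength_eq_zero hπ (hw i)

omit [Module.Finite ℤ X] in
-- For `j ≠ i` the translation fixes `α_j`. For `j = i` the root `t_ϖ α_i = α_i - δ` is negative, so
-- `s_i` is a left descent of `t_{-ϖ}`, and additivity of lengths makes `w α_i` positive.
lemma IsGrassmannian.of_mul_trans_neg {i : ι} {ϖ : Y} (hϖ : IsFundCoweight b i ϖ)
    {w : ExtAffWeyl P} (hw : IsGrassmannian b (w * trans P (-ϖ)))
    (hl : invLength b (w * trans P (-ϖ)) = invLength b w + invLength b (trans P (-ϖ))) :
    IsGrassmannian b w := by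
  rw [isGrassmannian_iff] at hw ⊢
  intro j
  by_cases hj : (j : ι) = i
  · refine pos_smul_nodeRoot_of_invLength_mul hl ?_
    rw [← trans_neg, neg_neg, show nodeRoot b (.inl j) = AffRoot.mk P j 0 from rfl, trans_smul, hj,
      hϖ.1]
    rintro (h | h)
    · exact absurd h (by change ¬ (0 : ℤ) < 0 - 1; decide)
    · exact absurd h.1 (by change ¬ (0 : ℤ) - 1 = 0; decide)
  · have h := hw j
    rwa [mul_smul, show nodeRoot b (.inl j) = AffRoot.mk P j 0 from rfl, trans_smul, map_neg,
      hϖ.2 j j.2 hj, neg_zero, sub_zero] at h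

omit [Finite ι] [P.IsReduced] [Module.Finite ℤ X] in
-- Conjugation by a group element maps translations to translations.
lemma proj_conj (w : ExtAffWeyl P) (x : Smash P) :
    proj P (elt w * proj P x * elt w⁻¹) = elt w * proj P x * elt w⁻¹ := by
  have h : elt w * elt (transPart P w⁻¹) * elt w⁻¹ * elt (transPart P w) = 1 := by
    rw [← elt_mul, ← elt_mul, ← elt_mul, ← (isTransPart_transPart P).map_mul, mul_inv_cancel,
      (isTransPart_transPart P).map_one, elt_one]
  rw [mul_assoc, proj_elt_mul, proj_proj_mul, proj_elt]
  calc _ = elt w * proj P x * elt w⁻¹ *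
        (elt w * elt (transPart P w⁻¹) * elt w⁻¹ * elt (transPart P w)) := by
        simp only [← mul_assoc]
        rw [mul_assoc _ (elt w⁻¹) (elt w), elt_inv_mul, mul_one]
    _ = _ := by rw [h, mul_one, mul_assoc]

lemma IsFundCoweight.isAntidominant_neg {i : ι} {ϖ : Y} (hϖ : IsFundCoweight b i ϖ) :
    IsAntidominant b (-ϖ) := by
  intro j hj
  rw [map_neg]
  by_cases h : j = i
  · rw [h, hϖ.1]
    decide
  · rw [hϖ.2 j hj h, neg_zero]

/-- With `w' = π⁻¹ w π` the left side is `π ℓ_{w'} π⁻¹ proj (π) ℓ_{t_{-ϖ}}`, and `ℓ_κ = proj (π)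
ℓ_{t_{-ϖ}}`; the factors lie in the commutative span of the translations. -/
lemma ellClass_mul_kappa {i : ι} {ϖ : Y} (hϖ : IsFundCoweight b i ϖ) {w : ExtAffWeyl P}
    (hl : invLength b (w * kappa b ϖ) = invLength b w + invLength b (kappa b ϖ)) :
    ellClass b (w * kappa b ϖ) = ellClass b (kappa b ϖ) *
      (elt (fundElt b ϖ) * ellClass b ((fundElt b ϖ)⁻¹ * w * fundElt b ϖ) *
        elt (fundElt b ϖ)⁻¹) := by
  have hπ : invLength b (fundElt b ϖ) = 0 := invLength_fundPart _
  have hμ := hϖ.isAntidominant_neg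
  rw [kappa_eq] at hl ⊢
  set π := fundElt b ϖ
  have h1 : w * (π * trans P (-ϖ)) = π * (π⁻¹ * w * π) * trans P (-ϖ) := by group
  have h2 : invLength b (π * (π⁻¹ * w * π) * trans P (-ϖ)) =
      invLength b (π * (π⁻¹ * w * π)) + invLength b (trans P (-ϖ)) := by
    rw [← h1, hl, invLength_mul_of_left hπ, show π * (π⁻¹ * w * π) = w * π by group,
      invLength_mul_of_right hπ]
  rw [h1, ellClass_eq b (π * (π⁻¹ * w * π) * trans P (-ϖ)), lowerSum_mul h2,
    proj_mul_lowerSum_trans _ hμ, lowerSum_fund_mul hπ, proj_elt_mul, ellClass_eq b (π⁻¹ * w * π),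
    mul_assoc, ← proj_elt]
  rw [ellClass_eq b (π * _), lowerSum_fund_mul hπ, proj_mul_lowerSum_trans _ hμ, ← proj_conj,
    ellClass_eq b (trans P _), ← proj_proj_mul, proj_mul_comm]

end AffNilHecke

end

/-! ### The factorization theorem -/

theorem propositionP {ι X Y : Type*} [Finite ι] [AddCommGroup X] [AddCommGroup Y]
    [Module.Finite ℤ X] [Module.Finite ℤ Y]
    (P : RootPairing ι ℤ X Y) [P.IsReduced] (b : P.Base) :
    -- the objects of the statement are well defined
    ((∀ w, ∃! p, AffNilHecke.IsFundAffDecomp b w p) ∧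
      (∀ w, ∃! x, AffNilHecke.IsTElt b w x) ∧
      (∀ w, AffNilHecke.IsGrassmannian b w → ∃! x, AffNilHecke.IsKClass b w x) ∧
      (∀ w, {v | AffNilHecke.bruhatLE b v w}.Finite)) ∧
    -- multiplication by an antidominant translation
    (∀ (w : AffNilHecke.ExtAffWeyl P) (μ : Y),
      AffNilHecke.IsGrassmannian b w → AffNilHecke.IsAntidominant b μ →
      AffNilHecke.IsGrassmannian b (w * AffNilHecke.trans P μ) ∧
      AffNilHecke.length b (w * AffNilHecke.trans P μ) =
        AffNilHecke.length b w + AffNilHecke.length b (AffNilHecke.trans P μ) ∧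
      AffNilHecke.ellClass b (w * AffNilHecke.trans P μ) =
        AffNilHecke.ellClass b w * AffNilHecke.ellClass b (AffNilHecke.trans P μ)) ∧
    -- the `k`-rectangle factorization
    (∀ i ∈ b.support, ∀ ϖ : Y, AffNilHecke.IsFundCoweight b i ϖ →
      ∀ w : AffNilHecke.ExtAffWeyl P,
      AffNilHecke.IsGrassmannian b (w * AffNilHecke.kappa b ϖ) →
      AffNilHecke.length b (w * AffNilHecke.kappa b ϖ) =
        AffNilHecke.length b w + AffNilHecke.length b (AffNilHecke.kappa b ϖ) →
      AffNilHecke.IsGrassmannian b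
        ((AffNilHecke.fundElt b ϖ)⁻¹ * w * AffNilHecke.fundElt b ϖ) ∧
      AffNilHecke.ellClass b (w * AffNilHecke.kappa b ϖ) =
        AffNilHecke.ellClass b (AffNilHecke.kappa b ϖ) *
          (AffNilHecke.elt (AffNilHecke.fundElt b ϖ) *
            AffNilHecke.ellClass b
              ((AffNilHecke.fundElt b ϖ)⁻¹ * w * AffNilHecke.fundElt b ϖ) *
            AffNilHecke.elt (AffNilHecke.fundElt b ϖ)⁻¹)) := by
  refine ⟨⟨fun w ↦ AffNilHecke.existsUnique_isFundAffDecomp b w,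
    fun w ↦ AffNilHecke.existsUnique_isTElt b w,
    fun w _ ↦ AffNilHecke.existsUnique_isKClass b w, fun w ↦ ?_⟩, fun w μ hw hμ ↦ ?_,
    fun i _ ϖ hϖ w hw hl ↦ ?_⟩
  · simp_rw [AffNilHecke.bruhatLE_iff]
    exact AffNilHecke.finite_bruhatChain b w
  · simp_rw [AffNilHecke.length_eq]
    exact ⟨hw.mul_trans hμ, hw.invLength_mul_trans hμ, AffNilHecke.ellClass_mul_trans hw hμ⟩
  · simp_rw [AffNilHecke.length_eq] at hl
    refine ⟨?_, AffNilHecke.ellClass_mul_kappa hϖ hl⟩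
    have hπ : AffNilHecke.invLength b (AffNilHecke.fundElt b ϖ) = 0 :=
      AffNilHecke.invLength_fundPart _
    rw [mul_assoc]
    refine AffNilHecke.IsGrassmannian.fund_mul (by rw [AffNilHecke.invLength_inv, hπ]) ?_
    -- As `w κ = (w π) t_{-ϖ}`, the criterion applies to `w π`; multiplication by `π` on either side
    -- does not change lengths.
    rw [AffNilHecke.kappa_eq, ← mul_assoc] at hw hl
    refine AffNilHecke.IsGrassmannian.of_mul_trans_neg hϖ hw ?_
    rw [hl, AffNilHecke.invLength_mul_of_left hπ, AffNilHecke.invLength_mul_of_right hπ]
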